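/- **Setting.** Let $A$ be a field, $\mathcal D(A)$ a commutative $A$-algebra with a finite $A$-basis $(\epsilon_0,\dots,\epsilon_{\ell-1})$, and $\pi:\mathcal D(A)\to A$ an $A$-algebra homomorphism with $\pi(\epsilon_0)=1$ and $\pi(\epsilon_i)=0$ for $i\ge 1$. Suppose $\mathcal D(A)=\prod_{i=0}^{t}B_i$ with each $B_i$ a local $A$-algebra with residue field $A$; let $\pi_i:\mathcal D(A)\to B_i\to A$ be the projection to $B_i$ followed by the residue map, numbered so that $\pi_0=\pi$. For an $A$-algebra $R$ put $\mathcal D(R)=R\otimes_A\mathcal D(A)$. A $\mathcal D$-ring is a commutative $A$-algebra $R$ with maps $\partial_1,\dots,\partial_{\ell-1}:R\to R$ such that $e:R\to\mathcal D(R)$, $e(r)=r\epsilon_0+\partial_1(r)\epsilon_1+\cdots+\partial_{\ell-1}(r)\epsilon_{\ell-1}$, is an $A$-algebra homomorphism; a $\mathcal D$-field is a $\mathcal D$-ring which is a field. The associated endomorphisms of $R$ are $\sigma_i=(\mathrm{id}_R\otimes\pi_i)\circ e$, $i=0,\dots,t$; thus $\sigma_0=\mathrm{id}$. Let $\mathcal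 L_{\mathcal D}=\{0,1,+,-,\times,(\lambda_a)_{a\in A},\partial_1,\dots,\partial_{\ell-1}\}$, where $\lambda_a$ is scalar multiplication by $a$, and call a formula of the sublanguage $\{0,1,+,-,\times,(\lambda_a)_{a\in A}\}$ a ring formula (over $A$). Let $\mathcal D\text{-}\mathrm{CF}_0$ be the model companion of the theory of $\mathcal D$-fields of characteristic zero, i.e. the $\mathcal L_{\mathcal D}$-theory of the existentially closed $\mathcal D$-fields of characteristic zero. In its models $\sigma_1,\dots,\sigma_t$ are bijective; let $\Theta$ be the set of finite words in $\{\partial_1,\dots,\partial_{\ell-1},\sigma_1^{-1},\dots,\sigma_t^{-1}\}$. **Corollary (Quantifier Reduction).** Every $\mathcal L_{\mathcal D}$-formula $\phi(x_1,\dots,x_n)$ is equivalent modulo $\mathcal D\text{-}\mathrm{CF}_0$ to an $\mathcal L_{\mathcal D}$-formula of the form $\exists y\,\psi(x_1,\dots,x_n,y)$ ($y$ a single variable) such that, in all models of $\mathcal D\text{-}\mathrm{CF}_0$, $\psi(x_1,\dots,x_n,y)$ holds if and only if $\xi(\bar x,\bar y)$ holds, where * $\bar x$ is a finite tuple whose coordinates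 are of the form $\theta x_i$ with $\theta\in\Theta$ and $1\le i\le n$, $\bar y=(y,\sigma_1(y),\dots,\sigma_t(y))$, and $\xi$ is a quantifier-free ring formula over $A$ in disjunctive normal form (possibly with no disjuncts); * each disjunct of $\xi$ contains, for some $N\ge 0$ and some polynomials $t_0,\dots,t_N$ over $A$, the conjuncts $t_N(\bar x)\neq 0$ and $\sum_{j=0}^{N}t_j(\bar x)y^j=0$. In particular, when the associated endomorphisms are all trivial (that is, $\sigma_i=\mathrm{id}$ for all $i$ in every model of $\mathcal D\text{-}\mathrm{CF}_0$), the existential quantifier may be omitted and there is quantifier elimination: every $\mathcal L_{\mathcal D}$-formula $\phi(x_1,\dots,x_n)$ is equivalent modulo $\mathcal D\text{-}\mathrm{CF}_0$ to a quantifier-free $\mathcal L_{\mathcal D}$-formula which, in all models of $\mathcal D\text{-}\mathrm{CF}_0$, holds if and only if $\xi(\bar x)$ holds, where $\xi$ is a quantifier-free ring formula over $A$ and the coordinates of $\bar x$ are of the form $\theta x_i$ with $\theta\in\Theta$. -/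

import Mathlib

universe u v w

open scoped TensorProduct

namespace FreeOp

open FirstOrder FirstOrder.Language

/-! ## The data `(A, 𝒟, π, ε)` -/

/-- Data over a field `A`: the finite free `A`-algebra `D = 𝒟(A)`, an `A`-algebra homomorphism
`π : D → A`, and an `A`-basis `ε₀, …, ε_m` (so `ℓ = m + 1`) such that
`π ε₀ = 1` and `π εᵢ = 0` for `i ≥ 1`. -/
structure OperatorData (A : Type u) [Field A] (D : Type v) [CommRing D] [Algebra A D]
    (m : ℕ) where
  proj : D →ₐ[A] A
  basis : Module.Basis (Fin (m + 1)) A D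
  proj_basis_zero : proj (basis 0) = 1
  proj_basis_succ : ∀ i : Fin m, proj (basis i.succ) = 0

/-- A decomposition `D = B₀ × ⋯ × B_t` into local `A`-algebras all of whose residue fields are
`A`. An `A`-algebra homomorphism `res i : Bᵢ → A` out of a local ring is necessarily the residue
map, and it exists exactly when the residue field of `Bᵢ` is `A`. The factor `B₀` is the one
whose maximal ideal corresponds to the kernel of `π`. -/
structure LocalDecomposition {A : Type u} [Field A] {D : Type v} [CommRing D] [Algebra A D]
    {m : ℕ} (S : OperatorData A D m) (t : ℕ) where
  B : Fin (t + 1) → Type v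
  [commRing : ∀ i, CommRing (B i)]
  [algebra : ∀ i, Algebra A (B i)]
  [isLocalRing : ∀ i, IsLocalRing (B i)]
  equiv : D ≃ₐ[A] (∀ i, B i)
  res : ∀ i, B i →ₐ[A] A
  res_zero : ∀ d : D, res 0 (equiv d 0) = S.proj d

attribute [instance] LocalDecomposition.commRing LocalDecomposition.algebra
  LocalDecomposition.isLocalRing

section Rings

variable {A : Type u} [Field A] {D : Type v} [CommRing D] [Algebra A D] {m t : ℕ}

/-- The map `e : R → 𝒟(R) = R ⊗ D`, `e(r) = r ε₀ + ∂₁(r) ε₁ + ⋯ + ∂_m(r) ε_m`. -/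
noncomputable def OperatorData.expMap (S : OperatorData A D m) {R : Type w} [CommRing R] [Algebra A R]
    (op : Fin m → R → R) (r : R) : R ⊗[A] D :=
  r ⊗ₜ[A] S.basis 0 + ∑ i : Fin m, op i r ⊗ₜ[A] S.basis i.succ

/-- `(R, ∂₁, …, ∂_m)` is a `𝒟`-ring: the map `e` is an `A`-algebra homomorphism. -/
def OperatorData.IsDRing (S : OperatorData A D m) {R : Type w} [CommRing R] [Algebra A R]
    (op : Fin m → R → R) : Prop :=
  ∃ f : R →ₐ[A] R ⊗[A] D, ∀ r, f r = S.expMap op r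

namespace LocalDecomposition

variable {S : OperatorData A D m} (P : LocalDecomposition S t)

/-- The homomorphism `πᵢ : D → Bᵢ → A`. -/
noncomputable def projHom (i : Fin (t + 1)) : D →ₐ[A] A :=
  (P.res i).comp ((Pi.evalAlgHom A P.B i).comp (P.equiv : D →ₐ[A] (∀ i, P.B i)))

/-- The base change `πᵢ^R : 𝒟(R) = R ⊗ D → R`, `r ⊗ d ↦ πᵢ(d) r`. -/
noncomputable def projBase (i : Fin (t + 1)) (R : Type w) [CommRing R] [Algebra A R] :
    R ⊗[A] D →ₐ[A] R :=
  Algebra.TensorProduct.lift (AlgHom.id A R) ((Algebra.ofId A R).comp (P.projHom i))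
    (fun _ _ => Commute.all _ _)

/-- The associated endomorphism `σᵢ = πᵢ^R ∘ e` (with `σ₀ = id`). -/
noncomputable def assocEnd {R : Type w} [CommRing R] [Algebra A R] (op : Fin m → R → R)
    (i : Fin (t + 1)) (r : R) : R :=
  P.projBase i R (S.expMap op r)

theorem assocEnd_apply {R : Type w} [CommRing R] [Algebra A R] (op : Fin m → R → R)
    (i : Fin (t + 1)) (r : R) :
    P.assocEnd op i r =
      P.projHom i (S.basis 0) • r + ∑ j : Fin m, P.projHom i (S.basis j.succ) • op j r := by
  simp [assocEnd, projBase, OperatorData.expMap, Algebra.smul_def, Algebra.ofId_apply, mul_comm]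

theorem assocEnd_zero {R : Type w} [CommRing R] [Algebra A R] (op : Fin m → R → R) (r : R) :
    P.assocEnd op 0 r = r := by
  have h : ∀ d, P.projHom 0 d = S.proj d := fun d => P.res_zero d
  simp [assocEnd_apply, h, S.proj_basis_zero, S.proj_basis_succ]

/-- A letter of a word in `Θ`: `Sum.inl i` stands for the operator `∂ᵢ` and `Sum.inr j`
for `σⱼ⁻¹`, `j = 1, …, t`. -/
abbrev Letter (m t : ℕ) : Type := Fin m ⊕ Fin t

/-- Finite words in the operators `∂ᵢ` and `σⱼ⁻¹`. -/
abbrev Word (m t : ℕ) : Type := List (Letter m t)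

/-- The action of a letter. (`σⱼ` is bijective on `𝒟`-closed fields, and `Function.invFun`
is then its inverse.) -/
noncomputable def evalLetter {R : Type w} [CommRing R] [Algebra A R] (op : Fin m → R → R) :
    Letter m t → R → R
  | Sum.inl i => op i
  | Sum.inr j => Function.invFun (P.assocEnd op j.succ)

/-- The action of a word `θ = g₁ g₂ ⋯ g_k`: `θ r = g₁(g₂(⋯ g_k(r)))`. -/
noncomputable def evalWord {R : Type w} [CommRing R] [Algebra A R] (op : Fin m → R → R)
    (θ : Word m t) (r : R) : R :=
  θ.foldr (fun g x => P.evalLetter op g x) r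

end LocalDecomposition

end Rings

/-! ## Languages -/

/-- Function symbols of the language of `A`-algebras: `0, 1, +, -, ×` and the scalar
multiplications `λ_a`, `a ∈ A`. -/
inductive AlgFunc (A : Type u) : ℕ → Type u
  | zero : AlgFunc A 0
  | one : AlgFunc A 0
  | add : AlgFunc A 2
  | neg : AlgFunc A 1
  | mul : AlgFunc A 2
  | smul (a : A) : AlgFunc A 1

/-- Function symbols `∂₁, …, ∂_m`. -/
inductive OpFunc (m : ℕ) : ℕ → Type
  | op (i : Fin m) : OpFunc m 1

/-- The ring language, with scalars from `A`. -/
def algLang (A : Type u) : FirstOrder.Language.{u, 0} := ⟨AlgFunc A, fun _ => Empty⟩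

/-- The unary symbols `∂₁, …, ∂_m`. -/
def diffLang (m : ℕ) : FirstOrder.Language.{0, 0} := ⟨OpFunc m, fun _ => Empty⟩

/-- The language `L_𝒟` of `𝒟`-rings. -/
abbrev opLang (A : Type u) (m : ℕ) : FirstOrder.Language.{u, 0} := (algLang A).sum (diffLang m)

/-! ## `𝒟`-fields and `𝒟`-closed fields -/

section Fields

variable {A : Type u} [Field A] {D : Type v} [CommRing D] [Algebra A D] {m : ℕ}

/-- A `𝒟`-field: a `𝒟`-ring which is a field. -/
structure DField (S : OperatorData A D m) where
  carrier : Type w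
  [field : Field carrier]
  [algebra : Algebra A carrier]
  op : Fin m → carrier → carrier
  isDRing : S.IsDRing op

namespace DField

variable {S : OperatorData A D m}

instance : CoeSort (DField.{u, v, w} S) (Type w) := ⟨DField.carrier⟩

attribute [instance] DField.field DField.algebra

instance algStructure (K : DField.{u, v, w} S) : (algLang A).Structure K where
  funMap {_} f x :=
    match f, x with
    | .zero, _ => 0
    | .one, _ => 1
    | .add, x => x 0 + x 1
    | .neg, x => -x 0
    | .mul, x => x 0 * x 1
    | .smul a, x => a • x 0
  RelMap r _ := r.elim

instance diffStructure (K : DField.{u, v, w} S) : (diffLang m).Structure K where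
  funMap {_} f x :=
    match f, x with
    | .op i, x => K.op i (x 0)
  RelMap r _ := r.elim

/-- A `𝒟`-field `K` of characteristic zero is existentially closed if every existential formula
with parameters from `K` that has a solution in some `𝒟`-field extending `K` has a solution
in `K`. (Extensions of `K` automatically have characteristic zero.) -/
def IsExistentiallyClosed (K : DField.{u, v, w} S) : Prop :=
  ∀ (L : DField.{u, v, w} S) (f : K ↪[opLang A m] L) (n r : ℕ)
    (χ : (opLang A m).Formula (Fin n ⊕ Fin r)), χ.IsQF →
    ∀ (a : Fin n → K) (c : Fin r → L), χ.Realize (Sum.elim (fun i => f (a i)) c) →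
      ∃ c' : Fin r → K, χ.Realize (Sum.elim a c')

end DField

/-- The theory `𝒟-CF₀`: the model companion of the theory of `𝒟`-fields of characteristic zero,
that is, the first-order theory, in the language `L_𝒟`, of the class of existentially closed
`𝒟`-fields of characteristic zero. -/
def DCF0 (S : OperatorData A D m) : (opLang A m).Theory :=
  {τ | ∀ K : DField.{u, v, u} S, CharZero K → K.IsExistentiallyClosed →
    FirstOrder.Language.Sentence.Realize K τ}

/-- `K` is a `𝒟`-closed field: a model of `𝒟-CF₀`. -/
def DField.IsDClosed {S : OperatorData A D m} (K : DField.{u, v, w} S) : Prop :=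
  FirstOrder.Language.Theory.Model K (DCF0 S)

end Fields

/-! ## Ring formulas in disjunctive normal form -/

section Formulas

variable {A : Type u} {α : Type w}

/-- The term `0`. -/
def zeroTerm : (algLang A).Term α := Constants.term (L := algLang A) AlgFunc.zero

/-- The term `1`. -/
def oneTerm : (algLang A).Term α := Constants.term (L := algLang A) AlgFunc.one

/-- The term `s + s'`. -/
def addTerm (s s' : (algLang A).Term α) : (algLang A).Term α :=
  Functions.apply₂ (L := algLang A) AlgFunc.add s s'

/-- The term `s × s'`. -/
def mulTerm (s s' : (algLang A).Term α) : (algLang A).Term α :=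
  Functions.apply₂ (L := algLang A) AlgFunc.mul s s'

/-- The term `s ^ k`. -/
def powTerm (s : (algLang A).Term α) : ℕ → (algLang A).Term α
  | 0 => oneTerm
  | k + 1 => mulTerm (powTerm s k) s

/-- The term `∑ j ≤ N, c_j s ^ j`. -/
def polyTerm {N : ℕ} (c : Fin (N + 1) → (algLang A).Term α) (s : (algLang A).Term α) :
    (algLang A).Term α :=
  (List.ofFn fun j : Fin (N + 1) => mulTerm (c j) (powTerm s j)).foldr addTerm zeroTerm

/-- A literal: an atomic formula or the negation of one. -/
def IsLiteral (χ : (algLang A).Formula α) : Prop :=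
  BoundedFormula.IsAtomic χ ∨ ∃ χ' : (algLang A).Formula α, BoundedFormula.IsAtomic χ' ∧ χ = χ'.not

/-- The formula in disjunctive normal form with the given disjuncts; each disjunct is given as
the list of its conjuncts. -/
def dnf (C : List (List ((algLang A).Formula α))) : (algLang A).Formula α :=
  (C.map fun c => c.foldr (· ⊓ ·) ⊤).foldr (· ⊔ ·) ⊥

/-- The variables `x̄`: one variable for each `θ xᵢ`, with `θ ∈ Θ` and `i = 1, …, n`. -/
abbrev XVar (m t n : ℕ) : Type := LocalDecomposition.Word m t × Fin n

/-- The variables `x̄` together with `ȳ = (y, σ₁ y, …, σ_t y)`. -/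
abbrev XYVar (m t n : ℕ) : Type := XVar m t n ⊕ Fin (t + 1)

/-- `C` is the list of disjuncts of a quantifier-free ring formula `ξ(x̄, ȳ)` in disjunctive
normal form, each of which has conjuncts `t_N(x̄) ≠ 0` and `∑ j ≤ N, t_j(x̄) y ^ j = 0`,
for some `N` and some polynomials `t_j`. -/
def IsAlgebraicDNF {m t n : ℕ} (C : List (List ((algLang A).Formula (XYVar m t n)))) : Prop :=
  ∀ c ∈ C, (∀ χ ∈ c, IsLiteral χ) ∧
    ∃ (N : ℕ) (p : Fin (N + 1) → (algLang A).Term (XVar m t n)),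
      (Term.equal ((p (Fin.last N)).relabel Sum.inl) zeroTerm).not ∈ c ∧
      Term.equal (polyTerm (fun j => (p j).relabel Sum.inl) (Term.var (Sum.inr 0))) zeroTerm ∈ c

end Formulas

section Values

variable {A : Type u} [Field A] {D : Type v} [CommRing D] [Algebra A D] {m t : ℕ}
  {S : OperatorData A D m} (P : LocalDecomposition S t)

/-- The tuple `Θ a`. -/
noncomputable def thetaTuple (K : DField.{u, v, w} S) {n : ℕ} (a : Fin n → K) :
    XVar m t n → K :=
  fun p => P.evalWord K.op p.1 (a p.2)

/-- The tuple `(b, σ₁ b, …, σ_t b)`. -/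
noncomputable def sigmaTuple (K : DField.{u, v, w} S) (b : K) : Fin (t + 1) → K :=
  fun i => P.assocEnd K.op i b

end Values

end FreeOp

-- The map 𝒟(R) → R^(t+1) with coordinates πᵢ (`resMap`) is surjective with nilpotent kernel. A
-- homomorphism into 𝒟(R) can therefore be lifted from its residues, the associated endomorphisms,
-- along formally smooth extensions, and uniquely along separable algebraic ones. In characteristic
-- zero every field extension is formally smooth, so a 𝒟-structure extends to a larger field as soon
-- as the σⱼ do (`exists_extension`). Consequently 𝒟-fields amalgamate over an algebraically closed
-- base with bijective σⱼ: the tensor product is a domain on which the induced σⱼ are injective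
-- (`exists_amalgam`).
--
-- `DCF0` is defined as the theory of the existentially closed 𝒟-fields, with no axioms at hand, so
-- it must be proved that its models are existentially closed. Ultraproducts take the place of
-- geometric axioms. A model K is elementary in an ultraproduct of existentially closed fields. A
-- finite piece of an extension of that ultraproduct is a hypersurface with prescribed values of e;
-- irreducibility of the equation and independence of the variables under each σⱼ hold at almost
-- every index, so the piece is realized in extensions of almost all factors
-- (`exists_approximation`). Hence `DField.IsDClosed.isExistentiallyClosed`.
--
-- Amalgamation and existential closedness give, by induction on formulas, that two models agree on
-- formulas over a common algebraically closed inversive 𝒟-subfield (`realize_iff_of_isHom`). For a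
-- tuple a, take for this subfield the algebraic closure F of A(Θa). By unique lifting, a field
-- embedding of F that respects Θa and the σⱼ automatically respects all operators
-- (`realize_iff_of_hull`). So the truth of φ at a depends only on the field F with its σⱼ, over Θa.
--
-- A finite part of F lies in A(Θa)(y) for one algebraic y, by the primitive element theorem, and
-- the quantifier-free ring type of (Θa, y, σ₁y, …, σ_t y) determines how the σⱼ act on A(Θa)(y).
-- Compactness turns this into a single conjunction of literals implying φ (`exists_conjunct`), and
-- a second use of compactness into a finite disjunction (`exists_finite_cover`). If all σⱼ are
-- trivial, an embedding of A(Θa) extends to F with no further condition, and y disappears.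

universe w'

namespace FreeOp

open FirstOrder FirstOrder.Language

/-! ## The functor `R ↦ 𝒟(R)` -/

section Tensor

variable {A : Type u} [Field A] {D : Type v} [CommRing D] [Algebra A D] {m t : ℕ}

/-- The map `𝒟(f) : 𝒟(R) → 𝒟(R')`. -/
noncomputable def dmap (D : Type v) [CommRing D] [Algebra A D] {R : Type w} {R' : Type w'}
    [CommRing R] [CommRing R'] [Algebra A R] [Algebra A R'] (f : R →ₐ[A] R') :
    R ⊗[A] D →ₐ[A] R' ⊗[A] D :=
  Algebra.TensorProduct.map f (AlgHom.id A D)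

@[simp] theorem dmap_tmul {R : Type w} {R' : Type w'}
    [CommRing R] [CommRing R'] [Algebra A R] [Algebra A R'] (f : R →ₐ[A] R') (r : R) (d : D) :
    dmap D f (r ⊗ₜ d) = f r ⊗ₜ d := by
  simp [dmap]

theorem dmap_comp {R R' R'' : Type*} [CommRing R] [CommRing R'] [CommRing R'']
    [Algebra A R] [Algebra A R'] [Algebra A R'']
    (g : R' →ₐ[A] R'') (f : R →ₐ[A] R') (z : R ⊗[A] D) :
    dmap D (g.comp f) z = dmap D g (dmap D f z) := by
  induction z using TensorProduct.induction_on with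
  | zero => simp
  | tmul x y => simp
  | add x y hx hy => simp [hx, hy]

namespace OperatorData

variable (S : OperatorData A D m)

/-- The coordinate functions of `𝒟(R)` with respect to the basis `ε`. -/
noncomputable def coord {R : Type w} [CommRing R] [Algebra A R] (k : Fin (m + 1))
    (z : R ⊗[A] D) : R :=
  (S.basis.baseChange R).repr z k

/-- The element of `𝒟(R)` with given coordinates. -/
noncomputable def ofCoord {R : Type w} [CommRing R] [Algebra A R] (c : Fin (m + 1) → R) :
    R ⊗[A] D :=
  ∑ k, c k ⊗ₜ[A] S.basis k

theorem coord_tmul {R : Type w} [CommRing R] [Algebra A R] (k : Fin (m + 1)) (r : R) (d : D) :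
    S.coord k (r ⊗ₜ[A] d) = S.basis.repr d k • r := by
  simp [coord]

@[simp] theorem coord_add {R : Type w} [CommRing R] [Algebra A R] (k : Fin (m + 1))
    (y z : R ⊗[A] D) : S.coord k (y + z) = S.coord k y + S.coord k z := by
  simp [coord]

@[simp] theorem coord_zero {R : Type w} [CommRing R] [Algebra A R] (k : Fin (m + 1)) :
    S.coord k (0 : R ⊗[A] D) = 0 := by
  simp [coord]

theorem ofCoord_coord {R : Type w} [CommRing R] [Algebra A R] (z : R ⊗[A] D) :
    S.ofCoord (fun k => S.coord k z) = z := by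
  conv_rhs => rw [← (S.basis.baseChange R).sum_repr z]
  simp [ofCoord, coord, TensorProduct.smul_tmul']

theorem coord_ofCoord {R : Type w} [CommRing R] [Algebra A R] (c : Fin (m + 1) → R)
    (k : Fin (m + 1)) : S.coord k (S.ofCoord c) = c k := by
  have : S.ofCoord c = ∑ k, c k • S.basis.baseChange R k := by
    simp [ofCoord, TensorProduct.smul_tmul']
  rw [this, coord, Module.Basis.repr_sum_self]

theorem coord_ext {R : Type w} [CommRing R] [Algebra A R] {y z : R ⊗[A] D}
    (h : ∀ k, S.coord k y = S.coord k z) : y = z := by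
  rw [← S.ofCoord_coord y, ← S.ofCoord_coord z]
  simp only [h]

theorem coord_dmap {R : Type w} {R' : Type w'} [CommRing R] [CommRing R'] [Algebra A R]
    [Algebra A R'] (f : R →ₐ[A] R') (k : Fin (m + 1)) (z : R ⊗[A] D) :
    S.coord k (dmap D f z) = f (S.coord k z) := by
  induction z using TensorProduct.induction_on with
  | zero => simp
  | tmul x y => simp [coord_tmul]
  | add x y hx hy => simp [hx, hy]

theorem dmap_ofCoord {R : Type w} {R' : Type w'} [CommRing R] [CommRing R'] [Algebra A R]
    [Algebra A R'] (f : R →ₐ[A] R') (c : Fin (m + 1) → R) :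
    dmap D f (S.ofCoord c) = S.ofCoord fun k => f (c k) := by
  simp [ofCoord]

theorem dmap_injective (S : OperatorData A D m) {R : Type w} {R' : Type w'} [CommRing R]
    [CommRing R'] [Algebra A R] [Algebra A R'] (f : R →ₐ[A] R') (hf : Function.Injective f) :
    Function.Injective (dmap D f) := by
  intro y z h
  refine S.coord_ext fun k => hf ?_
  rw [← S.coord_dmap, ← S.coord_dmap, h]

theorem expMap_eq_ofCoord {R : Type w} [CommRing R] [Algebra A R] (op : Fin m → R → R) (r : R) :
    S.expMap op r = S.ofCoord (Fin.cons r fun i => op i r) := by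
  simp [expMap, ofCoord, Fin.sum_univ_succ]

theorem expMap_coord {R : Type w} [CommRing R] [Algebra A R] (z : R → R ⊗[A] D)
    (hz : ∀ r, S.coord 0 (z r) = r) (r : R) :
    S.expMap (fun i r => S.coord i.succ (z r)) r = z r := by
  rw [expMap_eq_ofCoord]
  conv_rhs => rw [← S.ofCoord_coord (z r)]
  congr 1
  funext k
  refine Fin.cases ?_ (fun i => ?_) k
  · simp [hz]
  · simp

end OperatorData

namespace LocalDecomposition

variable {S : OperatorData A D m} (P : LocalDecomposition S t)

@[simp] theorem projBase_tmul (i : Fin (t + 1)) {R : Type w} [CommRing R] [Algebra A R]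
    (r : R) (d : D) : P.projBase i R (r ⊗ₜ d) = P.projHom i d • r := by
  simp [projBase, Algebra.smul_def, Algebra.ofId_apply, mul_comm]

theorem projBase_dmap (i : Fin (t + 1)) {R : Type w} {R' : Type w'} [CommRing R] [CommRing R']
    [Algebra A R] [Algebra A R'] (f : R →ₐ[A] R') (z : R ⊗[A] D) :
    P.projBase i R' (dmap D f z) = f (P.projBase i R z) := by
  induction z using TensorProduct.induction_on with
  | zero => simp
  | tmul x y => simp
  | add x y hx hy => simp [hx, hy]

theorem projBase_zero {R : Type w} [CommRing R] [Algebra A R] (z : R ⊗[A] D) :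
    P.projBase 0 R z = S.coord 0 z := by
  have h : ∀ d, P.projHom 0 d = S.proj d := fun d => P.res_zero d
  rw [← S.ofCoord_coord z, S.coord_ofCoord]
  simp [OperatorData.ofCoord, Fin.sum_univ_succ, h, S.proj_basis_zero, S.proj_basis_succ]

/-- The map `𝒟(R) → R^{t+1}` with coordinates `πᵢ^R`. -/
noncomputable def resMap (R : Type w) [CommRing R] [Algebra A R] :
    R ⊗[A] D →ₐ[A] (Fin (t + 1) → R) :=
  AlgHom.pi fun i => P.projBase i R

@[simp] theorem resMap_apply (R : Type w) [CommRing R] [Algebra A R] (z : R ⊗[A] D)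
    (i : Fin (t + 1)) : P.resMap R z i = P.projBase i R z := rfl

/-- The idempotents of the product decomposition of `D` separate the residue maps. -/
theorem exists_projHom_eq_single (i : Fin (t + 1)) :
    ∃ d : D, ∀ j, P.projHom j d = if j = i then 1 else 0 := by
  classical
  refine ⟨P.equiv.symm (Pi.single i 1), fun j => ?_⟩
  by_cases h : j = i
  · subst h; simp [projHom]
  · simp [projHom, h]

theorem resMap_surjective (R : Type w) [CommRing R] [Algebra A R] :
    Function.Surjective (P.resMap R) := by
  intro c
  choose d hd using P.exists_projHom_eq_single
  refine ⟨∑ i, c i ⊗ₜ d i, ?_⟩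
  funext j
  simp [hd]

/-- In each local factor the kernel of the residue map lies in the maximal ideal, so a component
with nonzero residue differs from a unit of `A` by a non-unit and is itself a unit. -/
theorem projHom_eq_zero_of_isUnit {b : D} (h : ∀ i, P.projHom i b ≠ 0) : IsUnit b := by
  rw [← MulEquiv.isUnit_map P.equiv, Pi.isUnit_iff]
  intro i
  by_contra hb
  refine h i ?_
  by_contra hne
  have h1 : P.equiv b i ∈ IsLocalRing.maximalIdeal (P.B i) := hb
  have h2 : RingHom.ker (P.res i) ≤ IsLocalRing.maximalIdeal (P.B i) :=
    IsLocalRing.le_maximalIdeal (RingHom.ker_ne_top _)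
  have h3 : algebraMap A (P.B i) (P.projHom i b) - P.equiv b i ∈ RingHom.ker (P.res i) := by
    simp [RingHom.mem_ker, projHom]
  have h4 := Ideal.add_mem _ (h2 h3) h1
  rw [sub_add_cancel] at h4
  exact h4 ((IsUnit.mk0 _ hne).map (algebraMap A (P.B i)))

/-- If all residues of x vanish then xy + 1 has residues 1 and is a unit for every y, so x is in the
Jacobson radical. This is nilpotent because `D`, being finite over a field, is Artinian. -/
theorem isNilpotent_ker_projHom (S' : OperatorData A D m) :
    IsNilpotent (⨅ i, RingHom.ker (P.projHom i)) := by
  have : Module.Finite A D := Module.Finite.of_basis S'.basis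
  have : IsArtinianRing D := IsArtinianRing.of_finite A D
  have hle : (⨅ i, RingHom.ker (P.projHom i)) ≤ Ideal.jacobson (⊥ : Ideal D) := by
    intro x hx
    rw [Ideal.mem_jacobson_bot]
    intro y
    apply P.projHom_eq_zero_of_isUnit
    intro i
    have : P.projHom i x = 0 := by
      have := (Submodule.mem_iInf _).1 hx i
      exact this
    simp [this]
  obtain ⟨n, hn⟩ := IsArtinianRing.isNilpotent_jacobson_bot (R := D)
  exact ⟨n, le_bot_iff.1 ((Ideal.pow_right_mono hle n).trans hn.le)⟩

/-- Nilpotence passes from `D` to every base change because the kernel is contained in the ideal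
generated by the common kernel of the πᵢ on `D`. -/
theorem isNilpotent_ker_resMap (R : Type w) [CommRing R] [Algebra A R] :
    IsNilpotent (RingHom.ker (P.resMap R : R ⊗[A] D →+* (Fin (t + 1) → R))) := by
  obtain ⟨n, hn⟩ := P.isNilpotent_ker_projHom S
  refine ⟨n, ?_⟩
  have hle : RingHom.ker (P.resMap R : R ⊗[A] D →+* (Fin (t + 1) → R)) ≤
      (⨅ i, RingHom.ker (P.projHom i)).map
        (Algebra.TensorProduct.includeRight : D →ₐ[A] R ⊗[A] D) := by
    intro z hz
    choose d hd using P.exists_projHom_eq_single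
    set J := (⨅ i, RingHom.ker (P.projHom i)).map
        (Algebra.TensorProduct.includeRight : D →ₐ[A] R ⊗[A] D) with hJ
    -- Subtracting the combination of the `d i` that has the same residues as `z` leaves an element
    -- of the extended ideal.
    have key : ∀ z : R ⊗[A] D, z - ∑ i, P.projBase i R z ⊗ₜ[A] d i ∈ J := by
      intro z
      induction z using TensorProduct.induction_on with
      | zero => simp
      | tmul x y =>
        have : x ⊗ₜ[A] y - ∑ i, P.projBase i R (x ⊗ₜ[A] y) ⊗ₜ[A] d i =
            x ⊗ₜ[A] (1 : D) * Algebra.TensorProduct.includeRight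
              (R := A) (A := R) (y - ∑ i, P.projHom i y • d i) := by
          rw [Algebra.TensorProduct.includeRight_apply, Algebra.TensorProduct.tmul_mul_tmul,
            mul_one, one_mul, TensorProduct.tmul_sub, TensorProduct.tmul_sum]
          congr 1
          exact Finset.sum_congr rfl fun j _ => by rw [P.projBase_tmul, TensorProduct.smul_tmul]
        rw [this]
        refine Ideal.mul_mem_left _ _ (Ideal.mem_map_of_mem _ ?_)
        rw [Submodule.mem_iInf]
        intro j
        simp [RingHom.mem_ker, hd]
      | add x y hx hy =>
        have := add_mem hx hy
        convert! this using 1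
        simp [TensorProduct.add_tmul, Finset.sum_add_distrib]
        ring
    have h0 : ∀ i, P.projBase i R z = 0 := fun i => congrFun (RingHom.mem_ker.1 hz) i
    simpa [h0] using key z
  refine le_bot_iff.1 ((Ideal.pow_right_mono hle n).trans ?_)
  rw [← Ideal.map_pow, hn]
  simp

/-- The inverses of the residues lift to an inverse modulo the nilpotent kernel. -/
theorem isUnit_of_projBase_ne_zero {R : Type w} [Field R] [Algebra A R] {z : R ⊗[A] D}
    (h : ∀ i, P.projBase i R z ≠ 0) : IsUnit z := by
  obtain ⟨y, hy⟩ := P.resMap_surjective R fun i => (P.projBase i R z)⁻¹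
  have hnil : IsNilpotent (z * y - 1) := by
    obtain ⟨n, hn⟩ := P.isNilpotent_ker_resMap R
    refine ⟨n, ?_⟩
    have : z * y - 1 ∈ RingHom.ker (P.resMap R : R ⊗[A] D →+* (Fin (t + 1) → R)) := by
      rw [RingHom.mem_ker]
      funext i
      have := congrFun hy i
      simp only [resMap_apply] at this
      simp [this, h i]
    have h2 := Ideal.pow_mem_pow this n
    rw [hn] at h2
    simpa using h2
  have := hnil.isUnit_add_one
  rw [sub_add_cancel] at this
  exact isUnit_of_mul_isUnit_left this

end LocalDecomposition

end Tensor

/-! ## `𝒟`-fields -/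

namespace DField

variable {A : Type u} [Field A] {D : Type v} [CommRing D] [Algebra A D] {m t : ℕ}
  {S : OperatorData A D m}

/-- The homomorphism `e : K → 𝒟(K)`. -/
noncomputable def exp (K : DField.{u, v, w} S) : K →ₐ[A] K ⊗[A] D := K.isDRing.choose

theorem exp_apply (K : DField.{u, v, w} S) (r : K) : K.exp r = S.expMap K.op r :=
  K.isDRing.choose_spec r

theorem coord_succ_exp (K : DField.{u, v, w} S) (r : K) (i : Fin m) :
    S.coord i.succ (K.exp r) = K.op i r := by
  rw [exp_apply, OperatorData.expMap_eq_ofCoord, OperatorData.coord_ofCoord]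
  simp

theorem coord_zero_exp (K : DField.{u, v, w} S) (r : K) : S.coord 0 (K.exp r) = r := by
  rw [exp_apply, OperatorData.expMap_eq_ofCoord, OperatorData.coord_ofCoord]
  simp

/-- The `𝒟`-field given by a section `K → 𝒟(K)` of `π`. -/
noncomputable def ofExp (S : OperatorData A D m) (K : Type w) [Field K] [Algebra A K]
    (e : K →ₐ[A] K ⊗[A] D) (he : ∀ r, S.coord 0 (e r) = r) : DField.{u, v, w} S where
  carrier := K
  op i r := S.coord i.succ (e r)
  isDRing := ⟨e, fun r => (S.expMap_coord e he r).symm⟩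

theorem ofExp_exp (K : Type w) [Field K] [Algebra A K]
    (e : K →ₐ[A] K ⊗[A] D) (he : ∀ r, S.coord 0 (e r) = r) (r : K) :
    (ofExp S K e he).exp r = e r := by
  exact ((ofExp S K e he).exp_apply r).trans (S.expMap_coord e he r)

/-- The associated endomorphism `σⱼ`, as a homomorphism. -/
noncomputable def sigma (K : DField.{u, v, w} S) (P : LocalDecomposition S t) (j : Fin (t + 1)) :
    K →ₐ[A] K :=
  (P.projBase j K).comp K.exp

theorem sigma_apply (K : DField.{u, v, w} S) (P : LocalDecomposition S t) (j : Fin (t + 1))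
    (r : K) : K.sigma P j r = P.projBase j K (K.exp r) := rfl

theorem assocEnd_eq_sigma (K : DField.{u, v, w} S) (P : LocalDecomposition S t) (j : Fin (t + 1))
    (r : K) : P.assocEnd K.op j r = K.sigma P j r := by
  rw [sigma_apply, exp_apply]; rfl

theorem sigma_zero (K : DField.{u, v, w} S) (P : LocalDecomposition S t) (r : K) :
    K.sigma P 0 r = r := by
  rw [← assocEnd_eq_sigma, P.assocEnd_zero]

/-- All associated endomorphisms are surjective. -/
def IsInversive (K : DField.{u, v, w} S) (P : LocalDecomposition S t) : Prop :=
  ∀ j, Function.Surjective (K.sigma P j)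

/-- Homomorphisms of `𝒟`-fields. -/
def IsHom {K : DField.{u, v, w} S} {L : DField.{u, v, w'} S} (f : K →ₐ[A] L) : Prop :=
  ∀ i r, f (K.op i r) = L.op i (f r)

theorem isHom_iff {K : DField.{u, v, w} S} {L : DField.{u, v, w'} S} {f : K →ₐ[A] L} :
    IsHom f ↔ ∀ r, dmap D f (K.exp r) = L.exp (f r) := by
  constructor
  · intro h r
    refine S.coord_ext fun k => ?_
    rw [S.coord_dmap]
    refine Fin.cases ?_ (fun i => ?_) k
    · simp [coord_zero_exp]
    · simp [coord_succ_exp, h i r]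
  · intro h i r
    rw [← coord_succ_exp, ← S.coord_dmap, h, coord_succ_exp]

theorem IsHom.sigma {K : DField.{u, v, w} S} {L : DField.{u, v, w'} S} {f : K →ₐ[A] L}
    (hf : IsHom f) (P : LocalDecomposition S t) (j : Fin (t + 1)) (r : K) :
    f (K.sigma P j r) = L.sigma P j (f r) := by
  rw [sigma_apply, sigma_apply, ← isHom_iff.1 hf, P.projBase_dmap]

theorem IsHom.comp {K L M : DField.{u, v, w} S} {g : L →ₐ[A] M} {f : K →ₐ[A] L}
    (hg : IsHom g) (hf : IsHom f) : IsHom (g.comp f) := fun i r => by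
  simp [hf i r, hg i (f r)]

theorem sigma_injective (K : DField.{u, v, w} S) (P : LocalDecomposition S t) (j : Fin (t + 1)) :
    Function.Injective (K.sigma P j) := (K.sigma P j).toRingHom.injective

end DField

end FreeOp

namespace FreeOp

open FirstOrder FirstOrder.Language

/-! ## Extending the operators to larger fields -/

section Transcendence

/-- Both fields are algebraic closures of a polynomial ring over `F` in the same variables. -/
theorem nonempty_algEquiv_of_isTranscendenceBasis {F L M ι : Type*} [Field F] [Field L] [Field M]
    [Algebra F L] [Algebra F M] [IsAlgClosed L] [IsAlgClosed M] {x : ι → L} {y : ι → M}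
    (hx : IsTranscendenceBasis F x) (hy : IsTranscendenceBasis F y) :
    Nonempty (L ≃ₐ[F] M) := by
  have := IsAlgClosed.isAlgClosure_of_transcendence_basis x hx
  have := IsAlgClosed.isAlgClosure_of_transcendence_basis y hy
  let e : Algebra.adjoin F (Set.range x) ≃ₐ[F] Algebra.adjoin F (Set.range y) :=
    hx.1.aevalEquiv.symm.trans hy.1.aevalEquiv
  let E := IsAlgClosure.equivOfEquiv L M e.toRingEquiv
  refine ⟨AlgEquiv.ofRingEquiv (f := E) fun c => ?_⟩
  have h1 : algebraMap F L c =
      algebraMap (Algebra.adjoin F (Set.range x)) L (algebraMap F _ c) := rfl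
  rw [h1, IsAlgClosure.equivOfEquiv_algebraMap]
  simp

/-- Raising the transcendence degree to the full cardinality of `Ω`, without raising the cardinality
itself, makes room for the automorphisms of `exists_ringEquiv_extending`. -/
theorem exists_isAlgClosed_large (Ω : Type w) [Field Ω] [CharZero Ω] :
    ∃ (M : Type w) (_ : Field M) (_ : Algebra Ω M), IsAlgClosed M ∧
      Cardinal.mk M = Cardinal.mk Ω ∧ ∃ x : Ω → M, AlgebraicIndependent Ω x := by
  have hΩ : Cardinal.aleph0 ≤ Cardinal.mk Ω :=
    Cardinal.aleph0_le_mk_iff.2 (Infinite.of_injective _ (Nat.cast_injective (R := Ω)))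
  let B := AlgebraicClosure (FractionRing (MvPolynomial Ω Ω))
  refine ⟨B, inferInstance, inferInstance, inferInstance, le_antisymm ?_ ?_, ?_⟩
  · have h1 : Cardinal.mk B ≤
        max (Cardinal.mk (FractionRing (MvPolynomial Ω Ω))) Cardinal.aleph0 :=
      Algebra.IsAlgebraic.cardinalMk_le_max _ _
    rw [Cardinal.mk_fractionRing] at h1
    refine h1.trans (max_le (MvPolynomial.cardinalMk_le_max.trans ?_) hΩ)
    simp [hΩ]
  · exact Cardinal.mk_le_of_injective (algebraMap Ω B).injective
  · refine ⟨fun i => algebraMap (MvPolynomial Ω Ω) B (MvPolynomial.X i), ?_⟩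
    have h0 := MvPolynomial.algebraicIndependent_X Ω Ω
    exact h0.map' (f := IsScalarTower.toAlgHom Ω (MvPolynomial Ω Ω) B) (by
      rw [IsScalarTower.coe_toAlgHom',
        IsScalarTower.algebraMap_eq (MvPolynomial Ω Ω) (FractionRing (MvPolynomial Ω Ω)) B]
      exact (algebraMap (FractionRing (MvPolynomial Ω Ω)) B).injective.comp
        (IsFractionRing.injective _ _))

/-- Over either copy of `F`, a transcendence basis of `M` has exactly |Ω| elements: at most, because
|M| = |Ω|, and at least, because the family `x` stays independent over the smaller field. Matching
the two bases gives the automorphism. -/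
theorem exists_ringEquiv_extending {F Ω M : Type w} [Field F] [Field Ω] [Field M] [Algebra Ω M]
    [IsAlgClosed M] (hM : Cardinal.mk M = Cardinal.mk Ω) {x : Ω → M}
    (hx : AlgebraicIndependent Ω x) (s s' : F →+* Ω) :
    ∃ φ : M ≃+* M, ∀ c, φ (algebraMap Ω M (s c)) = algebraMap Ω M (s' c) := by
  have key : ∀ s : F →+* Ω, ∃ x : Ω → M,
      @IsTranscendenceBasis Ω F M _ _ ((algebraMap Ω M).comp s).toAlgebra x := by
    intro s
    let _ := s.toAlgebra
    let _ : Algebra F M := ((algebraMap Ω M).comp s).toAlgebra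
    have : IsScalarTower F Ω M := IsScalarTower.of_algebraMap_eq fun _ => rfl
    obtain ⟨b, hb⟩ := exists_isTranscendenceBasis F M
    have h : Cardinal.mk b = Cardinal.mk Ω := by
      apply le_antisymm
      · rw [← hM]
        exact Cardinal.mk_set_le b
      · rw [hb.cardinalMk_eq_trdeg]
        exact (hx.restrictScalars (R := F) (algebraMap F Ω).injective).cardinalMk_le_trdeg
    obtain ⟨e⟩ := Cardinal.eq.1 h
    exact ⟨_, hb.comp_equiv e.symm⟩
  obtain ⟨x, hx⟩ := key s
  obtain ⟨y, hy⟩ := key s'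
  obtain ⟨φ⟩ := @nonempty_algEquiv_of_isTranscendenceBasis F M M Ω _ _ _
    ((algebraMap Ω M).comp s).toAlgebra ((algebraMap Ω M).comp s').toAlgebra _ _ x y hx hy
  exact ⟨@AlgEquiv.toRingEquiv F M M _ _ _
    ((algebraMap Ω M).comp s).toAlgebra ((algebraMap Ω M).comp s').toAlgebra φ,
    fun c => @AlgEquiv.commutes F M M _ _ _
    ((algebraMap Ω M).comp s).toAlgebra ((algebraMap Ω M).comp s').toAlgebra φ c⟩

/-- A purely transcendental extension followed by a separable algebraic one. -/
theorem formallySmooth_of_charZero (F M : Type*) [Field F] [Field M] [CharZero F] [Algebra F M] :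
    Algebra.FormallySmooth F M := by
  obtain ⟨b, hb⟩ := exists_isTranscendenceBasis F M
  have := hb.isAlgebraic_field
  have : CharZero (IntermediateField.adjoin F (Set.range ((↑) : b → M))) :=
    charZero_of_injective_algebraMap (algebraMap F _).injective
  exact .of_algebraicIndependent_of_isSeparable hb.1

end Transcendence

section Extension

variable {A : Type u} [Field A] {D : Type v} [CommRing D] [Algebra A D] {m t : ℕ}
  {S : OperatorData A D m} (P : LocalDecomposition S t)

/-- The residues of `e` extend to automorphisms of a larger algebraically closed field `B`, the
zeroth to the identity. Since `B` is formally smooth over `F`, this tuple of automorphisms lifts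
through 𝒟(B) → B^(t+1) to a map extending `e`. Using automorphisms, not just endomorphisms, makes
the result inversive. -/
theorem exists_extension_of_field {F Ω : Type w} [Field F] [Field Ω] [Algebra A F] [Algebra A Ω]
    [CharZero Ω] (i : F →ₐ[A] Ω) (e : F →ₐ[A] Ω ⊗[A] D) (he : ∀ r, S.coord 0 (e r) = i r) :
    ∃ (M : DField.{u, v, w} S) (f : Ω →ₐ[A] M), IsAlgClosed M ∧ M.IsInversive P ∧
      ∀ r, M.exp (f (i r)) = dmap D f (e r) := by
  let s : Fin (t + 1) → F →ₐ[A] Ω := fun j => (P.projBase j Ω).comp e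
  have hs0 : ∀ r, s 0 r = i r := fun r => (P.projBase_zero (e r)).trans (he r)
  obtain ⟨B, _, _, _, hB, x, hx⟩ := exists_isAlgClosed_large Ω
  let _ : Algebra A B := ((algebraMap Ω B).comp (algebraMap A Ω)).toAlgebra
  have : IsScalarTower A Ω B := IsScalarTower.of_algebraMap_eq fun _ => rfl
  have hφ : ∀ j, ∃ φ : B ≃+* B,
      (∀ c, φ (algebraMap Ω _ (i c)) = algebraMap Ω _ (s j c)) ∧ (j = 0 → ∀ x, φ x = x) := by
    intro j
    by_cases hj : j = 0
    · subst hj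
      exact ⟨RingEquiv.refl _, fun c => by simp [hs0], fun _ _ => rfl⟩
    · obtain ⟨φ, h⟩ := exists_ringEquiv_extending hB hx (i : F →+* Ω) (s j : F →+* Ω)
      exact ⟨φ, h, fun h => absurd h hj⟩
  choose φ hφ hφ0 using hφ
  let f : Ω →ₐ[A] B := IsScalarTower.toAlgHom A Ω B
  let algF : Algebra F B := (f.comp i : F →+* B).toAlgebra
  -- The `F`-algebra structures on 𝒟(B) and on B^(t+1) are those given by `e` and its residues, so
  -- that an `F`-algebra map out of `B` is exactly an extension of `e`.
  let algD : Algebra F (B ⊗[A] D) :=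
    ((dmap D f).comp e : F →+* B ⊗[A] D).toAlgebra
  let ρ : F →+* (Fin (t + 1) → B) := RingHom.pi fun j => (f.comp (s j) : F →+* B)
  let algC : Algebra F (Fin (t + 1) → B) := ρ.toAlgebra
  have : CharZero F :=
    ⟨fun a b h => Nat.cast_injective (R := Ω) (by simpa using congrArg i h)⟩
  have := formallySmooth_of_charZero F B
  let g : B ⊗[A] D →ₐ[F] (Fin (t + 1) → B) :=
    { (P.resMap B : B ⊗[A] D →+* (Fin (t + 1) → B)) with
      commutes' := fun c => by
        funext j
        exact P.projBase_dmap j f (e c) }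
  let h : B →ₐ[F] (Fin (t + 1) → B) :=
    { (RingHom.pi fun j => (φ j : B →+* B)) with
      commutes' := fun c => by
        funext j
        exact hφ j c }
  let E := Algebra.FormallySmooth.liftOfSurjective h g (P.resMap_surjective _)
    (P.isNilpotent_ker_resMap _)
  have hE : ∀ x j, P.projBase j _ (E x) = φ j x := fun x j =>
    congrFun (Algebra.FormallySmooth.liftOfSurjective_apply h g (P.resMap_surjective _)
      (P.isNilpotent_ker_resMap _) x) j
  have hEF : ∀ c, E (f (i c)) = dmap D f (e c) := fun c => E.commutes c
  let E' : B →ₐ[A] B ⊗[A] D :=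
    { (E : B →+* B ⊗[A] D) with
      commutes' := fun a => by
        have := hEF (algebraMap A F a)
        simp only [AlgHom.commutes] at this
        exact this }
  have hE' : ∀ x, S.coord 0 (E' x) = x := fun x => by
    rw [← P.projBase_zero]
    exact (hE x 0).trans (hφ0 0 rfl x)
  refine ⟨DField.ofExp S B E' hE', f, ‹IsAlgClosed B›,
    fun j y => ?_, fun r => ?_⟩
  · refine ⟨(φ j).symm y, ?_⟩
    have h1 := DField.ofExp_exp (S := S) B E' hE' ((φ j).symm y)
    have h2 := (hE ((φ j).symm y) j).trans ((φ j).apply_symm_apply y)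
    exact (DField.sigma_apply (DField.ofExp S B E' hE') P j _).trans
      ((congrArg (P.projBase j B) h1).trans h2)
  · exact (DField.ofExp_exp (S := S) B E' hE' (f (i r))).trans (hEF r)

/-- Injectivity of every residue of `e` on `R` makes `e` send nonzero elements to units, so `e`
extends to the fraction field. -/
theorem exists_extension {R Ω : Type w} [CommRing R] [Field Ω] [Algebra A R] [Algebra A Ω]
    [CharZero Ω] (i : R →ₐ[A] Ω) (e : R →ₐ[A] Ω ⊗[A] D) (he : ∀ r, S.coord 0 (e r) = i r)
    (hinj : ∀ j r, P.projBase j Ω (e r) = 0 → r = 0) :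
    ∃ (M : DField.{u, v, w} S) (f : Ω →ₐ[A] M), IsAlgClosed M ∧ M.IsInversive P ∧
      ∀ r, M.exp (f (i r)) = dmap D f (e r) := by
  have hi : Function.Injective i := by
    rw [injective_iff_map_eq_zero]
    intro r hr
    exact hinj 0 r (by rw [P.projBase_zero, he, hr])
  have : IsDomain R := hi.isDomain i.toRingHom
  have hunit : ∀ y : nonZeroDivisors R, IsUnit (e y) := fun y =>
    P.isUnit_of_projBase_ne_zero fun j h0 => nonZeroDivisors.coe_ne_zero y (hinj j y h0)
  let F := FractionRing R
  let iF : F →ₐ[A] Ω := IsFractionRing.liftAlgHom (K := F) (g := i) hi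
  have hiF : ∀ r, iF (algebraMap R F r) = i r := fun r => IsFractionRing.lift_algebraMap (g := i.toRingHom) hi r
  let eF : F →ₐ[A] Ω ⊗[A] D := IsLocalization.liftAlgHom (M := nonZeroDivisors R) (f := e) hunit
  have heF : ∀ r, eF (algebraMap R F r) = e r := fun r => IsLocalization.lift_eq hunit r
  have hcoord : ∀ r, S.coord 0 (eF r) = iF r := by
    intro r
    have : (P.projBase 0 Ω).comp eF = iF := by
      apply IsLocalization.algHom_ext (nonZeroDivisors R)
      refine AlgHom.ext fun r => ?_
      change P.projBase 0 Ω (eF (algebraMap R F r)) = iF (algebraMap R F r)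
      rw [heF, hiF, P.projBase_zero, he]
    rw [← P.projBase_zero]
    exact DFunLike.congr_fun this r
  obtain ⟨M, f, h1, h2, h3⟩ := exists_extension_of_field P iF eF hcoord
  refine ⟨M, f, h1, h2, fun r => ?_⟩
  rw [← hiF, h3, heF]

end Extension

end FreeOp

namespace FreeOp

open FirstOrder FirstOrder.Language

/-! ## Amalgamation -/

section TensorDomain

/-- Nullstellensatz: the quotient by a maximal ideal is finite over `F`, hence equal to `F`. -/
theorem nonempty_algHom_of_finiteType (F B : Type*) [Field F] [IsAlgClosed F] [CommRing B]
    [Nontrivial B] [Algebra F B] [Algebra.FiniteType F B] : Nonempty (B →ₐ[F] F) := by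
  obtain ⟨I, hI⟩ := Ideal.exists_maximal B
  let _ := Ideal.Quotient.field I
  have : Module.Finite F (B ⧸ I) := finite_of_finite_type_of_isJacobsonRing F (B ⧸ I)
  have hbij := IsAlgClosed.algebraMap_bijective_of_isIntegral (k := F) (K := B ⧸ I)
  let e : F ≃ₐ[F] B ⧸ I := AlgEquiv.ofBijective (Algebra.ofId F _) hbij
  exact ⟨(e.symm : B ⧸ I →ₐ[F] F).comp (Ideal.Quotient.mkₐ F I)⟩

/-- If xy = 0 with x and y nonzero, their finitely many coordinates in a basis of `K`, together with
the inverse of a product of two nonzero ones, generate an algebra `B` of finite type. An `F`-point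
of `B` keeps those two coordinates nonzero and specializes the relation to a product of nonzero
elements in the field `K`. -/
theorem isDomain_tensorProduct_of_isAlgClosed (F K L : Type*) [Field F] [IsAlgClosed F]
    [Field K] [Field L] [Algebra F K] [Algebra F L] : IsDomain (L ⊗[F] K) := by
  have : NoZeroDivisors (L ⊗[F] K) := by
    refine ⟨fun {x y} hxy => ?_⟩
    by_contra! hne
    let b := Module.Basis.ofVectorSpace F K
    obtain ⟨a, ha⟩ : ∃ a, (b.baseChange L).repr x a ≠ 0 := by
      by_contra! h
      exact hne.1 ((b.baseChange L).repr.map_eq_zero_iff.1 (Finsupp.ext h))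
    obtain ⟨c, hc⟩ : ∃ c, (b.baseChange L).repr y c ≠ 0 := by
      by_contra! h
      exact hne.2 ((b.baseChange L).repr.map_eq_zero_iff.1 (Finsupp.ext h))
    let T : Set L := ((b.baseChange L).repr x '' ((b.baseChange L).repr x).support ∪
      (b.baseChange L).repr y '' ((b.baseChange L).repr y).support) ∪
      {((b.baseChange L).repr x a * (b.baseChange L).repr y c)⁻¹}
    have hT : T.Finite := (((Finset.finite_toSet _).image _).union
      ((Finset.finite_toSet _).image _)).union (Set.finite_singleton _)
    let B := Algebra.adjoin F T
    have : Algebra.FiniteType F B :=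
      (Subalgebra.fg_iff_finiteType _).1 (Subalgebra.fg_def.2 ⟨T, hT, rfl⟩)
    obtain ⟨φ⟩ := nonempty_algHom_of_finiteType F B
    let ι : B ⊗[F] K →ₐ[F] L ⊗[F] K := Algebra.TensorProduct.map B.val (AlgHom.id F K)
    have hι : Function.Injective ι :=
      Module.Flat.rTensor_preserves_injective_linearMap (M := K) B.val.toLinearMap
        Subtype.val_injective
    let ψ : B ⊗[F] K →ₐ[F] K :=
      Algebra.TensorProduct.lift ((Algebra.ofId F K).comp φ) (AlgHom.id F K)
        (fun _ _ => Commute.all _ _)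
    have key : ∀ z : L ⊗[F] K, (∀ i, (b.baseChange L).repr z i ∈ B) →
        ∃ z' : B ⊗[F] K, ι z' = z ∧ (ψ z' = 0 → ∀ i (hi : (b.baseChange L).repr z i ∈ B),
          φ ⟨_, hi⟩ = 0) := by
      intro z hz
      refine ⟨∑ i ∈ ((b.baseChange L).repr z).support,
        (⟨(b.baseChange L).repr z i, hz i⟩ : B) ⊗ₜ b i, ?_, ?_⟩
      · conv_rhs => rw [← (b.baseChange L).linearCombination_repr z]
        simp [ι, Finsupp.linearCombination_apply, Finsupp.sum, TensorProduct.smul_tmul']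
      · intro h0 i hi
        have h1 : ∑ i ∈ ((b.baseChange L).repr z).support,
            φ ⟨(b.baseChange L).repr z i, hz i⟩ • b i = 0 := by
          simpa [ψ, Algebra.smul_def, Algebra.ofId_apply] using h0
        by_cases hs : i ∈ ((b.baseChange L).repr z).support
        · exact linearIndependent_iff'.1 b.linearIndependent _ _ h1 i hs
        · rw [Finsupp.notMem_support_iff] at hs
          have : (⟨_, hi⟩ : B) = 0 := Subtype.ext hs
          rw [this, map_zero]
    have hxB : ∀ i, (b.baseChange L).repr x i ∈ B := by
      intro i
      by_cases hs : i ∈ ((b.baseChange L).repr x).support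
      · exact Algebra.subset_adjoin (Or.inl (Or.inl ⟨i, hs, rfl⟩))
      · rw [Finsupp.notMem_support_iff] at hs
        rw [hs]; exact B.zero_mem
    have hyB : ∀ i, (b.baseChange L).repr y i ∈ B := by
      intro i
      by_cases hs : i ∈ ((b.baseChange L).repr y).support
      · exact Algebra.subset_adjoin (Or.inl (Or.inr ⟨i, hs, rfl⟩))
      · rw [Finsupp.notMem_support_iff] at hs
        rw [hs]; exact B.zero_mem
    have hinv : ((b.baseChange L).repr x a * (b.baseChange L).repr y c)⁻¹ ∈ B :=
      Algebra.subset_adjoin (Or.inr rfl)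
    obtain ⟨x', hx', hx0⟩ := key x hxB
    obtain ⟨y', hy', hy0⟩ := key y hyB
    have h0 : x' * y' = 0 := hι (by rw [map_mul, hx', hy', hxy, map_zero])
    have h1 : φ ⟨_, hxB a⟩ * φ ⟨_, hyB c⟩ * φ ⟨_, hinv⟩ = 1 := by
      rw [← map_mul, ← map_mul, ← map_one φ]
      congr 1
      exact Subtype.ext (mul_inv_cancel₀ (mul_ne_zero ha hc))
    have h2 : ψ x' * ψ y' = 0 := by rw [← map_mul, h0, map_zero]
    rcases mul_eq_zero.1 h2 with h | h
    · rw [hx0 h a (hxB a)] at h1; simp at h1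
    · rw [hy0 h c (hyB c)] at h1; simp at h1
  exact NoZeroDivisors.to_isDomain _

/-- Stated for ring homomorphisms because e is not linear over the base 𝒟-field; the `F`-algebra
structure on `C` is the one carried over by `f`. -/
theorem exists_tensorProduct_lift {F K L C : Type*} [CommRing F] [CommRing K] [CommRing L]
    [CommRing C] [Algebra F K] [Algebra F L] (f : L →+* C) (g : K →+* C)
    (h : ∀ c, f (algebraMap F L c) = g (algebraMap F K c)) :
    ∃ Φ : L ⊗[F] K →+* C, ∀ l k, Φ (l ⊗ₜ k) = f l * g k := by
  let _ : Algebra F C := (f.comp (algebraMap F L)).toAlgebra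
  let f' : L →ₐ[F] C := { f with commutes' := fun _ => rfl }
  let g' : K →ₐ[F] C := { g with commutes' := fun c => (h c).symm }
  exact ⟨(Algebra.TensorProduct.lift f' g' fun _ _ => Commute.all _ _ : L ⊗[F] K →+* C),
    fun l k => Algebra.TensorProduct.lift_tmul f' g' (fun _ _ => Commute.all _ _) l k⟩

/-- The map `τ` is semilinear over `s`, and surjectivity of `s` ensures that it sends an `F`-basis
of `K` to an `F`-independent family. This is where inversivity of the base enters the amalgamation.
-/
theorem injective_of_tensorProduct_lift {F K L : Type*} [Field F] [Field K] [Field L]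
    [Algebra F K] [Algebra F L] (s : F →+* F) (hs : Function.Surjective s) (ρ : L →+* L)
    (τ : K →+* K) (hτ : ∀ c, τ (algebraMap F K c) = algebraMap F K (s c))
    (Φ : L ⊗[F] K →+* L ⊗[F] K) (hΦ : ∀ l k, Φ (l ⊗ₜ k) = ρ l ⊗ₜ τ k) :
    Function.Injective Φ := by
  rw [injective_iff_map_eq_zero]
  intro z hz
  let b := Module.Basis.ofVectorSpace F K
  have h1 : LinearIndependent F (fun i => τ (b i)) :=
    b.linearIndependent.map_of_surjective_injective s τ.toAddMonoidHom hs
      (fun m hm => (map_eq_zero_iff τ τ.injective).1 hm) (fun r m => by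
        simp [Algebra.smul_def, hτ])
  have h2 := Module.Flat.linearIndependent_one_tmul (S := L) h1
  have h3 : ∑ i ∈ ((b.baseChange L).repr z).support,
      ρ ((b.baseChange L).repr z i) • ((1 : L) ⊗ₜ[F] τ (b i)) = 0 := by
    rw [← hz]
    conv_rhs => rw [← (b.baseChange L).linearCombination_repr z]
    simp [Finsupp.linearCombination_apply, Finsupp.sum, TensorProduct.smul_tmul', hΦ]
  refine (b.baseChange L).repr.map_eq_zero_iff.1 (Finsupp.ext fun i => ?_)
  by_contra hi
  have := linearIndependent_iff'.1 h2 _ _ h3 i (Finsupp.mem_support_iff.2 hi)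
  exact hi ((map_eq_zero_iff ρ ρ.injective).1 this)

end TensorDomain

section Amalgamation

variable {A : Type u} [Field A] {D : Type v} [CommRing D] [Algebra A D] {m t : ℕ}
  {S : OperatorData A D m} (P : LocalDecomposition S t)

open DField

/-- The two maps e agree over `F` and so define one on L ⊗ K, which is a domain because `F` is
algebraically closed. Each associated endomorphism acts there as σ ⊗ σ, which is injective because
`F` is inversive, and `exists_extension` applies. -/
theorem exists_amalgam {F K L : DField.{u, v, w} S} [CharZero F] [IsAlgClosed F]
    (hinv : F.IsInversive P) {i : F →ₐ[A] L} (hi : IsHom i) {j : F →ₐ[A] K} (hj : IsHom j) :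
    ∃ (M : DField.{u, v, w} S) (f : L →ₐ[A] M) (g : K →ₐ[A] M), IsHom f ∧ IsHom g ∧
      ∀ x, f (i x) = g (j x) := by
  let _ : Algebra F L := i.toRingHom.toAlgebra
  let _ : Algebra F K := j.toRingHom.toAlgebra
  have hiA : ∀ c, algebraMap F L c = i c := fun _ => rfl
  have hjA : ∀ c, algebraMap F K c = j c := fun _ => rfl
  have : IsScalarTower A F L := IsScalarTower.of_algebraMap_eq fun a => (i.commutes a).symm
  have : IsScalarTower A F K := IsScalarTower.of_algebraMap_eq fun a => (j.commutes a).symm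
  have : IsDomain (L ⊗[F] K) := isDomain_tensorProduct_of_isAlgClosed F K L
  let R := L ⊗[F] K
  let Ω := FractionRing R
  let iL : L →ₐ[A] R := Algebra.TensorProduct.includeLeft
  let iK : K →ₐ[A] R := (Algebra.TensorProduct.includeRight : K →ₐ[F] R).restrictScalars A
  let iR : R →ₐ[A] Ω := IsScalarTower.toAlgHom A R Ω
  have hiR : Function.Injective iR := IsFractionRing.injective R Ω
  have hLK : ∀ c, iL (i c) = iK (j c) := fun c => by
    change i c ⊗ₜ[F] (1 : K) = (1 : L) ⊗ₜ[F] j c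
    rw [← hiA, ← hjA, Algebra.algebraMap_eq_smul_one, Algebra.algebraMap_eq_smul_one,
      TensorProduct.smul_tmul]
  have hmul : ∀ l k, (l ⊗ₜ[F] k : R) = iL l * iK k := fun l k => by
    change l ⊗ₜ[F] k = (l ⊗ₜ[F] (1 : K)) * ((1 : L) ⊗ₜ[F] k)
    rw [Algebra.TensorProduct.tmul_mul_tmul, mul_one, one_mul]
  have hcomp : (iL.comp i) = (iK.comp j) := AlgHom.ext hLK
  obtain ⟨Φ, hΦ⟩ := exists_tensorProduct_lift (F := F) (C := R ⊗[A] D)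
    ((dmap D iL).comp L.exp : L →+* R ⊗[A] D) ((dmap D iK).comp K.exp : K →+* R ⊗[A] D) (by
      intro c
      change dmap D iL (L.exp (i c)) = dmap D iK (K.exp (j c))
      rw [← isHom_iff.1 hi, ← isHom_iff.1 hj, ← dmap_comp, ← dmap_comp, hcomp])
  have hΦL : ∀ l, Φ (iL l) = dmap D iL (L.exp l) := fun l =>
    (hΦ l 1).trans (by rw [map_one, mul_one]; rfl)
  have hΦK : ∀ k, Φ (iK k) = dmap D iK (K.exp k) := fun k =>
    (hΦ 1 k).trans (by rw [map_one, one_mul]; rfl)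
  let E : R →ₐ[A] R ⊗[A] D :=
    { Φ with
      commutes' := fun a => (congrArg Φ (iL.commutes a).symm).trans
        ((hΦL _).trans (by rw [L.exp.commutes, AlgHom.commutes])) }
  have hE : ∀ r, E r = Φ r := fun _ => rfl
  have hσ : ∀ p l k, P.projBase p R (E (l ⊗ₜ k)) = L.sigma P p l ⊗ₜ K.sigma P p k := by
    intro p l k
    rw [hmul, hE, map_mul, map_mul, hΦL, hΦK, P.projBase_dmap, P.projBase_dmap, hmul]
    rfl
  have hσinj : ∀ p, Function.Injective ((P.projBase p R : R ⊗[A] D →+* R).comp (E : R →+* _)) := by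
    intro p
    refine injective_of_tensorProduct_lift (F.sigma P p : F →+* F) (hinv p)
      (L.sigma P p : L →+* L) (K.sigma P p : K →+* K) (fun c => ?_) _ (hσ p)
    exact (hj.sigma P p c).symm
  have : CharZero Ω := by
    let ψ : F →+* Ω := ((iR.comp iL).comp i : F →+* Ω)
    exact ⟨fun a b h => Nat.cast_injective (R := F) (ψ.injective (by simpa using h))⟩
  obtain ⟨M, f, -, -, hM⟩ := exists_extension P (S := S) iR ((dmap D iR).comp E) (fun r => by
      have h0 : ((P.projBase 0 R : R ⊗[A] D →+* R).comp (E : R →+* _)) r = r := by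
        induction r using TensorProduct.induction_on with
        | zero => simp
        | tmul x y => exact (hσ 0 x y).trans (by rw [sigma_zero, sigma_zero])
        | add x y hx hy => rw [map_add, hx, hy]
      rw [← P.projBase_zero]
      exact (P.projBase_dmap 0 iR (E r)).trans (congrArg iR h0))
    (fun p r h => by
      refine (injective_iff_map_eq_zero _).1 (hσinj p) r (hiR ?_)
      rw [map_zero, ← h]
      exact (P.projBase_dmap p iR (E r)).symm)
  refine ⟨M, (f.comp iR).comp iL, (f.comp iR).comp iK, ?_, ?_, fun x => ?_⟩
  · rw [isHom_iff]
    intro r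
    rw [dmap_comp, dmap_comp, ← hΦL]
    exact (hM (iL r)).symm
  · rw [isHom_iff]
    intro r
    rw [dmap_comp, dmap_comp, ← hΦK]
    exact (hM (iK r)).symm
  · exact congrArg (fun z => f (iR z)) (hLK x)

end Amalgamation

end FreeOp

namespace FreeOp

open FirstOrder FirstOrder.Language

/-! ## Model-theoretic preliminaries -/

section General

variable {L : FirstOrder.Language.{u, v}}

theorem realize_congr_freeVarFinset {α M : Type*} [L.Structure M] [DecidableEq α] {n : ℕ}
    {φ : L.BoundedFormula α n} {x y : α → M} (xs : Fin n → M)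
    (h : ∀ a ∈ φ.freeVarFinset, x a = y a) : φ.Realize x xs ↔ φ.Realize y xs := by
  have h1 := BoundedFormula.realize_restrictFreeVar (φ := φ) (f := Subtype.val) (v := x)
    (xs := xs) x (fun _ => rfl)
  have h2 := BoundedFormula.realize_restrictFreeVar (φ := φ) (f := Subtype.val) (v := x)
    (xs := xs) y (fun a => h a a.2)
  exact h1.symm.trans h2

/-- The compactness theorem for sets of formulas. -/
theorem exists_model_realize (T : L.Theory) {α : Type w} (Γ : Set (L.Formula α))
    (h : ∀ Γ₀ : Finset (L.Formula α), (Γ₀ : Set (L.Formula α)) ⊆ Γ →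
      ∃ (M : Type (max u v w)) (_ : L.Structure M) (_ : M ⊨ T) (_ : Nonempty M) (x : α → M),
        ∀ φ ∈ Γ₀, φ.Realize x) :
    ∃ (M : Type (max u v w)) (_ : L.Structure M) (_ : M ⊨ T) (_ : Nonempty M) (x : α → M),
        ∀ φ ∈ Γ, φ.Realize x := by
  classical
  let T' : L[[α]].Theory := (L.lhomWithConstants α).onTheory T ∪ Formula.equivSentence '' Γ
  have hsat : T'.IsSatisfiable := by
    rw [Theory.isSatisfiable_iff_isFinitelySatisfiable]
    intro T₀ hT₀
    obtain ⟨M, _, _, _, x, hx⟩ := h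
      ((T₀.image Formula.equivSentence.symm).filter (· ∈ Γ)) (by intro φ hφ; simp at hφ; exact hφ.2)
    let _ : (constantsOn α).Structure M := constantsOn.structure x
    have hM : M ⊨ (L.lhomWithConstants α).onTheory T := (LHom.onTheory_model _ _).2 inferInstance
    have : M ⊨ (T₀ : L[[α]].Theory) := by
      refine ⟨fun τ hτ => ?_⟩
      rcases hT₀ hτ with h1 | ⟨φ, hφ, rfl⟩
      · exact hM.realize_of_mem _ h1
      · refine (Formula.realize_equivSentence M φ).2 (hx φ ?_)
        rw [Finset.mem_filter, Finset.mem_image]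
        exact ⟨⟨_, hτ, by simp⟩, hφ⟩
    exact Theory.Model.isSatisfiable M
  obtain ⟨M⟩ := hsat
  let _ := (L.lhomWithConstants α).reduct M
  have h1 : M ⊨ (L.lhomWithConstants α).onTheory T :=
    M.is_model.mono Set.subset_union_left
  have h2 : M ⊨ Formula.equivSentence '' Γ := M.is_model.mono Set.subset_union_right
  refine ⟨M, inferInstance, (LHom.onTheory_model _ _).1 h1, inferInstance,
    fun a => (L.con a : M), fun φ hφ => ?_⟩
  exact (Formula.realize_equivSentence M φ).1 (h2.realize_of_mem _ ⟨φ, hφ, rfl⟩)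

end General

/-! ## Terms of the language of `𝒟`-rings -/

section Terms

variable {A : Type u} {m : ℕ} {α : Type w}

/-- The symbol `0`. -/
def fZero : (opLang A m).Functions 0 := Sum.inl (show (algLang A).Functions 0 from AlgFunc.zero)

/-- The symbol `1`. -/
def fOne : (opLang A m).Functions 0 := Sum.inl (show (algLang A).Functions 0 from AlgFunc.one)

/-- The symbol `+`. -/
def fAdd : (opLang A m).Functions 2 := Sum.inl (show (algLang A).Functions 2 from AlgFunc.add)

/-- The symbol `-`. -/
def fNeg : (opLang A m).Functions 1 := Sum.inl (show (algLang A).Functions 1 from AlgFunc.neg)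

/-- The symbol `×`. -/
def fMul : (opLang A m).Functions 2 := Sum.inl (show (algLang A).Functions 2 from AlgFunc.mul)

/-- The symbol `λ_a`. -/
def fSmul (a : A) : (opLang A m).Functions 1 :=
  Sum.inl (show (algLang A).Functions 1 from AlgFunc.smul a)

/-- The symbol `∂ᵢ`. -/
def fOp (i : Fin m) : (opLang A m).Functions 1 :=
  Sum.inr (show (diffLang m).Functions 1 from OpFunc.op i)

/-- The term `0`. -/
def dZero : (opLang A m).Term α := Constants.term (L := opLang A m) fZero

/-- The term `1`. -/
def dOne : (opLang A m).Term α := Constants.term (L := opLang A m) fOne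

/-- The term `s + s'`. -/
def dAdd (s s' : (opLang A m).Term α) : (opLang A m).Term α :=
  Functions.apply₂ (L := opLang A m) fAdd s s'

/-- The term `-s`. -/
def dNeg (s : (opLang A m).Term α) : (opLang A m).Term α :=
  Functions.apply₁ (L := opLang A m) fNeg s

/-- The term `s × s'`. -/
def dMul (s s' : (opLang A m).Term α) : (opLang A m).Term α :=
  Functions.apply₂ (L := opLang A m) fMul s s'

/-- The term `a s`. -/
def dSmul (a : A) (s : (opLang A m).Term α) : (opLang A m).Term α :=
  Functions.apply₁ (L := opLang A m) (fSmul a) s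

/-- The term `∂ᵢ s`. -/
def dOp (i : Fin m) (s : (opLang A m).Term α) : (opLang A m).Term α :=
  Functions.apply₁ (L := opLang A m) (fOp i) s

/-- The sum of a list of terms. -/
def dSum (l : List ((opLang A m).Term α)) : (opLang A m).Term α := l.foldr dAdd dZero

/-- The coordinates of `e(s)`. -/
def dCoord (k : Fin (m + 1)) (s : (opLang A m).Term α) : (opLang A m).Term α :=
  Fin.cases s (fun i => dOp i s) k

end Terms

section Compatible

variable {A : Type u} [Field A] {m : ℕ}

/-- The structure on `M` is the one given by the ring structure and operators. -/
structure Compatible (M : Type w) [CommRing M] [Algebra A M] [(opLang A m).Structure M]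
    (op : Fin m → M → M) : Prop where
  zero : ∀ x, Structure.funMap (L := opLang A m) fZero x = (0 : M)
  one : ∀ x, Structure.funMap (L := opLang A m) fOne x = (1 : M)
  add : ∀ x : Fin 2 → M, Structure.funMap (L := opLang A m) fAdd x = x 0 + x 1
  neg : ∀ x : Fin 1 → M, Structure.funMap (L := opLang A m) fNeg x = -x 0
  mul : ∀ x : Fin 2 → M, Structure.funMap (L := opLang A m) fMul x = x 0 * x 1
  smul : ∀ (a : A) (x : Fin 1 → M),
    Structure.funMap (L := opLang A m) (fSmul a) x = a • x 0
  op : ∀ (i : Fin m) (x : Fin 1 → M),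
    Structure.funMap (L := opLang A m) (fOp i) x = op i (x 0)

namespace Compatible

variable {M : Type w} [CommRing M] [Algebra A M] [(opLang A m).Structure M]
    {op : Fin m → M → M} (h : Compatible (A := A) M op) {α : Type*} (x : α → M)
include h

theorem realize_zero : (dZero : (opLang A m).Term α).realize x = 0 := h.zero _

theorem realize_one : (dOne : (opLang A m).Term α).realize x = 1 := h.one _

theorem realize_add (s s' : (opLang A m).Term α) :
    (dAdd s s').realize x = s.realize x + s'.realize x := by
  rw [dAdd, Term.realize_functions_apply₂, h.add]; rfl

theorem realize_neg (s : (opLang A m).Term α) : (dNeg s).realize x = -s.realize x := by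
  rw [dNeg, Term.realize_functions_apply₁, h.neg]; rfl

theorem realize_mul (s s' : (opLang A m).Term α) :
    (dMul s s').realize x = s.realize x * s'.realize x := by
  rw [dMul, Term.realize_functions_apply₂, h.mul]; rfl

theorem realize_smul (a : A) (s : (opLang A m).Term α) :
    (dSmul a s).realize x = a • s.realize x := by
  rw [dSmul, Term.realize_functions_apply₁, h.smul]; rfl

theorem realize_op (i : Fin m) (s : (opLang A m).Term α) :
    (dOp i s).realize x = op i (s.realize x) := by
  rw [dOp, Term.realize_functions_apply₁, h.op]; rfl

theorem realize_sum (l : List ((opLang A m).Term α)) :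
    (dSum l).realize x = (l.map fun s => s.realize x).sum := by
  induction l with
  | nil => exact h.realize_zero x
  | cons s l ih => rw [List.map_cons, List.sum_cons, ← ih]; exact h.realize_add x _ _

theorem realize_coord (k : Fin (m + 1)) (s : (opLang A m).Term α) :
    (dCoord k s).realize x = (Fin.cons (s.realize x) fun i => op i (s.realize x) : Fin (m + 1) → M) k := by
  refine Fin.cases ?_ (fun i => ?_) k
  · rfl
  · exact h.realize_op x i s

end Compatible

variable {D : Type v} [CommRing D] [Algebra A D] {S : OperatorData A D m}

theorem DField.compatible (K : DField.{u, v, w} S) : Compatible (A := A) K K.op where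
  zero _ := rfl
  one _ := rfl
  add _ := rfl
  neg _ := rfl
  mul _ := rfl
  smul _ _ := rfl
  op _ _ := rfl

/-- Criterion for a structure map to respect all function symbols. -/
theorem map_funMap_of_compatible {M : Type w} {N : Type w'} [CommRing M] [Algebra A M]
    [(opLang A m).Structure M] {op : Fin m → M → M} (hM : Compatible (A := A) M op)
    [CommRing N] [Algebra A N] [(opLang A m).Structure N] {op' : Fin m → N → N}
    (hN : Compatible (A := A) N op') (f : M →ₐ[A] N) (hf : ∀ i r, f (op i r) = op' i (f r))
    {n : ℕ} (F : (opLang A m).Functions n) (x : Fin n → M) :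
    f (Structure.funMap F x) = Structure.funMap F (f ∘ x) := by
  rcases F with F | F
  · cases F with
    | zero => exact (congrArg f (hM.zero x)).trans ((map_zero f).trans (hN.zero _).symm)
    | one => exact (congrArg f (hM.one x)).trans ((map_one f).trans (hN.one _).symm)
    | add => exact (congrArg f (hM.add x)).trans ((map_add f _ _).trans (hN.add (f ∘ x)).symm)
    | neg => exact (congrArg f (hM.neg x)).trans ((map_neg f _).trans (hN.neg (f ∘ x)).symm)
    | mul => exact (congrArg f (hM.mul x)).trans ((map_mul f _ _).trans (hN.mul (f ∘ x)).symm)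
    | smul a => exact (congrArg f (hM.smul a x)).trans ((map_smul f _ _).trans (hN.smul a (f ∘ x)).symm)
  · cases F with
    | op i => exact (congrArg f (hM.op i x)).trans ((hf i _).trans (hN.op i (f ∘ x)).symm)

namespace DField

/-- A homomorphism of `𝒟`-fields as an embedding of structures. -/
def IsHom.toEmbedding {K : DField.{u, v, w} S} {L : DField.{u, v, w'} S} {f : K →ₐ[A] L}
    (hf : IsHom f) : K ↪[opLang A m] L where
  toFun := f
  inj' := f.toRingHom.injective
  map_fun' F x := map_funMap_of_compatible K.compatible L.compatible f hf F x
  map_rel' r _ := by rcases r with r | r <;> exact r.elim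

@[simp] theorem IsHom.toEmbedding_apply {K : DField.{u, v, w} S} {L : DField.{u, v, w'} S}
    {f : K →ₐ[A] L} (hf : IsHom f) (x : K) : hf.toEmbedding x = f x := rfl

/-- A map of `𝒟`-fields respecting the operations is a homomorphism. -/
theorem exists_isHom {K : DField.{u, v, w} S} {L : DField.{u, v, w'} S} (g : K → L)
    (hone : g 1 = 1) (hadd : ∀ x y, g (x + y) = g x + g y) (hmul : ∀ x y, g (x * y) = g x * g y)
    (hsmul : ∀ (a : A) x, g (a • x) = a • g x) (hop : ∀ i x, g (K.op i x) = L.op i (g x)) :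
    ∃ f : K →ₐ[A] L, IsHom f ∧ ∀ x, f x = g x := by
  have hzero : g 0 = 0 := by simpa using hadd 0 0
  refine ⟨{ toFun := g, map_one' := hone, map_mul' := hmul, map_zero' := hzero, map_add' := hadd,
            commutes' := fun a => ?_ }, hop, fun _ => rfl⟩
  rw [Algebra.algebraMap_eq_smul_one, hsmul, hone, ← Algebra.algebraMap_eq_smul_one]

end DField

/-! ## Axioms of `𝒟`-rings -/

/-- The conditions are equations between terms, with the structure constants of `D` as scalars, and
therefore transfer to every model of `DCF0`. -/
theorem isDRing_of_axioms (S : OperatorData A D m) {M : Type w} [CommRing M] [Algebra A M]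
    (op : Fin m → M → M) (X : M → Fin (m + 1) → M) (hX : ∀ x, X x = Fin.cons x fun i => op i x)
    (hadd : ∀ k x y, X (x + y) k = X x k + X y k)
    (hsc : ∀ k (a : A), X (a • 1) k = (a * S.basis.repr 1 k) • (1 : M))
    (hmul : ∀ k x y, X (x * y) k =
      ∑ i, ∑ j, S.basis.repr (S.basis i * S.basis j) k • (X x i * X y j)) :
    S.IsDRing op := by
  have hexp : ∀ r, S.expMap op r = S.ofCoord (X r) := fun r => by
    rw [S.expMap_eq_ofCoord, hX]
  have hscal : ∀ a : A, S.ofCoord (X (algebraMap A M a)) = algebraMap A (M ⊗[A] D) a := by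
    intro a
    refine S.coord_ext fun k => ?_
    rw [S.coord_ofCoord, Algebra.algebraMap_eq_smul_one, hsc,
      Algebra.TensorProduct.algebraMap_apply, S.coord_tmul, Algebra.algebraMap_eq_smul_one,
      smul_smul, mul_comm]
  have hmul' : ∀ x y, S.ofCoord (X (x * y)) = S.ofCoord (X x) * S.ofCoord (X y) := by
    intro x y
    have h1 : S.ofCoord (X x) * S.ofCoord (X y) =
        ∑ i, ∑ j, (X x i * X y j) ⊗ₜ[A] (S.basis i * S.basis j) := by
      simp [OperatorData.ofCoord, Finset.sum_mul_sum]
    refine S.coord_ext fun k => ?_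
    rw [S.coord_ofCoord, hmul, h1]
    simp only [OperatorData.coord, map_sum, Finsupp.coe_finsetSum, Finset.sum_apply]
    refine Finset.sum_congr rfl fun i _ => Finset.sum_congr rfl fun j _ => ?_
    exact (S.coord_tmul k _ _).symm
  have hadd' : ∀ x y, S.ofCoord (X (x + y)) = S.ofCoord (X x) + S.ofCoord (X y) := by
    intro x y
    refine S.coord_ext fun k => ?_
    rw [S.coord_add, S.coord_ofCoord, S.coord_ofCoord, S.coord_ofCoord, hadd]
  refine ⟨{ toFun := fun r => S.ofCoord (X r), map_one' := ?_, map_mul' := hmul', map_zero' := ?_,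
            map_add' := hadd', commutes' := hscal }, fun r => (hexp r).symm⟩
  · have := hscal 1
    rwa [map_one, map_one] at this
  · have := hscal 0
    rwa [map_zero, map_zero] at this

namespace DField

theorem coord_exp (K : DField.{u, v, w} S) (k : Fin (m + 1)) (x : K) :
    S.coord k (K.exp x) = (Fin.cons x fun i => K.op i x : Fin (m + 1) → K) k := by
  rw [exp_apply, S.expMap_eq_ofCoord, S.coord_ofCoord]

theorem coord_exp_mul (K : DField.{u, v, w} S) (k : Fin (m + 1)) (x y : K) :
    S.coord k (K.exp (x * y)) =
      ∑ i, ∑ j, S.basis.repr (S.basis i * S.basis j) k •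
        (S.coord i (K.exp x) * S.coord j (K.exp y)) := by
  rw [map_mul]
  conv_lhs => rw [← S.ofCoord_coord (K.exp x), ← S.ofCoord_coord (K.exp y)]
  have h1 : S.ofCoord (fun i => S.coord i (K.exp x)) * S.ofCoord (fun i => S.coord i (K.exp y)) =
      ∑ i, ∑ j, (S.coord i (K.exp x) * S.coord j (K.exp y)) ⊗ₜ[A] (S.basis i * S.basis j) := by
    simp [OperatorData.ofCoord, Finset.sum_mul_sum]
  rw [h1]
  simp only [← S.coord_tmul]
  simp only [OperatorData.coord, map_sum, Finsupp.coe_finsetSum, Finset.sum_apply]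

theorem coord_exp_smul_one (K : DField.{u, v, w} S) (k : Fin (m + 1)) (a : A) :
    S.coord k (K.exp (a • 1)) = (a * S.basis.repr 1 k) • (1 : K) := by
  rw [← Algebra.algebraMap_eq_smul_one, K.exp.commutes, Algebra.TensorProduct.algebraMap_apply,
    S.coord_tmul, Algebra.algebraMap_eq_smul_one, smul_smul, mul_comm]

end DField

end Compatible

end FreeOp

namespace FreeOp

open FirstOrder FirstOrder.Language

/-! ## Models of `𝒟-CF₀` -/

section Models

variable {A : Type u} [Field A] {D : Type v} [CommRing D] [Algebra A D] {m t : ℕ}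
  {S : OperatorData A D m}

/-- Formulas valid in all existentially closed `𝒟`-fields are valid in all models of `𝒟-CF₀`. -/
theorem realize_of_model_DCF0 {M : Type w} [(opLang A m).Structure M] (hM : M ⊨ DCF0 S)
    {β : Type*} [Finite β] (φ : (opLang A m).Formula β)
    (h : ∀ K : DField.{u, v, u} S, CharZero K → K.IsExistentiallyClosed →
      ∀ x : β → K, φ.Realize x) (x : β → M) : φ.Realize x := by
  let τ : (opLang A m).Sentence := (φ.relabel (Sum.inr : β → Empty ⊕ β)).iAlls β
  have hτ : τ ∈ DCF0 S := fun K h1 h2 => by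
    rw [Sentence.Realize, Formula.realize_iAlls]
    intro y
    rw [Formula.realize_relabel]
    exact h K h1 h2 _
  have := hM.realize_of_mem τ hτ
  rw [Sentence.Realize, Formula.realize_iAlls] at this
  have := this x
  rwa [Formula.realize_relabel] at this

theorem DField.IsExistentiallyClosed.isDClosed {K : DField.{u, v, u} S} (h0 : CharZero K)
    (h : K.IsExistentiallyClosed) : K.IsDClosed :=
  ⟨fun _ hτ => hτ K h0 h⟩

theorem exists_dField_of_compatible {M : Type w} [Field M] [Algebra A M]
    [(opLang A m).Structure M] {op : Fin m → M → M} (hc : Compatible (A := A) M op)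
    (hD : S.IsDRing op) : ∃ K : DField.{u, v, w} S, Nonempty (M ≃[opLang A m] K) := by
  have key : ∀ (K : DField.{u, v, w} S) (f : M ≃ₐ[A] K), (∀ i r, f (op i r) = K.op i (f r)) →
      Nonempty (M ≃[opLang A m] K) := fun K f hf =>
    ⟨⟨f.toEquiv, fun F x => map_funMap_of_compatible hc K.compatible (f : M →ₐ[A] K) hf F x,
      fun r _ => by rcases r with r | r <;> exact r.elim⟩⟩
  exact ⟨⟨M, op, hD⟩, key ⟨M, op, hD⟩ AlgEquiv.refl fun _ _ => rfl⟩

/-- A model is a bare structure, so its ring, scalars and operators are rebuilt from the interpreted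
symbols; each axiom needed holds in all 𝒟-fields and hence in the model. -/
theorem exists_dField_of_model {M : Type w} [(opLang A m).Structure M] (hM : M ⊨ DCF0 S) :
    ∃ K : DField.{u, v, w} S, Nonempty (M ≃[opLang A m] K) := by
  have eq : ∀ {k : ℕ} (s s' : (opLang A m).Term (Fin k)),
      (∀ K : DField.{u, v, u} S, ∀ x : Fin k → K, s.realize x = s'.realize x) →
      ∀ x : Fin k → M, s.realize x = s'.realize x := fun s s' h x =>
    Formula.realize_equal.1 (realize_of_model_DCF0 hM (s.equal s')
      (fun K _ _ y => Formula.realize_equal.2 (h K y)) x)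
  let zero' : M := Structure.funMap (fZero : (opLang A m).Functions 0) ![]
  let one' : M := Structure.funMap (fOne : (opLang A m).Functions 0) ![]
  let add' : M → M → M := fun x y => Structure.funMap (fAdd : (opLang A m).Functions 2) ![x, y]
  let mul' : M → M → M := fun x y => Structure.funMap (fMul : (opLang A m).Functions 2) ![x, y]
  let neg' : M → M := fun x => Structure.funMap (fNeg : (opLang A m).Functions 1) ![x]
  let smul' : A → M → M := fun a x => Structure.funMap (fSmul a : (opLang A m).Functions 1) ![x]
  let op' : Fin m → M → M := fun i x => Structure.funMap (fOp i : (opLang A m).Functions 1) ![x]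
  have rzero : ∀ {k : ℕ} (x : Fin k → M), (dZero : (opLang A m).Term (Fin k)).realize x = zero' :=
    fun x => congrArg (Structure.funMap (M := M) (fZero : (opLang A m).Functions 0)) (Subsingleton.elim _ _)
  have rone : ∀ {k : ℕ} (x : Fin k → M), (dOne : (opLang A m).Term (Fin k)).realize x = one' :=
    fun x => congrArg (Structure.funMap (M := M) (fOne : (opLang A m).Functions 0)) (Subsingleton.elim _ _)
  have radd : ∀ {k : ℕ} (x : Fin k → M) (s s' : (opLang A m).Term (Fin k)),
      (dAdd s s').realize x = add' (s.realize x) (s'.realize x) :=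
    fun x s s' => Term.realize_functions_apply₂
  have rmul : ∀ {k : ℕ} (x : Fin k → M) (s s' : (opLang A m).Term (Fin k)),
      (dMul s s').realize x = mul' (s.realize x) (s'.realize x) :=
    fun x s s' => Term.realize_functions_apply₂
  have rneg : ∀ {k : ℕ} (x : Fin k → M) (s : (opLang A m).Term (Fin k)),
      (dNeg s).realize x = neg' (s.realize x) := fun x s => Term.realize_functions_apply₁
  have rsmul : ∀ {k : ℕ} (x : Fin k → M) (a : A) (s : (opLang A m).Term (Fin k)),
      (dSmul a s).realize x = smul' a (s.realize x) := fun x a s => Term.realize_functions_apply₁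
  have kz := fun (K : DField.{u, v, u} S) {k : ℕ} (x : Fin k → K) => K.compatible.realize_zero x
  have ko := fun (K : DField.{u, v, u} S) {k : ℕ} (x : Fin k → K) => K.compatible.realize_one x
  have ka := fun (K : DField.{u, v, u} S) {k : ℕ} (x : Fin k → K) => K.compatible.realize_add x
  have km := fun (K : DField.{u, v, u} S) {k : ℕ} (x : Fin k → K) => K.compatible.realize_mul x
  have kn := fun (K : DField.{u, v, u} S) {k : ℕ} (x : Fin k → K) => K.compatible.realize_neg x
  have ks := fun (K : DField.{u, v, u} S) {k : ℕ} (x : Fin k → K) => K.compatible.realize_smul x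
  -- There is no symbol for inversion; inverses come from an existential formula, which also fixes
  -- the inverse of zero to be zero, as the minimal field axioms require.
  have hinv : ∀ x : M, ∃ y : M, (x = zero' → y = zero') ∧ (x ≠ zero' → mul' x y = one') := by
    intro x
    let φ : (opLang A m).Formula (Fin 1 ⊕ Fin 1) :=
      (Term.equal (Term.var (Sum.inl 0)) dZero).imp (Term.equal (Term.var (Sum.inr 0)) dZero) ⊓
      (Term.equal (Term.var (Sum.inl 0)) dZero).not.imp
        (Term.equal (dMul (Term.var (Sum.inl 0)) (Term.var (Sum.inr 0))) dOne)
    have h := realize_of_model_DCF0 hM (φ.iExs (Fin 1)) (fun K _ _ x => by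
      rw [Formula.realize_iExs]
      refine ⟨fun _ => (x 0)⁻¹, ?_⟩
      simp only [φ, Formula.realize_inf, Formula.realize_imp, Formula.realize_not,
        Formula.realize_equal, Term.realize_var, K.compatible.realize_zero,
        K.compatible.realize_one, K.compatible.realize_mul, Sum.elim_inl, Sum.elim_inr]
      exact ⟨fun h => by rw [h, inv_zero], fun h => mul_inv_cancel₀ h⟩) (fun _ => x)
    rw [Formula.realize_iExs] at h
    obtain ⟨y, hy⟩ := h
    simp only [φ, Formula.realize_inf, Formula.realize_imp, Formula.realize_not,
        Formula.realize_equal, Term.realize_var, Sum.elim_inl, Sum.elim_inr] at hy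
    have e0 : (dZero : (opLang A m).Term (Fin 1 ⊕ Fin 1)).realize
        (Sum.elim (fun _ : Fin 1 => x) y) = zero' :=
      congrArg (Structure.funMap (M := M) (fZero : (opLang A m).Functions 0)) (Subsingleton.elim _ _)
    have e1 : (dOne : (opLang A m).Term (Fin 1 ⊕ Fin 1)).realize
        (Sum.elim (fun _ : Fin 1 => x) y) = one' :=
      congrArg (Structure.funMap (M := M) (fOne : (opLang A m).Functions 0)) (Subsingleton.elim _ _)
    have e2 : (dMul (Term.var (Sum.inl 0)) (Term.var (Sum.inr 0)) :
        (opLang A m).Term (Fin 1 ⊕ Fin 1)).realize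
        (Sum.elim (fun _ : Fin 1 => x) y) = mul' x (y 0) := Term.realize_functions_apply₂
    rw [e0, e1, e2] at hy
    exact ⟨y 0, hy⟩
  choose inv' hinv0 hinv1 using hinv
  have hne : zero' ≠ one' := by
    have h := realize_of_model_DCF0 hM
      ((Term.equal dZero dOne).not : (opLang A m).Formula (Fin 0)) (fun K _ _ x => by
        rw [Formula.realize_not, Formula.realize_equal, kz, ko]
        exact zero_ne_one) Fin.elim0
    rwa [Formula.realize_not, Formula.realize_equal, rzero, rone] at h
  let x0 : (opLang A m).Term (Fin 3) := Term.var 0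
  let x1 : (opLang A m).Term (Fin 3) := Term.var 1
  let x2 : (opLang A m).Term (Fin 3) := Term.var 2
  let _ : Zero M := ⟨zero'⟩
  let _ : One M := ⟨one'⟩
  let _ : Add M := ⟨add'⟩
  let _ : Mul M := ⟨mul'⟩
  let _ : Neg M := ⟨neg'⟩
  let _ : Inv M := ⟨inv'⟩
  let fld : Field M := Field.ofMinimalAxioms M
    (fun a b c => by
      have := eq (dAdd (dAdd x0 x1) x2) (dAdd x0 (dAdd x1 x2))
        (fun K x => by simp only [ka]; ring) ![a, b, c]
      simp only [radd] at this
      exact this)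
    (fun a => by
      have := eq (dAdd dZero x0) x0 (fun K x => by simp only [ka, kz]; ring) ![a, a, a]
      simp only [radd, rzero] at this
      exact this)
    (fun a => by
      have := eq (dAdd (dNeg x0) x0) dZero
        (fun K x => by simp only [ka, kn, kz]; ring) ![a, a, a]
      simp only [radd, rneg, rzero] at this
      exact this)
    (fun a b c => by
      have := eq (dMul (dMul x0 x1) x2) (dMul x0 (dMul x1 x2))
        (fun K x => by simp only [km]; ring) ![a, b, c]
      simp only [rmul] at this
      exact this)
    (fun a b => by
      have := eq (dMul x0 x1) (dMul x1 x0) (fun K x => by simp only [km]; ring) ![a, b, b]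
      simp only [rmul] at this
      exact this)
    (fun a => by
      have := eq (dMul dOne x0) x0 (fun K x => by simp only [km, ko]; ring) ![a, a, a]
      simp only [rmul, rone] at this
      exact this)
    (fun a ha => hinv1 a ha)
    (hinv0 zero' rfl)
    (fun a b c => by
      have := eq (dMul x0 (dAdd x1 x2)) (dAdd (dMul x0 x1) (dMul x0 x2))
        (fun K x => by simp only [ka, km]; ring) ![a, b, c]
      simp only [rmul, radd] at this
      exact this)
    ⟨zero', one', hne⟩
  let φ : A →+* M :=
    { toFun := fun a => smul' a one'
      map_one' := by
        have := eq (k := 0) (dSmul 1 dOne) dOne (fun K x => by simp only [ks, ko, one_smul]) ![]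
        simp only [rsmul, rone] at this
        exact this
      map_zero' := by
        have := eq (k := 0) (dSmul 0 dOne) dZero (fun K x => by simp only [ks, kz, zero_smul]) ![]
        simp only [rsmul, rone, rzero] at this
        exact this
      map_add' := fun a b => by
        have := eq (k := 0) (dSmul (a + b) dOne) (dAdd (dSmul a dOne) (dSmul b dOne))
          (fun K x => by simp only [ks, ka, add_smul]) ![]
        simp only [rsmul, rone, radd] at this
        exact this
      map_mul' := fun a b => by
        have := eq (k := 0) (dSmul (a * b) dOne) (dMul (dSmul a dOne) (dSmul b dOne))
          (fun K x => by simp only [ks, km, ko, smul_mul_smul_comm, mul_one]) ![]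
        simp only [rsmul, rone, rmul] at this
        exact this }
  let alg : Algebra A M := φ.toAlgebra
  have hsm : ∀ (a : A) (x : M), a • x = smul' a x := fun a b => by
    have := eq (dMul (dSmul a dOne) x0) (dSmul a x0)
      (fun K x => by simp only [ks, km, ko, smul_mul_assoc, one_mul]) ![b, b, b]
    simp only [rsmul, rone, rmul] at this
    exact this
  have hcomp : Compatible (A := A) M op' :=
    { zero := fun x => congrArg (Structure.funMap (M := M) (fZero : (opLang A m).Functions 0))
        (Subsingleton.elim _ _)
      one := fun x => congrArg (Structure.funMap (M := M) (fOne : (opLang A m).Functions 0))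
        (Subsingleton.elim _ _)
      add := fun x => congrArg (Structure.funMap (M := M) (fAdd : (opLang A m).Functions 2))
        (by funext i; fin_cases i <;> rfl)
      neg := fun x => congrArg (Structure.funMap (M := M) (fNeg : (opLang A m).Functions 1))
        (by funext i; fin_cases i; rfl)
      mul := fun x => congrArg (Structure.funMap (M := M) (fMul : (opLang A m).Functions 2))
        (by funext i; fin_cases i <;> rfl)
      smul := fun a x => by
        rw [hsm]
        exact congrArg (Structure.funMap (M := M) (fSmul a : (opLang A m).Functions 1))
          (by funext i; fin_cases i; rfl)
      op := fun i x => congrArg (Structure.funMap (M := M) (fOp i : (opLang A m).Functions 1))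
        (by funext i; fin_cases i; rfl) }
  have hD : S.IsDRing op' := by
    refine isDRing_of_axioms S op' (fun x => Fin.cons x fun i => op' i x) (fun x => rfl) ?_ ?_ ?_
    · intro k a b
      have := eq (dCoord k (dAdd x0 x1)) (dAdd (dCoord k x0) (dCoord k x1)) (fun K x => by
        have hc := K.compatible
        simp only [hc.realize_coord, hc.realize_add, ← K.coord_exp, map_add, S.coord_add])
        ![a, b, b]
      simp only [hcomp.realize_coord, hcomp.realize_add] at this
      exact this
    · intro k a
      have := eq (k := 0) (dCoord k (dSmul a dOne)) (dSmul (a * S.basis.repr 1 k) dOne)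
        (fun K x => by
          have hc := K.compatible
          simp only [hc.realize_coord, hc.realize_smul, hc.realize_one, ← K.coord_exp,
            K.coord_exp_smul_one]) ![]
      simp only [hcomp.realize_coord, hcomp.realize_smul, hcomp.realize_one] at this
      exact this
    · intro k a b
      have := eq (dCoord k (dMul x0 x1))
        (dSum (List.ofFn fun i => dSum (List.ofFn fun j =>
          dSmul (S.basis.repr (S.basis i * S.basis j) k) (dMul (dCoord i x0) (dCoord j x1)))))
        (fun K x => by
          have hc := K.compatible
          simp only [hc.realize_coord, hc.realize_smul, hc.realize_mul, hc.realize_sum,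
            List.map_ofFn, List.sum_ofFn, Function.comp_def, ← K.coord_exp, K.coord_exp_mul])
        ![a, b, b]
      simp only [hcomp.realize_coord, hcomp.realize_smul, hcomp.realize_mul, hcomp.realize_sum,
            List.map_ofFn, List.sum_ofFn, Function.comp_def] at this
      exact this
  exact exists_dField_of_compatible hcomp hD

theorem DField.IsDClosed.charZero {K : DField.{u, v, w} S} (hK : K.IsDClosed) : CharZero K := by
  refine charZero_of_inj_zero fun n hn => ?_
  by_contra h0
  have h := realize_of_model_DCF0 hK
    ((Term.equal (dSum (List.replicate n dOne)) dZero).not : (opLang A m).Formula (Fin 0))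
    (fun K' h1 _ x => by
      rw [Formula.realize_not, Formula.realize_equal, K'.compatible.realize_sum,
        K'.compatible.realize_zero]
      simpa [K'.compatible.realize_one] using h0) Fin.elim0
  rw [Formula.realize_not, Formula.realize_equal, K.compatible.realize_sum,
        K.compatible.realize_zero] at h
  exact h (by simpa [K.compatible.realize_one] using hn)

end Models

end FreeOp

namespace FreeOp

open FirstOrder FirstOrder.Language

/-! ## Existentially closed `𝒟`-fields -/

section QF

variable {L : FirstOrder.Language.{u, v}}

theorem isQF_equal {α : Type*} (s s' : L.Term α) : (Term.equal s s').IsQF :=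
  (BoundedFormula.IsAtomic.equal _ _).isQF

theorem isQF_foldr_inf {α : Type*} {n : ℕ} (l : List (L.BoundedFormula α n))
    (h : ∀ φ ∈ l, φ.IsQF) : (l.foldr (· ⊓ ·) ⊤).IsQF := by
  induction l with
  | nil => exact BoundedFormula.IsQF.top
  | cons φ l ih =>
    exact (h φ (by simp)).inf (ih fun ψ hψ => h ψ (by simp [hψ]))

theorem isQF_foldr_sup {α : Type*} {n : ℕ} (l : List (L.BoundedFormula α n))
    (h : ∀ φ ∈ l, φ.IsQF) : (l.foldr (· ⊔ ·) ⊥).IsQF := by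
  induction l with
  | nil => exact BoundedFormula.isQF_bot
  | cons φ l ih =>
    exact (h φ (by simp)).sup (ih fun ψ hψ => h ψ (by simp [hψ]))

end QF

section EC

variable {A : Type u} [Field A] {D : Type v} [CommRing D] [Algebra A D] {m t : ℕ}
  {S : OperatorData A D m}

open DField

/-- A map preserving all formulas. -/
def IsElementary {K K' : DField.{u, v, w} S} (f : K → K') : Prop :=
  ∀ φ : (opLang A m).Formula K, φ.Realize f ↔ φ.Realize id

theorem IsElementary.realize_iff {K K' : DField.{u, v, w} S} {f : K → K'} (hf : IsElementary f)
    {α : Type*} (φ : (opLang A m).Formula α) (x : α → K) :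
    φ.Realize (fun i => f (x i)) ↔ φ.Realize x := by
  have := hf (φ.relabel x)
  rwa [Formula.realize_relabel, Formula.realize_relabel] at this

/-- Existential closedness is defined with variables in some `Fin`; since a formula has finitely
many variables, all elements of `K` and `L` may serve as variables. -/
theorem exists_realize_of_isExistentiallyClosed {K L : DField.{u, v, w} S}
    (hK : K.IsExistentiallyClosed) {f : K →ₐ[A] L} (hf : IsHom f)
    (χ : (opLang A m).Formula (K ⊕ L)) (hχ : χ.IsQF) (h : χ.Realize (Sum.elim f id)) :
    ∃ g : L → K, χ.Realize (Sum.elim id g) := by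
  classical
  let s := BoundedFormula.freeVarFinset χ
  let l₁ : List K := s.toLeft.toList
  let l₂ : List L := s.toRight.toList
  -- `idxOf` returns the length of the list for an absent element, hence the extra index, at which
  -- `getD` takes the default value 0.
  let r₁ : K → Fin (l₁.length + 1) := fun x =>
    ⟨l₁.idxOf x, Nat.lt_succ_of_le List.idxOf_le_length⟩
  let r₂ : L → Fin (l₂.length + 1) := fun x =>
    ⟨l₂.idxOf x, Nat.lt_succ_of_le List.idxOf_le_length⟩
  let a : Fin (l₁.length + 1) → K := fun i => l₁.getD i 0
  let c : Fin (l₂.length + 1) → L := fun i => l₂.getD i 0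
  have ha : ∀ x, Sum.inl x ∈ s → a (r₁ x) = x := fun x hx => by
    have : x ∈ l₁ := by simpa [l₁] using hx
    simp [a, r₁, this]
  have hc : ∀ x, Sum.inr x ∈ s → c (r₂ x) = x := fun x hx => by
    have : x ∈ l₂ := by simpa [l₂] using hx
    simp [c, r₂, this]
  obtain ⟨c', hc'⟩ := hK L hf.toEmbedding _ _ (χ.relabel (Sum.map r₁ r₂)) (hχ.relabel _) a c (by
    rw [Formula.realize_relabel]
    refine (realize_congr_freeVarFinset _ ?_).1 h
    rintro (x | x) hx
    · simp [ha x hx]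
    · simp [hc x hx])
  refine ⟨fun x => c' (r₂ x), ?_⟩
  rw [Formula.realize_relabel] at hc'
  refine (realize_congr_freeVarFinset _ ?_).1 hc'
  rintro (x | x) hx
  · simp [ha x hx]
  · simp

/-- An extension of an existentially closed `K` embeds over `K` into an elementary extension
of `K`. -/
theorem exists_elementary_extension {K M : DField.{u, v, u} S} (h0 : CharZero K)
    (hK : K.IsExistentiallyClosed) {f : K →ₐ[A] M} (hf : IsHom f) :
    ∃ (K' : DField.{u, v, u} S) (h : M →ₐ[A] K'), K'.IsDClosed ∧ IsHom h ∧
      IsElementary fun x => h (f x) := by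
  classical
  -- `Γ₁` is the elementary diagram of `K` and `Γ₂` the quantifier-free diagram of `M`, which also
  -- identifies the variable of y in `K` with that of its image. Existential closedness realizes
  -- each finite part in `K` itself.
  let Γ₁ : Set ((opLang A m).Formula (K ⊕ M)) :=
    {ψ | ∃ φ : (opLang A m).Formula K, φ.Realize id ∧ ψ = φ.relabel Sum.inl}
  let Γ₂ : Set ((opLang A m).Formula (K ⊕ M)) :=
    {χ | BoundedFormula.IsQF χ ∧ χ.Realize (Sum.elim f id)}
  obtain ⟨N, _, hN, _, x, hx⟩ := exists_model_realize (DCF0 S) (Γ₁ ∪ Γ₂) (by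
    intro Γ₀ hΓ₀
    let l := (Γ₀.filter (· ∈ Γ₂)).toList
    have hl : ∀ ψ ∈ l, ψ ∈ Γ₂ := fun ψ hψ => by
      simp only [l, Finset.mem_toList, Finset.mem_filter] at hψ
      exact hψ.2
    obtain ⟨g, hg⟩ := exists_realize_of_isExistentiallyClosed hK hf (l.foldr (· ⊓ ·) ⊤)
      (isQF_foldr_inf _ fun ψ hψ => (hl ψ hψ).1)
      ((BoundedFormula.realize_foldr_inf _ _ _).2 fun ψ hψ => (hl ψ hψ).2)
    refine ⟨K, inferInstance, hK.isDClosed h0, inferInstance, Sum.elim id g, fun ψ hψ => ?_⟩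
    rcases hΓ₀ hψ with ⟨φ, hφ, rfl⟩ | h2
    · rwa [Formula.realize_relabel]
    · exact (BoundedFormula.realize_foldr_inf _ _ _).1 hg ψ (by simp [l, hψ, h2]))
  obtain ⟨K', ⟨E⟩⟩ := exists_dField_of_model hN
  have hx' : ∀ ψ ∈ Γ₁ ∪ Γ₂, ψ.Realize (fun i => E (x i)) := fun ψ hψ =>
    (StrongHomClass.realize_formula E ψ).2 (hx ψ hψ)
  have hqf : ∀ s s' : (opLang A m).Term (K ⊕ M), s.realize (Sum.elim f id) =
      s'.realize (Sum.elim f id) → s.realize (fun i => E (x i)) = s'.realize fun i => E (x i) :=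
    fun s s' h => Formula.realize_equal.1
      (hx' (s.equal s') (Or.inr ⟨isQF_equal _ _, Formula.realize_equal.2 h⟩))
  have hM := M.compatible
  have hK' := K'.compatible
  obtain ⟨h, hh, hhx⟩ := exists_isHom (K := M) (L := K') (fun y => E (x (Sum.inr y)))
    (by
      have := hqf (Term.var (Sum.inr 1)) dOne (by rw [hM.realize_one]; rfl)
      rwa [hK'.realize_one] at this)
    (fun a b => by
      have := hqf (Term.var (Sum.inr (a + b))) (dAdd (Term.var (Sum.inr a)) (Term.var (Sum.inr b)))
        (by rw [hM.realize_add]; rfl)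
      rwa [hK'.realize_add] at this)
    (fun a b => by
      have := hqf (Term.var (Sum.inr (a * b))) (dMul (Term.var (Sum.inr a)) (Term.var (Sum.inr b)))
        (by rw [hM.realize_mul]; rfl)
      rwa [hK'.realize_mul] at this)
    (fun c b => by
      have := hqf (Term.var (Sum.inr (c • b))) (dSmul c (Term.var (Sum.inr b)))
        (by rw [hM.realize_smul]; rfl)
      rwa [hK'.realize_smul] at this)
    (fun i b => by
      have := hqf (Term.var (Sum.inr (M.op i b))) (dOp i (Term.var (Sum.inr b)))
        (by rw [hM.realize_op]; rfl)
      rwa [hK'.realize_op] at this)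
  have hcl : K'.IsDClosed := StrongHomClass.theory_model E
  refine ⟨K', h, hcl, hh, ?_⟩
  have hfx : ∀ y, h (f y) = E (x (Sum.inl y)) := fun y => by
    rw [hhx]
    exact hqf (Term.var (Sum.inr (f y))) (Term.var (Sum.inl y)) rfl
  have hpos : ∀ φ : (opLang A m).Formula K, φ.Realize id → φ.Realize fun y => h (f y) := by
    intro φ hφ
    have := hx' (φ.relabel Sum.inl) (Or.inl ⟨φ, hφ, rfl⟩)
    rw [Formula.realize_relabel] at this
    simp only [hfx]
    exact this
  intro φ
  refine ⟨fun h1 => ?_, hpos φ⟩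
  by_contra h2
  exact Formula.realize_not.1 (hpos φ.not (Formula.realize_not.2 h2)) h1

theorem exists_extension_self (P : LocalDecomposition S t) (K : DField.{u, v, w} S)
    [CharZero K] : ∃ (M : DField.{u, v, w} S) (f : K →ₐ[A] M), IsHom f ∧ IsAlgClosed M ∧
      M.IsInversive P := by
  obtain ⟨M, f, h1, h2, h3⟩ := exists_extension_of_field P (S := S) (AlgHom.id A K) K.exp
    (fun r => K.coord_zero_exp r)
  exact ⟨M, f, isHom_iff.2 fun r => (h3 r).symm, h1, h2⟩

/-- The term `s ^ k`. -/
def dPow {α : Type w} (s : (opLang A m).Term α) : ℕ → (opLang A m).Term α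
  | 0 => dOne
  | k + 1 => dMul (dPow s k) s

theorem realize_pow (K : DField.{u, v, w} S) {α : Type*} (x : α → K) (s : (opLang A m).Term α)
    (k : ℕ) : (dPow s k).realize x = s.realize x ^ k := by
  induction k with
  | zero => rw [dPow, K.compatible.realize_one, pow_zero]
  | succ k ih => rw [dPow, K.compatible.realize_mul, ih, pow_succ]

theorem IsElementary.exists_root {K K' : DField.{u, v, w} S} {f : K →ₐ[A] K'}
    (hf : IsElementary f) (p : Polynomial K) (h : ∃ y, p.eval₂ (f : K →+* K') y = 0) :
    ∃ y, p.eval y = 0 := by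
  let s : (opLang A m).Term (K ⊕ Unit) := dSum (List.ofFn fun i : Fin (p.natDegree + 1) =>
    dMul (Term.var (Sum.inl (p.coeff i))) (dPow (Term.var (Sum.inr ())) i))
  have hs : ∀ (L : DField.{u, v, w} S) (g : K →+* L) (y : L),
      s.realize (Sum.elim g fun _ => y) = p.eval₂ g y := by
    intro L g y
    rw [L.compatible.realize_sum, Polynomial.eval₂_eq_sum_range, List.map_ofFn, List.sum_ofFn,
      ← Fin.sum_univ_eq_sum_range (fun i => g (p.coeff i) * y ^ i)]
    refine Finset.sum_congr rfl fun i _ => ?_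
    simp [L.compatible.realize_mul, realize_pow]
  have := hf ((Term.equal s dZero).iExs Unit)
  rw [Formula.realize_iExs, Formula.realize_iExs] at this
  obtain ⟨y, hy⟩ := h
  obtain ⟨z, hz⟩ := this.1 ⟨fun _ => y, by
    rw [Formula.realize_equal, K'.compatible.realize_zero]
    exact (hs K' f y).trans hy⟩
  rw [Formula.realize_equal, K.compatible.realize_zero] at hz
  refine ⟨z (), ?_⟩
  rw [← hz]
  exact (hs K (RingHom.id K) (z ())).symm

theorem IsElementary.isAlgClosed {K K' : DField.{u, v, w} S} {f : K →ₐ[A] K'}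
    (hf : IsElementary f) [IsAlgClosed K'] : IsAlgClosed K := by
  refine IsAlgClosed.of_exists_root K fun p _ hp => hf.exists_root p ?_
  exact IsAlgClosed.exists_eval₂_eq_zero (f : K →+* K') p hp.degree_pos.ne'

/-- A root in an algebraically closed 𝒟-field above `K` is carried into an elementary extension of
`K`, and from there the existence of a root descends. -/
theorem DField.IsExistentiallyClosed.isAlgClosed (P : LocalDecomposition S t)
    {K : DField.{u, v, u} S} (h0 : CharZero K) (hK : K.IsExistentiallyClosed) :
    IsAlgClosed K := by
  obtain ⟨M, f, hf, _, -⟩ := exists_extension_self P K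
  obtain ⟨K', h, -, -, hel⟩ := exists_elementary_extension h0 hK hf
  refine IsAlgClosed.of_exists_root K fun p _ hp =>
    IsElementary.exists_root (f := h.comp f) hel p ?_
  obtain ⟨y, hy⟩ := IsAlgClosed.exists_eval₂_eq_zero (f : K →+* M) p hp.degree_pos.ne'
  refine ⟨h y, ?_⟩
  have := congrArg h hy
  rw [map_zero] at this
  rw [← this]
  exact (Polynomial.hom_eval₂ p (f : K →+* M) (h : M →+* K') y).symm

/-- The term `σⱼ(s)`. -/
noncomputable def dSigma (P : LocalDecomposition S t) (j : Fin (t + 1)) {α : Type w}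
    (s : (opLang A m).Term α) : (opLang A m).Term α :=
  dSum (List.ofFn fun k => dSmul (P.projHom j (S.basis k)) (dCoord k s))

theorem realize_sigma (P : LocalDecomposition S t) (j : Fin (t + 1)) (K : DField.{u, v, w} S)
    {α : Type*} (x : α → K) (s : (opLang A m).Term α) :
    (dSigma P j s).realize x = K.sigma P j (s.realize x) := by
  rw [dSigma, K.compatible.realize_sum, sigma_apply, ← S.ofCoord_coord (K.exp _), List.map_ofFn,
    List.sum_ofFn]
  simp [K.compatible.realize_smul, K.compatible.realize_coord, OperatorData.ofCoord, K.coord_exp]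

/-- The formula `∃ y, σⱼ(y) = x`. -/
noncomputable def sigmaSurjFormula (P : LocalDecomposition S t) (j : Fin (t + 1)) {α : Type w}
    (a : α) : (opLang A m).Formula α :=
  (Term.equal (dSigma P j (Term.var (Sum.inr ()))) (Term.var (Sum.inl a))).iExs Unit

theorem realize_sigmaSurjFormula (P : LocalDecomposition S t) (j : Fin (t + 1))
    (K : DField.{u, v, w} S) {α : Type w'} (x : α → K) (a : α) :
    (sigmaSurjFormula P j a).Realize x ↔ ∃ y, K.sigma P j y = x a := by
  rw [sigmaSurjFormula, Formula.realize_iExs]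
  constructor
  · rintro ⟨y, hy⟩
    rw [Formula.realize_equal, realize_sigma] at hy
    exact ⟨y (), hy⟩
  · rintro ⟨y, hy⟩
    refine ⟨fun _ => y, ?_⟩
    rw [Formula.realize_equal, realize_sigma]
    exact hy

theorem DField.IsExistentiallyClosed.isInversive (P : LocalDecomposition S t)
    {K : DField.{u, v, u} S} (h0 : CharZero K) (hK : K.IsExistentiallyClosed) :
    K.IsInversive P := by
  obtain ⟨M, f, hf, -, hM⟩ := exists_extension_self P K
  obtain ⟨K', h, -, hh, hel⟩ := exists_elementary_extension h0 hK hf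
  intro j x
  refine (realize_sigmaSurjFormula P j K id x).1 ((hel (sigmaSurjFormula P j x)).1 ?_)
  rw [realize_sigmaSurjFormula]
  obtain ⟨y, hy⟩ := hM j (f x)
  exact ⟨h y, by rw [← hh.sigma, hy]⟩

theorem DField.IsDClosed.isInversive (P : LocalDecomposition S t)
    {K : DField.{u, v, w} S} (hK : K.IsDClosed) : K.IsInversive P := by
  intro j x
  have := realize_of_model_DCF0 hK (sigmaSurjFormula P j (0 : Fin 1)) (fun K' h1 h2 y =>
    (realize_sigmaSurjFormula P j K' y 0).2 (h2.isInversive P h1 j (y 0))) (fun _ => x)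
  exact (realize_sigmaSurjFormula P j K (fun _ : Fin 1 => x) 0).1 this

end EC

end FreeOp

namespace FreeOp

open FirstOrder FirstOrder.Language

/-! ### Divisibility by an irreducible polynomial with a prescribed zero -/

section Polynomials

/-- With a common zero the two polynomials are not coprime over the fraction field, so `p` divides
`g` there; `p` is primitive, so by Gauss's lemma it divides over `R`. -/
theorem dvd_of_polynomial_map_eq_zero {R Ω : Type*} [CommRing R] [IsDomain R]
    [NormalizedGCDMonoid R] [Field Ω] (ψ : Polynomial R →+* Ω)
    (hψ : Function.Injective (ψ.comp Polynomial.C)) {p g : Polynomial R} (hp : Irreducible p)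
    (hp0 : ψ p = 0) (hg0 : ψ g = 0) : p ∣ g := by
  have hdeg : p.natDegree ≠ 0 := by
    intro h
    rw [Polynomial.eq_C_of_natDegree_eq_zero h] at hp0 hp
    have : p.coeff 0 = 0 := hψ (by simpa using hp0)
    exact hp.ne_zero (by rw [this, map_zero])
  have hprim := hp.isPrimitive hdeg
  let χ : FractionRing R →+* Ω := IsFractionRing.lift hψ
  let ψ' : Polynomial (FractionRing R) →+* Ω := Polynomial.eval₂RingHom χ (ψ Polynomial.X)
  have hψ' : ∀ f : Polynomial R, ψ' (f.map (algebraMap R (FractionRing R))) = ψ f := by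
    intro f
    have : ψ'.comp (Polynomial.mapRingHom (algebraMap R (FractionRing R))) = ψ := by
      refine Polynomial.ringHom_ext (fun a => ?_) ?_
      · have : χ (algebraMap R (FractionRing R) a) = ψ (Polynomial.C a) :=
          IsFractionRing.lift_algebraMap hψ a
        simp [ψ', this]
      · simp [ψ']
    exact congrArg (fun h => h f) this
  refine hprim.dvd_of_fraction_map_dvd_fraction_map (K := FractionRing R) ?_
  have hirr := (hprim.irreducible_iff_irreducible_map_fraction_map (K := FractionRing R)).1 hp
  refine (hirr.isCoprime_or_dvd _).resolve_left ?_
  rintro ⟨a, b, hab⟩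
  have := congrArg ψ' hab
  simp [hψ', hp0, hg0] at this

/-- The previous lemma with the variable `none` singled out. With `Ψ` a residue of e, it shows that
all residues have the same kernel, generated by `p`. -/
theorem dvd_of_mvPolynomial_map_eq_zero {k Ω κ : Type*} [Field k] [Field Ω]
    (Ψ : MvPolynomial (Option κ) k →+* Ω)
    (hΨ : ∀ g : MvPolynomial κ k, Ψ (MvPolynomial.rename some g) = 0 → g = 0)
    {p g : MvPolynomial (Option κ) k} (hp : Irreducible p) (hp0 : Ψ p = 0) (hg0 : Ψ g = 0) :
    p ∣ g := by
  classical
  obtain ⟨hN⟩ := (inferInstance : Nonempty (NormalizedGCDMonoid (MvPolynomial κ k)))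
  let E := MvPolynomial.optionEquivLeft k κ
  let ψ : Polynomial (MvPolynomial κ k) →+* Ω := Ψ.comp (E.symm : _ →+* _)
  have hψE : ∀ f, ψ (E f) = Ψ f := fun f => by simp [ψ]
  have hC : ∀ g, E.symm (Polynomial.C g) = MvPolynomial.rename some g := by
    intro g
    rw [AlgEquiv.symm_apply_eq]
    induction g using MvPolynomial.induction_on with
    | C a => rw [MvPolynomial.rename_C]; exact (MvPolynomial.optionEquivLeft_C ..).symm
    | add f g hf hg => rw [map_add, map_add, map_add, hf, hg]
    | mul_X f n hf =>
      rw [map_mul, map_mul, map_mul, hf, MvPolynomial.rename_X]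
      exact congrArg _ (MvPolynomial.optionEquivLeft_X_some ..).symm
  have hψ : Function.Injective (ψ.comp Polynomial.C) := by
    rw [injective_iff_map_eq_zero]
    intro a ha
    refine hΨ a ?_
    rw [← hC]
    exact ha
  have := dvd_of_polynomial_map_eq_zero ψ hψ (p := E p) (g := E g)
    ((MulEquiv.irreducible_iff E).2 hp) (by rw [hψE, hp0]) (by rw [hψE, hg0])
  exact (map_dvd_iff E).1 this

end Polynomials

/-! ### Ultraproducts of fields and polynomials of bounded degree -/

section Ulim

variable {I : Type w} (U : Ultrafilter I)

/-- `q` exhibits `Q` as the ultraproduct of the rings `R i`. -/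
structure IsUlim {R : I → Type w} [∀ i, CommRing (R i)] {Q : Type w} [CommRing Q]
    (q : (∀ i, R i) →+* Q) : Prop where
  surjective : Function.Surjective q
  eq_zero_iff : ∀ x, q x = 0 ↔ ∀ᶠ i in (U : Filter I), x i = 0

/-- The quotient by the maximal ideal of families that vanish along `U`. The predicate `IsUlim`
covers this construction as well as the model-theoretic one in `exists_ultraproduct`. -/
theorem exists_isUlim {A : Type u} [Field A] (R : I → Type w) [∀ i, Field (R i)]
    [∀ i, Algebra A (R i)] :
    ∃ (Q : Type w) (_ : Field Q) (_ : Algebra A Q) (q : (∀ i, R i) →ₐ[A] Q),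
      IsUlim U (q : (∀ i, R i) →+* Q) := by
  classical
  let J : Ideal (∀ i, R i) :=
    { carrier := {x | ∀ᶠ i in (U : Filter I), x i = 0}
      add_mem' := fun {x y} hx hy => by
        filter_upwards [hx, hy] with i h1 h2
        simp [h1, h2]
      zero_mem' := by simp
      smul_mem' := fun c x hx => by
        filter_upwards [hx] with i h1
        simp [h1] }
  have hJ : J.IsMaximal := by
    refine Ideal.isMaximal_iff.2 ⟨fun h => ?_, fun J' x hJJ' hx hx' => ?_⟩
    · have : ∀ᶠ i in (U : Filter I), (1 : R i) = 0 := h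
      exact U.neBot.ne (by simpa using this)
    · have hx1 : ∀ᶠ i in (U : Filter I), x i ≠ 0 := (Ultrafilter.eventually_not).2 hx
      have h1 : (1 - (fun i => (x i)⁻¹) * x) ∈ J := by
        change ∀ᶠ i in (U : Filter I), _
        filter_upwards [hx1] with i hi
        simp [hi]
      have := J'.add_mem (hJJ' h1) (J'.mul_mem_left (fun i => (x i)⁻¹) hx')
      simpa using this
  let F : Field ((∀ i, R i) ⧸ J) := Ideal.Quotient.field J
  refine ⟨(∀ i, R i) ⧸ J, F, Ideal.Quotient.algebra A, Ideal.Quotient.mkₐ A J,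
    ⟨Ideal.Quotient.mkₐ_surjective A J, fun x => ?_⟩⟩
  exact Ideal.Quotient.eq_zero_iff_mem

variable {U} {R : I → Type w} [∀ i, CommRing (R i)] {Q : Type w} [CommRing Q]
    {q : (∀ i, R i) →+* Q}

theorem IsUlim.eq_iff (h : IsUlim U q) {x y : ∀ i, R i} :
    q x = q y ↔ ∀ᶠ i in (U : Filter I), x i = y i := by
  rw [← sub_eq_zero, ← map_sub, h.eq_zero_iff]
  simp [sub_eq_zero]

theorem IsUlim.ne_iff (h : IsUlim U q) {x y : ∀ i, R i} :
    q x ≠ q y ↔ ∀ᶠ i in (U : Filter I), x i ≠ y i := by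
  rw [Ne, h.eq_iff, Ultrafilter.eventually_not]

theorem IsUlim.ne_zero_iff (h : IsUlim U q) {x : ∀ i, R i} :
    q x ≠ 0 ↔ ∀ᶠ i in (U : Filter I), x i ≠ 0 := by
  rw [Ne, h.eq_zero_iff, Ultrafilter.eventually_not]

/-- A monic polynomial lifts to a monic polynomial of the same degree over the product, which has a
root in each component. -/
theorem IsUlim.isAlgClosed {R : I → Type w} [∀ i, Field (R i)] [∀ i, IsAlgClosed (R i)]
    {Q : Type w} [Field Q] {q : (∀ i, R i) →+* Q} (h : IsUlim U q) : IsAlgClosed Q := by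
  refine IsAlgClosed.of_exists_root _ fun p hp hirr => ?_
  have hl : p ∈ Polynomial.lifts q := by
    rw [Polynomial.lifts_iff_coeff_lifts]
    exact fun n => h.surjective _
  obtain ⟨g, rfl, hg, hmon⟩ := Polynomial.lifts_and_degree_eq_and_monic hl hp
  have hd : ∀ i, (g.map (Pi.evalRingHom R i)).degree ≠ 0 := by
    intro i
    rw [hmon.degree_map, hg]
    exact (Polynomial.degree_pos_of_irreducible hirr).ne'
  choose x hx using fun i => IsAlgClosed.exists_root (g.map (Pi.evalRingHom R i)) (hd i)
  refine ⟨q x, ?_⟩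
  have : g.eval x = 0 := by
    funext i
    have h1 := hx i
    rw [Polynomial.IsRoot.def, Polynomial.eval_map] at h1
    change Polynomial.eval₂ (Pi.evalRingHom R i) (Pi.evalRingHom R i x) g = 0 at h1
    rw [Polynomial.eval₂_at_apply] at h1
    exact h1
  rw [Polynomial.eval_map_apply, this, map_zero]

theorem IsUlim.map_mvPolynomial_ne_zero (h : IsUlim U q) {τ : Type*}
    {P : MvPolynomial τ (∀ i, R i)} (hP : MvPolynomial.map q P ≠ 0) :
    ∀ᶠ i in (U : Filter I), MvPolynomial.map (Pi.evalRingHom R i) P ≠ 0 := by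
  obtain ⟨m, hm⟩ := MvPolynomial.ne_zero_iff.1 hP
  rw [MvPolynomial.coeff_map, h.ne_zero_iff] at hm
  filter_upwards [hm] with i hi h0
  apply hi
  simpa [MvPolynomial.coeff_map] using congrArg (MvPolynomial.coeff m) h0

theorem IsUlim.map_mvPolynomial_eq (h : IsUlim U q) {τ : Type*}
    {P P' : MvPolynomial τ (∀ i, R i)} (hP : MvPolynomial.map q P = MvPolynomial.map q P') :
    ∀ᶠ i in (U : Filter I), MvPolynomial.map (Pi.evalRingHom R i) P =
      MvPolynomial.map (Pi.evalRingHom R i) P' := by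
  classical
  have : ∀ m ∈ P.support ∪ P'.support, ∀ᶠ i in (U : Filter I), P.coeff m i = P'.coeff m i := by
    intro m _
    rw [← h.eq_iff, ← MvPolynomial.coeff_map, ← MvPolynomial.coeff_map, hP]
  rw [← Filter.eventually_all_finset] at this
  filter_upwards [this] with i hi
  ext m
  rw [MvPolynomial.coeff_map, MvPolynomial.coeff_map]
  by_cases hm : m ∈ P.support ∪ P'.support
  · exact hi m hm
  · simp only [Finset.mem_union, MvPolynomial.mem_support_iff, not_or, not_not] at hm
    simp [hm.1, hm.2]

theorem exists_finset_totalDegree_le (τ : Type*) [Finite τ] (d : ℕ) : ∃ s : Finset (τ →₀ ℕ),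
    ∀ m : τ →₀ ℕ, (m.sum fun _ e => e) ≤ d → m ∈ s := by
  classical
  refine ⟨Finset.Icc 0 (Finsupp.equivFunOnFinite.symm fun _ : τ => d), fun m hm => ?_⟩
  refine Finset.mem_Icc.2 ⟨zero_le, fun t => ?_⟩
  by_cases ht : t ∈ m.support
  · exact (Finset.single_le_sum (f := fun t => m t) (fun _ _ => Nat.zero_le _) ht).trans hm
  · simp [Finsupp.notMem_support_iff.1 ht]

/-- The degree bound leaves finitely many monomials, so a family of polynomials assembles into a
single polynomial over the product ring. -/
theorem IsUlim.exists_mvPolynomial_lift (h : IsUlim U q) {τ : Type*} [Finite τ] (d : ℕ)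
    (a : ∀ i, MvPolynomial τ (R i)) (ha : ∀ᶠ i in (U : Filter I), (a i).totalDegree ≤ d) :
    ∃ ã : MvPolynomial τ (∀ i, R i),
      (∀ᶠ i in (U : Filter I), MvPolynomial.map (Pi.evalRingHom R i) ã = a i) ∧
        ((∀ᶠ i in (U : Filter I), (a i).totalDegree ≠ 0) → (MvPolynomial.map q ã).totalDegree ≠ 0) := by
  classical
  obtain ⟨s, hs⟩ := exists_finset_totalDegree_le τ d
  have h1 : ∀ᶠ i in (U : Filter I), MvPolynomial.map (Pi.evalRingHom R i)
      (∑ m ∈ s, MvPolynomial.monomial m fun i => (a i).coeff m) = a i := by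
    filter_upwards [ha] with i hi
    have hsub : (a i).support ⊆ s := fun m hm => hs m ((MvPolynomial.le_totalDegree hm).trans hi)
    conv_rhs => rw [(a i).as_sum]
    have h0 : ∀ m ∈ s, m ∉ (a i).support → MvPolynomial.monomial m ((a i).coeff m) = 0 :=
      fun m _ hm => by rw [MvPolynomial.notMem_support_iff.1 hm, map_zero]
    rw [Finset.sum_subset hsub h0]
    simp [map_sum, MvPolynomial.map_monomial]
  refine ⟨∑ m ∈ s, MvPolynomial.monomial m fun i => (a i).coeff m, h1, fun h2 h0 => ?_⟩
  rw [MvPolynomial.totalDegree_eq_zero_iff_eq_C] at h0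
  have h3 := h.map_mvPolynomial_eq (P := ∑ m ∈ s, MvPolynomial.monomial m fun i => (a i).coeff m)
    (P' := MvPolynomial.C (MvPolynomial.coeff 0
    (∑ m ∈ s, MvPolynomial.monomial m fun i => (a i).coeff m))) (by
      rw [MvPolynomial.map_C, ← MvPolynomial.coeff_map]; exact h0)
  obtain ⟨i, hi1, hi2, hi3⟩ := (h1.and (h2.and h3)).exists
  apply hi2
  rw [← hi1, hi3, MvPolynomial.map_C, MvPolynomial.totalDegree_C]

theorem isUnit_mvPolynomial_iff {k τ : Type*} [Field k] {f : MvPolynomial τ k} (hf : f ≠ 0) :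
    IsUnit f ↔ f.totalDegree = 0 := by
  rw [MvPolynomial.isUnit_iff_totalDegree_of_isReduced]
  refine ⟨fun h => h.2, fun h => ⟨?_, h⟩⟩
  rw [isUnit_iff_ne_zero]
  intro h0
  rw [MvPolynomial.totalDegree_eq_zero_iff_eq_C, h0, map_zero] at h
  exact hf h

theorem exists_factors_of_not_irreducible {k τ : Type*} [Field k] {f : MvPolynomial τ k}
    (hf : f ≠ 0) (hd : f.totalDegree ≠ 0) (hirr : ¬ Irreducible f) :
    ∃ a b, f = a * b ∧ a.totalDegree ≠ 0 ∧ b.totalDegree ≠ 0 ∧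
      a.totalDegree ≤ f.totalDegree ∧ b.totalDegree ≤ f.totalDegree := by
  rw [irreducible_iff] at hirr
  push Not at hirr
  obtain ⟨a, b, hab, ha, hb⟩ := hirr (by rwa [isUnit_mvPolynomial_iff hf])
  have ha0 : a ≠ 0 := by rintro rfl; exact hf (by simpa using hab)
  have hb0 : b ≠ 0 := by rintro rfl; exact hf (by simpa using hab)
  have h := MvPolynomial.totalDegree_mul_of_isDomain ha0 hb0
  rw [← hab] at h
  rw [isUnit_mvPolynomial_iff ha0] at ha
  rw [isUnit_mvPolynomial_iff hb0] at hb
  exact ⟨a, b, hab, ha, hb, by omega, by omega⟩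

theorem IsUlim.eventually_totalDegree_ne_zero (h : IsUlim U q) {τ : Type*}
    {p : MvPolynomial τ (∀ i, R i)} (hp : (MvPolynomial.map q p).totalDegree ≠ 0) :
    ∀ᶠ i in (U : Filter I), (MvPolynomial.map (Pi.evalRingHom R i) p).totalDegree ≠ 0 := by
  by_contra hcon
  rw [← Ultrafilter.eventually_not] at hcon
  apply hp
  rw [MvPolynomial.totalDegree_eq_zero_iff_eq_C, MvPolynomial.coeff_map, ← MvPolynomial.map_C]
  ext m
  rw [MvPolynomial.coeff_map, MvPolynomial.coeff_map, h.eq_iff]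
  filter_upwards [hcon] with i hi
  rw [not_not, MvPolynomial.totalDegree_eq_zero_iff_eq_C, MvPolynomial.coeff_map,
    ← MvPolynomial.map_C] at hi
  have := congrArg (MvPolynomial.coeff m) hi
  rwa [MvPolynomial.coeff_map, MvPolynomial.coeff_map] at this

theorem IsUlim.map_mul_eq (h : IsUlim U q) {τ : Type*} {p a b : MvPolynomial τ (∀ i, R i)}
    (hab : ∀ᶠ i in (U : Filter I), MvPolynomial.map (Pi.evalRingHom R i) p =
      MvPolynomial.map (Pi.evalRingHom R i) a * MvPolynomial.map (Pi.evalRingHom R i) b) :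
    MvPolynomial.map q p = MvPolynomial.map q a * MvPolynomial.map q b := by
  rw [← map_mul]
  ext m
  rw [MvPolynomial.coeff_map, MvPolynomial.coeff_map, h.eq_iff]
  filter_upwards [hab] with i h1
  rw [← map_mul] at h1
  have := congrArg (MvPolynomial.coeff m) h1
  rwa [MvPolynomial.coeff_map, MvPolynomial.coeff_map] at this

/-- The degrees of factors are bounded by the degree of the product, so factorizations at almost all
indices would assemble into a factorization over the ultraproduct. -/
theorem IsUlim.irreducible {R : I → Type w} [∀ i, Field (R i)]
    {Q : Type w} [Field Q] {q : (∀ i, R i) →+* Q} (h : IsUlim U q) {τ : Type*} [Finite τ]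
    {p : MvPolynomial τ (∀ i, R i)} (hp : Irreducible (MvPolynomial.map q p)) :
    ∀ᶠ i in (U : Filter I), Irreducible (MvPolynomial.map (Pi.evalRingHom R i) p) := by
  classical
  have hdeg := h.eventually_totalDegree_ne_zero (p := p) fun h3 =>
    hp.not_isUnit ((isUnit_mvPolynomial_iff hp.ne_zero).2 h3)
  have hne := h.map_mvPolynomial_ne_zero hp.ne_zero
  have hle : ∀ i, (MvPolynomial.map (Pi.evalRingHom R i) p).totalDegree ≤ p.totalDegree := fun i =>
    Finset.sup_mono (MvPolynomial.support_map_subset _ _)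
  by_contra hcon
  rw [← Ultrafilter.eventually_not] at hcon
  have hfac : ∀ i, ∃ a b : MvPolynomial τ (R i),
      (MvPolynomial.map (Pi.evalRingHom R i) p ≠ 0 ∧
        (MvPolynomial.map (Pi.evalRingHom R i) p).totalDegree ≠ 0 ∧
        ¬ Irreducible (MvPolynomial.map (Pi.evalRingHom R i) p)) →
      MvPolynomial.map (Pi.evalRingHom R i) p = a * b ∧ a.totalDegree ≠ 0 ∧ b.totalDegree ≠ 0 ∧
        a.totalDegree ≤ p.totalDegree ∧ b.totalDegree ≤ p.totalDegree := by
    intro i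
    by_cases hi : (MvPolynomial.map (Pi.evalRingHom R i) p ≠ 0 ∧
        (MvPolynomial.map (Pi.evalRingHom R i) p).totalDegree ≠ 0 ∧
        ¬ Irreducible (MvPolynomial.map (Pi.evalRingHom R i) p))
    · obtain ⟨a, b, h1, h2, h3, h4, h5⟩ := exists_factors_of_not_irreducible hi.1 hi.2.1 hi.2.2
      exact ⟨a, b, fun _ => ⟨h1, h2, h3, h4.trans (hle i), h5.trans (hle i)⟩⟩
    · exact ⟨0, 0, fun h => absurd h hi⟩
  choose a b hab using hfac
  have hall : ∀ᶠ i in (U : Filter I), MvPolynomial.map (Pi.evalRingHom R i) p = a i * b i ∧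
      (a i).totalDegree ≠ 0 ∧ (b i).totalDegree ≠ 0 ∧
        (a i).totalDegree ≤ p.totalDegree ∧ (b i).totalDegree ≤ p.totalDegree := by
    filter_upwards [hcon, hne, hdeg] with i h1 h2 h3 using hab i ⟨h2, h3, h1⟩
  obtain ⟨a', ha1, ha2⟩ := h.exists_mvPolynomial_lift p.totalDegree a
    (hall.mono fun i hi => hi.2.2.2.1)
  obtain ⟨b', hb1, hb2⟩ := h.exists_mvPolynomial_lift p.totalDegree b
    (hall.mono fun i hi => hi.2.2.2.2)
  have hprod : MvPolynomial.map q p = MvPolynomial.map q a' * MvPolynomial.map q b' := by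
    refine h.map_mul_eq ?_
    filter_upwards [hall, ha1, hb1] with i h1 h2 h3
    rw [h2, h3, h1.1]
  have hda := ha2 (hall.mono fun i hi => hi.2.1)
  have hdb := hb2 (hall.mono fun i hi => hi.2.2.1)
  rcases hp.isUnit_or_isUnit hprod with hu | hu
  · exact hda (MvPolynomial.isUnit_iff_totalDegree_of_isReduced.1 hu).2
  · exact hdb (MvPolynomial.isUnit_iff_totalDegree_of_isReduced.1 hu).2

end Ulim

end FreeOp

/-! ### Function fields as hypersurfaces; algebraic independence in ultraproducts -/

namespace FreeOp

open FirstOrder FirstOrder.Language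

-- A finitely generated extension in characteristic zero is the function field of a hypersurface:
-- take a maximal independent `u` inside `V` and a primitive element for the remaining algebraic
-- extension. A single equation is convenient because its irreducibility transfers by
-- `IsUlim.irreducible`.
open scoped IntermediateField.algebraAdjoinAdjoin in
theorem exists_primitive_presentation {k M : Type*} [Field k] [CharZero k] [Field M] [Algebra k M]
    (V : Set M) (hV : V.Finite) :
    ∃ (u : Set M) (w : Option u → M) (p : MvPolynomial (Option u) k), u.Finite ∧ 
      AlgebraicIndependent k (fun x => w (some x)) ∧ Irreducible p ∧ MvPolynomial.aeval w p = 0 ∧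
      ∀ x ∈ V, ∃ r s : MvPolynomial (Option u) k, MvPolynomial.aeval w s ≠ 0 ∧
        x * MvPolynomial.aeval w s = MvPolynomial.aeval w r := by
  classical
  obtain ⟨u, -, hu⟩ := exists_maximal_algebraicIndependent (R := k) ∅ V (Set.empty_subset _)
    ((algebraicIndependent_empty_iff ..).mpr (algebraMap k M).injective)
  have hui := hu.prop.1
  have huV : u ⊆ V := hu.prop.2
  have halg : ∀ x ∈ V, IsAlgebraic (Algebra.adjoin k u) x := by
    intro x hx
    by_contra hcon
    have h1 : AlgebraicIndepOn k id (insert x u) := by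
      refine AlgebraicIndepOn.insert hui ?_
      rw [Set.image_id]
      exact hcon
    have h2 : insert x u ⊆ V := Set.insert_subset hx huV
    have h3 := hu.le_of_ge ⟨h1, h2⟩ (Set.subset_insert x u)
    have hxu : x ∈ u := h3 (Set.mem_insert x u)
    exact hcon (isAlgebraic_algebraMap (⟨x, Algebra.subset_adjoin hxu⟩ : Algebra.adjoin k u))
  let F0 := IntermediateField.adjoin k u
  have : CharZero F0 := charZero_of_injective_algebraMap (algebraMap k F0).injective
  have hint : ∀ x ∈ V, IsIntegral F0 x := by
    intro x hx
    rw [← isAlgebraic_iff_isIntegral]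
    have := halg x hx
    obtain ⟨f, hf, hf0⟩ := this
    let ι : Algebra.adjoin k u →+* F0 := (Subalgebra.inclusion
      (IntermediateField.algebra_adjoin_le_adjoin k u)).toRingHom
    have hι : Function.Injective ι := Subalgebra.inclusion_injective _
    refine ⟨f.map ι, (Polynomial.map_ne_zero_iff hι).2 hf, ?_⟩
    rw [Polynomial.aeval_def, Polynomial.eval₂_map]
    exact hf0
  have : Finite V := hV
  have hfd : FiniteDimensional F0 (IntermediateField.adjoin F0 V) :=
    IntermediateField.finiteDimensional_adjoin hint
  obtain ⟨α, hα⟩ := Field.exists_primitive_element F0 (IntermediateField.adjoin F0 V)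
  let w : Option u → M := fun o => o.elim (α : M) fun x => x
  have hαalg : IsAlgebraic (Algebra.adjoin k u) (α : M) := by
    have h1 : IsAlgebraic F0 (α : M) :=
      (Algebra.IsAlgebraic.isAlgebraic (R := F0) α).algebraMap
    have : IsFractionRing (Algebra.adjoin k u) F0 := inferInstance
    exact (IsFractionRing.isAlgebraic_iff (Algebra.adjoin k u) F0 M).2 h1
  have hrange : Set.range w = insert (α : M) u := by
    ext x
    simp [w, Option.exists, eq_comm]
  have hle : V ⊆ IntermediateField.adjoin k (Set.range w) := by
    intro x hx
    have hx1 : x ∈ IntermediateField.adjoin F0 V := IntermediateField.subset_adjoin _ _ hx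
    have hx2 : (⟨x, hx1⟩ : IntermediateField.adjoin F0 V) ∈
        IntermediateField.adjoin F0 {α} := by rw [hα]; trivial
    have hx3 : x ∈ IntermediateField.adjoin F0 {(α : M)} := by
      have := IntermediateField.mem_map (f := (IntermediateField.adjoin F0 V).val)
        (S := IntermediateField.adjoin F0 {α}) |>.2 ⟨_, hx2, rfl⟩
      rw [IntermediateField.adjoin_map] at this
      simpa using this
    have hx4 : x ∈ (IntermediateField.adjoin F0 {(α : M)}).restrictScalars k := hx3
    rw [IntermediateField.adjoin_adjoin_left] at hx4
    rw [hrange, Set.insert_eq, Set.union_comm]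
    exact hx4
  have hker : RingHom.ker (MvPolynomial.aeval w : MvPolynomial (Option u) k →ₐ[k] M) ≠ ⊥ := by
    intro h
    have hinj : Function.Injective (MvPolynomial.aeval w : MvPolynomial (Option u) k →ₐ[k] M) :=
      (RingHom.injective_iff_ker_eq_bot _).2 h
    have hAI : AlgebraicIndependent k w := hinj
    have := (AlgebraicIndependent.option_iff (x := fun x : u => (x : M)) (a := (α : M))).1 hAI
    apply this.2
    rwa [Subtype.range_coe]
  -- A nonzero prime ideal of a factorial ring contains a prime element.
  obtain ⟨p, hp, hprime⟩ := (RingHom.ker_isPrime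
    (MvPolynomial.aeval w : MvPolynomial (Option u) k →ₐ[k] M)).exists_mem_prime_of_ne_bot hker
  refine ⟨u, w, p, hV.subset huV, hui, hprime.irreducible, hp, fun x hx => ?_⟩
  obtain ⟨r, s, hrs⟩ := (IntermediateField.mem_adjoin_range_iff k w x).1 (hle hx)
  -- The representation as a quotient allows a vanishing denominator; then x = 0, written as 0 / 1.
  by_cases hs : MvPolynomial.aeval w s = 0
  · refine ⟨0, 1, by simp, ?_⟩
    rw [hrs, hs]
    simp
  · exact ⟨r, s, hs, by rw [hrs, div_mul_cancel₀ _ hs]⟩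

section Ulim

variable {I : Type w} {U : Ultrafilter I} {K Ω : I → Type w} [∀ i, Field (K i)]
  [∀ i, Field (Ω i)] [∀ i, Algebra (K i) (Ω i)] {Ks Qs : Type w} [Field Ks] [Field Qs]
  [Algebra Ks Qs] {q : (∀ i, K i) →+* Ks} {qΩ : (∀ i, Ω i) →+* Qs}

theorem ulim_aeval
    (hc : ∀ x : ∀ i, K i, qΩ (fun i => algebraMap (K i) (Ω i) (x i)) = algebraMap Ks Qs (q x))
    {τ : Type*} (z : τ → ∀ i, Ω i) (P : MvPolynomial τ (∀ i, K i)) :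
    qΩ (fun i => MvPolynomial.aeval (fun t => z t i) (MvPolynomial.map (Pi.evalRingHom K i) P)) =
      MvPolynomial.aeval (fun t => qΩ (z t)) (MvPolynomial.map q P) := by
  induction P using MvPolynomial.induction_on with
  | C a => simpa using hc a
  | add f g hf hg =>
    rw [map_add, map_add, ← hf, ← hg, ← map_add]
    congr 1
    funext i
    simp
  | mul_X f n hf =>
    rw [map_mul, map_mul, ← hf, MvPolynomial.map_X, MvPolynomial.aeval_X, ← map_mul]
    congr 1
    funext i
    simp

/-- A relation over the ultraproduct lifts to one at almost every index, so independence passes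
upwards without finiteness assumptions. -/
theorem ulim_algebraicIndependent (hq : IsUlim U q) (hΩ : IsUlim U qΩ)
    (hc : ∀ x : ∀ i, K i, qΩ (fun i => algebraMap (K i) (Ω i) (x i)) = algebraMap Ks Qs (q x))
    {τ : Type*} {x : τ → ∀ i, Ω i} (hx : ∀ i, AlgebraicIndependent (K i) fun t => x t i) :
    AlgebraicIndependent Ks fun t => qΩ (x t) := by
  rw [algebraicIndependent_iff]
  intro P hP
  obtain ⟨P, rfl⟩ := MvPolynomial.map_surjective q hq.surjective P
  by_contra hne
  have h1 := hq.map_mvPolynomial_ne_zero hne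
  rw [← ulim_aeval hc, hΩ.eq_zero_iff] at hP
  obtain ⟨i, hi1, hi2⟩ := (h1.and hP).exists
  exact hi1 ((algebraicIndependent_iff.1 (hx i)) _ hi2)

/-- An algebraic dependence is one polynomial relation with finitely many coefficients, so it
descends to almost all indices. -/
theorem eventually_isAlgebraic (hq : IsUlim U q) (hΩ : IsUlim U qΩ)
    (hc : ∀ x : ∀ i, K i, qΩ (fun i => algebraMap (K i) (Ω i) (x i)) = algebraMap Ks Qs (q x))
    {E : Type*} [Field E] [Algebra Ks E] (h : E →ₐ[Ks] Qs) {τ : Type*} (yE : τ → E)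
    (y : τ → ∀ i, Ω i) (hy : ∀ t, qΩ (y t) = h (yE t)) (a : E) (x : ∀ i, Ω i) (hx : qΩ x = h a)
    (ha : IsAlgebraic (Algebra.adjoin Ks (Set.range yE)) a) :
    ∀ᶠ i in (U : Filter I),
      IsAlgebraic (Algebra.adjoin (K i) (Set.range fun t => y t i)) (x i) := by
  obtain ⟨f, hf, hf0⟩ := ha
  have hcoef : ∀ n, ∃ c : MvPolynomial τ (∀ i, K i),
      MvPolynomial.aeval yE (MvPolynomial.map q c) = (f.coeff n : E) := by
    intro n
    have := (f.coeff n).2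
    obtain ⟨c, hc'⟩ := (Algebra.adjoin_range_eq_range_aeval Ks yE).le this
    obtain ⟨c, rfl⟩ := MvPolynomial.map_surjective q hq.surjective c
    exact ⟨c, hc'⟩
  choose c hcf using hcoef
  have key : ∀ n, qΩ (fun i => MvPolynomial.aeval (fun t => y t i)
      (MvPolynomial.map (Pi.evalRingHom K i) (c n))) = h (f.coeff n : E) := by
    intro n
    rw [ulim_aeval hc, ← hcf, MvPolynomial.comp_aeval_apply]
    simp only [hy]
  obtain ⟨n, hn⟩ : ∃ n, f.coeff n ≠ 0 := by
    by_contra hcon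
    push Not at hcon
    exact hf (Polynomial.ext (by simpa using hcon))
  have hnΩ : qΩ (fun i => MvPolynomial.aeval (fun t => y t i)
      (MvPolynomial.map (Pi.evalRingHom K i) (c n))) ≠ 0 := by
    rw [key, Ne, map_eq_zero_iff h h.injective]
    simpa using hn
  rw [hΩ.ne_zero_iff] at hnΩ
  have hsum : qΩ (fun i => ∑ l ∈ Finset.range (f.natDegree + 1),
      MvPolynomial.aeval (fun t => y t i)
        (MvPolynomial.map (Pi.evalRingHom K i) (c l)) * x i ^ l) = 0 := by
    have h1 : (fun i => ∑ l ∈ Finset.range (f.natDegree + 1),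
      MvPolynomial.aeval (fun t => y t i)
        (MvPolynomial.map (Pi.evalRingHom K i) (c l)) * x i ^ l) =
        ∑ l ∈ Finset.range (f.natDegree + 1), (fun i => MvPolynomial.aeval (fun t => y t i)
          (MvPolynomial.map (Pi.evalRingHom K i) (c l))) * x ^ l := by
      funext i
      simp [Finset.sum_apply]
    rw [h1, map_sum]
    simp only [map_mul, map_pow, key, hx]
    rw [Polynomial.aeval_eq_sum_range] at hf0
    have := congrArg h hf0
    simpa [map_sum, Algebra.smul_def] using this
  rw [hΩ.eq_zero_iff] at hsum
  filter_upwards [hnΩ, hsum] with i hi1 hi2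
  let B := Algebra.adjoin (K i) (Set.range fun t => y t i)
  have hmem : ∀ g : MvPolynomial τ (K i), MvPolynomial.aeval (fun t => y t i) g ∈ B := by
    intro g
    change _ ∈ Algebra.adjoin (K i) (Set.range fun t => y t i)
    rw [Algebra.adjoin_range_eq_range_aeval]
    exact ⟨g, rfl⟩
  let F : Polynomial B := ∑ l ∈ Finset.range (f.natDegree + 1),
    Polynomial.monomial l ⟨_, hmem (MvPolynomial.map (Pi.evalRingHom K i) (c l))⟩
  have hnle : n ∈ Finset.range (f.natDegree + 1) := by
    rw [Finset.mem_range, Nat.lt_succ_iff]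
    exact Polynomial.le_natDegree_of_ne_zero hn
  refine ⟨F, fun hF => hi1 ?_, ?_⟩
  · have h2 := congrArg (fun F => F.coeff n) hF
    simp only [F, Polynomial.finsetSum_coeff, Polynomial.coeff_monomial] at h2
    rw [Finset.sum_ite_eq' _ n, if_pos hnle] at h2
    exact congrArg Subtype.val h2
  · rw [← hi2, map_sum]
    refine Finset.sum_congr rfl fun l _ => ?_
    rw [Polynomial.aeval_monomial]
    rfl

/-- Independence need not descend by itself, since the relations at the various indices may have
unbounded degree. Finite transcendence degree repairs this: extend `zE` to a transcendence basis of
`E`; algebraicity of the `xE` over it descends, and |ι| elements over which `Ω i` is algebraic must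
be a basis, because the transcendence degree is |ι|. -/
theorem eventually_algebraicIndependent (hq : IsUlim U q) (hΩ : IsUlim U qΩ)
    (hc : ∀ x : ∀ i, K i, qΩ (fun i => algebraMap (K i) (Ω i) (x i)) = algebraMap Ks Qs (q x))
    {E : Type*} [Field E] [Algebra Ks E] (h : E →ₐ[Ks] Qs) {ι κ : Type w} [Finite ι] [Finite κ]
    {xE : ι → E} (hxE : IsTranscendenceBasis Ks xE) {x : ι → ∀ i, Ω i}
    (hxh : ∀ k, qΩ (x k) = h (xE k))
    (hx : ∀ i, IsTranscendenceBasis (K i) fun k => x k i)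
    {zE : κ → E} (hzE : AlgebraicIndependent Ks zE) {z : κ → ∀ i, Ω i}
    (hz : ∀ k, qΩ (z k) = h (zE k)) :
    ∀ᶠ i in (U : Filter I), AlgebraicIndependent (K i) fun k => z k i := by
  classical
  have hℓ : ∀ e : E, ∃ y : ∀ i, Ω i, qΩ y = h e := fun e => hΩ.surjective _
  choose ℓ hℓ using hℓ
  have halg : Algebra.IsAlgebraic (Algebra.adjoin Ks (Set.range zE ∪ Set.range xE)) E := by
    have := hxE.isAlgebraic
    refine ⟨fun a => (Algebra.IsAlgebraic.isAlgebraic (R := Algebra.adjoin Ks (Set.range xE))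
      a).adjoin_of_forall_isAlgebraic fun b hb => absurd (Or.inr hb.1) hb.2⟩
  obtain ⟨B, hB1, hB2, hB⟩ := exists_isTranscendenceBasis_between (R := Ks) (Set.range zE)
    (Set.range zE ∪ Set.range xE) Set.subset_union_left hzE.to_subtype_range
  have hfinB : Finite B := ((Set.finite_range zE).union (Set.finite_range xE)).subset hB2
  have hcard := hxE.lift_cardinalMk_eq hB
  have h1 : ∀ k, ∀ᶠ i in (U : Filter I), IsAlgebraic (Algebra.adjoin (K i)
      (Set.range fun b : B => ℓ b i)) (x k i) := by
    intro k
    have := hB.isAlgebraic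
    exact eventually_isAlgebraic hq hΩ hc h (fun b : B => (b : E)) (fun b => ℓ b)
      (fun b => hℓ b) (xE k) (x k) (hxh k) (Algebra.IsAlgebraic.isAlgebraic _)
  have h2 : ∀ k, ∀ᶠ i in (U : Filter I), ℓ (zE k) i = z k i := by
    intro k
    rw [← hΩ.eq_iff, hℓ, hz]
  rw [← Filter.eventually_all] at h1 h2
  filter_upwards [h1, h2] with i hi1 hi2
  have halg2 : Algebra.IsAlgebraic (Algebra.adjoin (K i) (Set.range fun b : B => ℓ b i)) (Ω i) := by
    have := (hx i).isAlgebraic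
    refine ⟨fun a => (Algebra.IsAlgebraic.isAlgebraic (R := Algebra.adjoin (K i)
      (Set.range fun k => x k i)) a).adjoin_of_forall_isAlgebraic ?_⟩
    rintro b ⟨⟨k, rfl⟩, -⟩
    exact hi1 k
  have hbase : IsTranscendenceBasis (K i) fun b : B => ℓ b i := by
    refine Algebra.IsAlgebraic.isTranscendenceBasis_of_lift_le_trdeg_of_finite (K i) _ ?_
    have h3 := (hx i).lift_cardinalMk_eq_trdeg
    have h4 : Nat.card ι = Nat.card B := by
      simpa [Nat.card] using congrArg Cardinal.toNat hcard
    have h5 : Cardinal.mk ι = Nat.card ι := Nat.cast_card.symm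
    have h6 : Cardinal.mk B = Nat.card B := Nat.cast_card.symm
    rw [Cardinal.lift_id, Cardinal.lift_id] at h3
    rw [← h3, h5, h6, h4]
    simp
  have h7 := hbase.1.comp (fun k => (⟨zE k, hB1 ⟨k, rfl⟩⟩ : B)) fun a b hab =>
    hzE.injective (congrArg Subtype.val hab)
  convert h7 using 1
  funext k
  exact (hi2 k).symm

end Ulim

end FreeOp

/-! ### Auxiliary fields, and 𝒟-fields obtained from maps on polynomial rings -/

namespace FreeOp

open FirstOrder FirstOrder.Language

theorem exists_isTranscendenceBasis_adjoin {k M : Type w} [Field k] [Field M] [Algebra k M]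
    (W : Set M) (hW : W.Finite) :
    ∃ (ι : Type w) (_ : Finite ι) (x : ι → IntermediateField.adjoin k W),
      IsTranscendenceBasis k x := by
  let s : Set (IntermediateField.adjoin k W) := Subtype.val ⁻¹' W
  have hs : s.Finite := hW.preimage Subtype.val_injective.injOn
  have himg : Subtype.val '' s = W := by
    ext r
    constructor
    · rintro ⟨r, hr, rfl⟩
      exact hr
    · exact fun hr => ⟨⟨r, IntermediateField.subset_adjoin k W hr⟩, hr, rfl⟩
  have hlift : ∀ r ∈ Algebra.adjoin k W, ∃ r' : IntermediateField.adjoin k W,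
      r' ∈ Algebra.adjoin k s ∧ (r' : M) = r := by
    intro r hr
    have h1 := (IntermediateField.adjoin k W).val.map_adjoin s
    have h2 : r ∈ (Algebra.adjoin k s).map (IntermediateField.adjoin k W).val := by
      rw [h1]
      change r ∈ Algebra.adjoin k (Subtype.val '' s)
      rwa [himg]
    obtain ⟨r', hr', h3⟩ := h2
    exact ⟨r', hr', h3⟩
  have halg : Algebra.IsAlgebraic (Algebra.adjoin k s) (IntermediateField.adjoin k W) := by
    refine ⟨fun e => ?_⟩
    obtain ⟨r, hr, t, ht, he⟩ := IntermediateField.mem_adjoin_iff_div.1 e.2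
    obtain ⟨r', hr', rfl⟩ := hlift r hr
    obtain ⟨t', ht', rfl⟩ := hlift t ht
    have : e = r' * t'⁻¹ := Subtype.ext (he.trans (div_eq_mul_inv _ _))
    rw [this]
    exact (isAlgebraic_algebraMap (⟨r', hr'⟩ : Algebra.adjoin k s)).mul
      (isAlgebraic_algebraMap (⟨t', ht'⟩ : Algebra.adjoin k s)).inv
  obtain ⟨t, hts, ht⟩ := exists_isTranscendenceBasis_subset (R := k) s
  exact ⟨t, hs.subset hts, _, ht⟩

/-- Send the basis to `y`, then extend over the remaining algebraic extension into the algebraically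
closed `Q`. -/
theorem exists_algHom_of_isTranscendenceBasis {k E Q ι : Type*} [Field k] [Field E] [Field Q]
    [Algebra k E] [Algebra k Q] [IsAlgClosed Q] {x : ι → E} (hx : IsTranscendenceBasis k x)
    {y : ι → Q} (hy : AlgebraicIndependent k y) :
    ∃ h : E →ₐ[k] Q, ∀ t, h (x t) = y t := by
  let φ : Algebra.adjoin k (Set.range x) →ₐ[k] Q :=
    (MvPolynomial.aeval y).comp (hx.1.aevalEquiv.symm : _ →ₐ[k] MvPolynomial ι k)
  have hφ : Function.Injective φ := 
    Function.Injective.comp (g := MvPolynomial.aeval y) hy hx.1.aevalEquiv.symm.injective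
  let _ : Algebra (Algebra.adjoin k (Set.range x)) Q := φ.toRingHom.toAlgebra
  have : IsScalarTower k (Algebra.adjoin k (Set.range x)) Q :=
    IsScalarTower.of_algebraMap_eq fun r => (φ.commutes r).symm
  have : FaithfulSMul (Algebra.adjoin k (Set.range x)) Q :=
    (faithfulSMul_iff_algebraMap_injective _ _).2 hφ
  have := hx.isAlgebraic
  let h : E →ₐ[Algebra.adjoin k (Set.range x)] Q := IsAlgClosed.lift
  refine ⟨h.restrictScalars k, fun t => ?_⟩
  have h1 := h.commutes ⟨x t, Algebra.subset_adjoin ⟨t, rfl⟩⟩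
  refine h1.trans ?_
  change φ ⟨x t, _⟩ = y t
  have h2 : hx.1.aevalEquiv.symm ⟨x t, Algebra.subset_adjoin ⟨t, rfl⟩⟩ = MvPolynomial.X t := by
    rw [AlgEquiv.symm_apply_eq]
    apply Subtype.ext
    have := hx.1.algebraMap_aevalEquiv (MvPolynomial.X t)
    rw [MvPolynomial.aeval_X] at this
    exact this.symm
  simp [φ, h2]

theorem exists_isAlgClosed_isTranscendenceBasis (A : Type u) [Field A] (k ι : Type w) [Field k]
    [Algebra A k] :
    ∃ (Ω : Type w) (_ : Field Ω) (_ : Algebra k Ω) (_ : Algebra A Ω) (_ : IsScalarTower A k Ω)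
      (_ : IsAlgClosed Ω) (x : ι → Ω), IsTranscendenceBasis k x := by
  let Ω := AlgebraicClosure (FractionRing (MvPolynomial ι k))
  let F : Field Ω := inferInstance
  let _ : Algebra k Ω := inferInstance
  let _ : Algebra A Ω := ((algebraMap k Ω).comp (algebraMap A k)).toAlgebra
  refine ⟨Ω, F, inferInstance, inferInstance, IsScalarTower.of_algebraMap_eq fun _ => rfl,
    inferInstance, fun t => algebraMap (FractionRing (MvPolynomial ι k)) Ω
      (algebraMap (MvPolynomial ι k) _ (MvPolynomial.X t)), ?_⟩
  have h1 := IsTranscendenceBasis.mvPolynomial ι k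
  have : Algebra.IsAlgebraic (MvPolynomial ι k) (FractionRing (MvPolynomial ι k)) :=
    IsLocalization.isAlgebraic _ (nonZeroDivisors _)
  have h2 := h1.algebraMap_comp (A := FractionRing (MvPolynomial ι k))
  exact h2.algebraMap_comp (A := Ω)

variable {A : Type u} [Field A] {D : Type v} [CommRing D] [Algebra A D] {m t : ℕ}
  {S : OperatorData A D m} (P : LocalDecomposition S t)

theorem pi_tensor_ext (S : OperatorData A D m) {I : Type*} {R : I → Type*}
    [∀ i, CommRing (R i)] [∀ i, Algebra A (R i)]
    {y z : (∀ i, R i) ⊗[A] D}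
    (h : ∀ i, dmap D (Pi.evalAlgHom A R i) y = dmap D (Pi.evalAlgHom A R i) z) : y = z := by
  refine S.coord_ext fun k => funext fun i => ?_
  have := congrArg (S.coord k) (h i)
  rwa [S.coord_dmap, S.coord_dmap] at this

/-- The homomorphism `e` on a product of `𝒟`-fields. -/
noncomputable def piExp {I : Type w} (K : I → DField.{u, v, w} S) :
    (∀ i, K i) →ₐ[A] (∀ i, K i) ⊗[A] D :=
  have key : ∀ (x : ∀ i, K i) (i : I), dmap D (Pi.evalAlgHom A (fun i => (K i : Type w)) i)
      (S.ofCoord fun k i => S.coord k ((K i).exp (x i))) = (K i).exp (x i) := fun x i => by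
    rw [S.dmap_ofCoord]
    exact S.ofCoord_coord _
  { toFun := fun x => S.ofCoord fun k i => S.coord k ((K i).exp (x i))
    map_one' := pi_tensor_ext S fun i => by rw [key]; simp
    map_mul' := fun x y => pi_tensor_ext S fun i => by rw [key, map_mul, key, key]; simp
    map_zero' := pi_tensor_ext S fun i => by rw [key]; simp
    map_add' := fun x y => pi_tensor_ext S fun i => by rw [key, map_add, key, key]; simp
    commutes' := fun c => pi_tensor_ext S fun i => by
      rw [key, AlgHom.commutes]
      exact (K i).exp.commutes c }

theorem dmap_eval_piExp {I : Type w} (K : I → DField.{u, v, w} S) (x : ∀ i, K i) (i : I) :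
    dmap D (Pi.evalAlgHom A (fun i => (K i : Type w)) i) (piExp K x) = (K i).exp (x i) := by
  change dmap D _ (S.ofCoord fun k i => S.coord k ((K i).exp (x i))) = _
  rw [S.dmap_ofCoord]
  exact S.ofCoord_coord _

theorem coord_piExp {I : Type w} (K : I → DField.{u, v, w} S) (x : ∀ i, K i) (k : Fin (m + 1)) :
    S.coord k (piExp K x) = fun i => S.coord k ((K i).exp (x i)) :=
  S.coord_ofCoord _ _

/-- If a residue of `e g` vanishes then `p` divides `g`, because `p` is killed too and the variables
`some x` have independent images; hence `e g = 0`. So all residues are injective on the quotient by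
the kernel of `e`, and `exists_extension` applies. -/
theorem exists_dField_of_aevalTower (K : DField.{u, v, w} S) {Ω : Type w} [Field Ω] [CharZero Ω]
    [Algebra A Ω] [Algebra K Ω] [IsScalarTower A K Ω] {κ : Type w}
    (e : MvPolynomial (Option κ) K →ₐ[A] Ω ⊗[A] D)
    (hC : ∀ a, e (MvPolynomial.C a) = dmap D (IsScalarTower.toAlgHom A K Ω) (K.exp a))
    {p : MvPolynomial (Option κ) K} (hp : Irreducible p) (hp0 : e p = 0)
    (hAI : ∀ j, AlgebraicIndependent K
      fun x : κ => P.projBase j Ω (e (MvPolynomial.X (some x)))) :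
    ∃ (N : DField.{u, v, w} S) (φ : Ω →ₐ[A] N),
      DField.IsHom (φ.comp (IsScalarTower.toAlgHom A K Ω)) ∧
        ∀ g, N.exp (φ (S.coord 0 (e g))) = dmap D φ (e g) := by
  let ē : (MvPolynomial (Option κ) K ⧸ RingHom.ker e) →ₐ[A] Ω ⊗[A] D := Ideal.kerLiftAlg e
  have hinj : ∀ j r, P.projBase j Ω (ē r) = 0 → r = 0 := by
    intro j r hg
    obtain ⟨g, rfl⟩ := Ideal.Quotient.mk_surjective r
    rw [Ideal.Quotient.eq_zero_iff_mem, RingHom.mem_ker]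
    replace hg : P.projBase j Ω (e g) = 0 := hg
    let Ψ : MvPolynomial (Option κ) K →+* Ω := ((P.projBase j Ω).comp e).toRingHom
    -- On polynomials in the variables `some x` the residue twists the coefficients by σⱼ and
    -- evaluates at independent elements.
    have hren : ∀ g : MvPolynomial κ K, Ψ (MvPolynomial.rename some g) =
        MvPolynomial.aeval (fun x : κ => P.projBase j Ω (e (MvPolynomial.X (some x))))
          (MvPolynomial.map (K.sigma P j : K →+* K) g) := by
      intro g
      induction g using MvPolynomial.induction_on with
      | C a =>
        rw [MvPolynomial.rename_C, MvPolynomial.map_C, MvPolynomial.aeval_C]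
        change P.projBase j Ω (e (MvPolynomial.C a)) = _
        rw [hC, P.projBase_dmap]
        rfl
      | add f g hf hg => simp only [map_add, hf, hg]
      | mul_X f n hf =>
        simp only [map_mul, hf, MvPolynomial.rename_X, MvPolynomial.map_X, MvPolynomial.aeval_X]
        rfl
    have hΨ : ∀ g : MvPolynomial κ K, Ψ (MvPolynomial.rename some g) = 0 → g = 0 := by
      intro g hg
      rw [hren] at hg
      have := (algebraicIndependent_iff.1 (hAI j)) _ hg
      exact MvPolynomial.map_injective _ (K.sigma P j).toRingHom.injective (by simpa using this)
    obtain ⟨c, rfl⟩ := dvd_of_mvPolynomial_map_eq_zero Ψ hΨ hp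
      (by change P.projBase j Ω (e p) = 0; rw [hp0, map_zero]) hg
    rw [map_mul, hp0, zero_mul]
  obtain ⟨N, φ, -, -, hN⟩ := exists_extension P ((P.projBase 0 Ω).comp ē) ē
    (fun r => (P.projBase_zero _).symm) hinj
  have key : ∀ g, N.exp (φ (S.coord 0 (e g))) = dmap D φ (e g) := by
    intro g
    have := hN (Ideal.Quotient.mk _ g)
    rw [← P.projBase_zero]
    exact this
  refine ⟨N, φ, DField.isHom_iff.2 fun a => ?_, key⟩
  have h1 := key (MvPolynomial.C a)
  rw [hC, S.coord_dmap, K.coord_zero_exp, ← dmap_comp] at h1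
  exact h1.symm

end FreeOp

namespace FreeOp

open FirstOrder FirstOrder.Language

/-! ### Quantifier-free formulas under partial homomorphisms -/

section PartialHom

variable {L : FirstOrder.Language.{u, v}} {I : Type*} {M : Type*} [L.Structure M] {N : I → Type*}
  [∀ i, L.Structure (N i)]

/-- Eventually along `l`, the maps `g i` respect all functions inside `V` and are injective
on `V`. -/
structure EventuallyPartialHom (L : FirstOrder.Language.{u, v}) [L.Structure M]
    [∀ i, L.Structure (N i)] (l : Filter I) (g : ∀ i, M → N i) (V : Set M) : Prop where
  map_fun : ∀ {n : ℕ} (F : L.Functions n) (x : Fin n → M), (∀ k, x k ∈ V) →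
    Structure.funMap F x ∈ V →
      ∀ᶠ i in l, g i (Structure.funMap F x) = Structure.funMap F fun k => g i (x k)
  ne : ∀ x ∈ V, ∀ y ∈ V, x ≠ y → ∀ᶠ i in l, g i x ≠ g i y

theorem EventuallyPartialHom.mono {l : Filter I} {g : ∀ i, M → N i} {V V' : Set M}
    (h : EventuallyPartialHom L l g V') (hV : V ⊆ V') : EventuallyPartialHom L l g V :=
  ⟨fun F x hx hF => h.map_fun F x (fun k => hV (hx k)) (hV hF),
    fun x hx y hy => h.ne x (hV hx) y (hV hy)⟩

/-- `V` collects the values of all subterms. It is chosen before the filter and the maps, which are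
later constructed from it. -/
theorem exists_finite_realize_term {α : Type*} (t : L.Term α) (c : α → M) :
    ∃ V : Set M, V.Finite ∧ t.realize c ∈ V ∧
      ∀ {I : Type w} {N : I → Type w'} [∀ i, L.Structure (N i)] (l : Filter I) (g : ∀ i, M → N i),
        EventuallyPartialHom L l g V →
          ∀ᶠ i in l, t.realize (fun a => g i (c a)) = g i (t.realize c) := by
  induction t with
  | var a => exact ⟨{c a}, Set.finite_singleton _, rfl, fun l g _ => by simp⟩
  | func F ts ih =>
    choose V hV hmem h using ih
    refine ⟨(⋃ k, V k) ∪ {Structure.funMap F fun k => (ts k).realize c},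
      (Set.finite_iUnion hV).union (Set.finite_singleton _), Or.inr rfl, ?_⟩
    intro I N _ l g hg
    have h1 : ∀ k, ∀ᶠ i in l, (ts k).realize (fun a => g i (c a)) = g i ((ts k).realize c) :=
      fun k => h k l g (hg.mono ((Set.subset_iUnion V k).trans Set.subset_union_left))
    have h2 := hg.map_fun F (fun k => (ts k).realize c)
      (fun k => Or.inl (Set.mem_iUnion.2 ⟨k, hmem k⟩)) (Or.inr rfl)
    rw [← Filter.eventually_all] at h1
    filter_upwards [h1, h2] with i hi1 hi2
    rw [Term.realize, Term.realize, hi2]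
    simp only [hi1]

theorem exists_finite_realize_isQF [∀ n, IsEmpty (L.Relations n)] {α : Type*} {n : ℕ}
    {χ : L.BoundedFormula α n} (hχ : χ.IsQF) (c : α → M) (d : Fin n → M) :
    ∃ V : Set M, V.Finite ∧
      ∀ {I : Type w} {N : I → Type w'} [∀ i, L.Structure (N i)] (l : Filter I) (g : ∀ i, M → N i),
        EventuallyPartialHom L l g V →
          ∀ᶠ i in l, χ.Realize (fun a => g i (c a)) (fun k => g i (d k)) ↔ χ.Realize c d := by
  induction hχ with
  | falsum => exact ⟨∅, Set.finite_empty, fun l g _ => by simp [BoundedFormula.Realize]⟩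
  | of_isAtomic h =>
    cases h with
    | equal t₁ t₂ =>
      obtain ⟨V₁, h1, h1m, h1'⟩ := exists_finite_realize_term t₁ (Sum.elim c d)
      obtain ⟨V₂, h2, h2m, h2'⟩ := exists_finite_realize_term t₂ (Sum.elim c d)
      refine ⟨V₁ ∪ V₂, h1.union h2, ?_⟩
      intro I N _ l g hg
      have e1 := h1' l g (hg.mono Set.subset_union_left)
      have e2 := h2' l g (hg.mono Set.subset_union_right)
      have e3 : t₁.realize (Sum.elim c d) ≠ t₂.realize (Sum.elim c d) → ∀ᶠ i in l,
          g i (t₁.realize (Sum.elim c d)) ≠ g i (t₂.realize (Sum.elim c d)) :=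
        hg.ne _ (Or.inl h1m) _ (Or.inr h2m)
      have hel : ∀ i, (Sum.elim (fun a => g i (c a)) fun k => g i (d k)) =
          fun a => g i (Sum.elim c d a) := fun i => by
        funext a
        cases a <;> rfl
      by_cases heq : t₁.realize (Sum.elim c d) = t₂.realize (Sum.elim c d)
      · filter_upwards [e1, e2] with i hi1 hi2
        simp only [BoundedFormula.realize_bdEqual, hel, hi1, hi2, heq]
      · filter_upwards [e1, e2, e3 heq] with i hi1 hi2 hi3
        simp only [BoundedFormula.realize_bdEqual, hel, hi1, hi2, heq, hi3]
    | rel R ts => exact isEmptyElim R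
  | imp _ _ ih1 ih2 =>
    obtain ⟨V₁, h1, h1'⟩ := ih1
    obtain ⟨V₂, h2, h2'⟩ := ih2
    refine ⟨V₁ ∪ V₂, h1.union h2, ?_⟩
    intro I N _ l g hg
    filter_upwards [h1' l g (hg.mono Set.subset_union_left),
      h2' l g (hg.mono Set.subset_union_right)] with i hi1 hi2
    rw [BoundedFormula.realize_imp, BoundedFormula.realize_imp, hi1, hi2]

end PartialHom

/-! ### Descending extensions of an ultraproduct to its factors -/

section Approximation

variable {A : Type u} [Field A] {D : Type v} [CommRing D] [Algebra A D] {m t : ℕ}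
  {S : OperatorData A D m} (P : LocalDecomposition S t)

theorem eventually_dmap_eval_eq (S : OperatorData A D m) {I : Type w} {U : Ultrafilter I}
    {Ω : I → Type w} [∀ i, Field (Ω i)]
    [∀ i, Algebra A (Ω i)] {Qs : Type w} [Field Qs] [Algebra A Qs] {qΩ : (∀ i, Ω i) →ₐ[A] Qs}
    (hΩ : IsUlim U (qΩ : (∀ i, Ω i) →+* Qs)) {y z : (∀ i, Ω i) ⊗[A] D}
    (h : dmap D qΩ y = dmap D qΩ z) :
    ∀ᶠ i in (U : Filter I), dmap D (Pi.evalAlgHom A Ω i) y = dmap D (Pi.evalAlgHom A Ω i) z := by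
  have h1 : ∀ k, ∀ᶠ i in (U : Filter I), S.coord k y i = S.coord k z i := by
    intro k
    rw [← hΩ.eq_iff]
    have := congrArg (S.coord k) h
    rwa [S.coord_dmap, S.coord_dmap] at this
  rw [← Filter.eventually_all] at h1
  filter_upwards [h1] with i hi
  refine S.coord_ext fun k => ?_
  rw [S.coord_dmap, S.coord_dmap]
  exact hi k

theorem coord_zero_mul (P : LocalDecomposition S t) {R : Type w} [CommRing R] [Algebra A R]
    (y z : R ⊗[A] D) :
    S.coord 0 (y * z) = S.coord 0 y * S.coord 0 z := by
  rw [← P.projBase_zero, ← P.projBase_zero, ← P.projBase_zero, map_mul]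

/-- Since σⱼ is surjective on `K`, each relation among the σⱼ(x a) is the σⱼ-image of a relation
among the x a. -/
theorem algebraicIndependent_sigma (K : DField.{u, v, w} S) (hinv : K.IsInversive P)
    (M : DField.{u, v, w} S) [Algebra K M] [IsScalarTower A K M]
    (hf : DField.IsHom (IsScalarTower.toAlgHom A K M)) {κ : Type*} {x : κ → M}
    (hx : AlgebraicIndependent K x) (j : Fin (t + 1)) :
    AlgebraicIndependent K fun a => M.sigma P j (x a) := by
  rw [algebraicIndependent_iff]
  intro g hg
  obtain ⟨g, rfl⟩ := MvPolynomial.map_surjective (K.sigma P j : K →+* K) (hinv j) g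
  have key : ∀ g : MvPolynomial κ K, MvPolynomial.aeval (fun a => M.sigma P j (x a))
      (MvPolynomial.map (K.sigma P j : K →+* K) g) = M.sigma P j (MvPolynomial.aeval x g) := by
    intro g
    induction g using MvPolynomial.induction_on with
    | C a =>
      rw [MvPolynomial.map_C, MvPolynomial.aeval_C, MvPolynomial.aeval_C]
      exact hf.sigma P j a
    | add f g hf hg => simp only [map_add, hf, hg]
    | mul_X f n hf => simp only [map_mul, hf, MvPolynomial.map_X, MvPolynomial.aeval_X]
  rw [key] at hg
  have h1 : MvPolynomial.aeval x g = 0 := M.sigma_injective P j (by rw [hg, map_zero])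
  rw [algebraicIndependent_iff.1 hx g h1, map_zero]

end Approximation

end FreeOp

namespace FreeOp

open FirstOrder FirstOrder.Language

section Approximation

variable {A : Type u} [Field A] {D : Type v} [CommRing D] [Algebra A D] {m t : ℕ}
  {S : OperatorData A D m} (P : LocalDecomposition S t)

/-- Realizing finitely much of an extension `M` of an ultraproduct `Ks` of `𝒟`-fields `K i` in
extensions of almost all of the `K i`, given auxiliary algebraically closed fields `Ω i`. -/
theorem exists_approximation_aux {I : Type w} {U : Ultrafilter I} {K : I → DField.{u, v, w} S}
    {Ks : DField.{u, v, w} S} (hinv : Ks.IsInversive P) (q : (∀ i, K i) →ₐ[A] Ks)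
    (hq : IsUlim U (q : (∀ i, K i) →+* Ks))
    (hop : ∀ (x : ∀ i, K i) k, q (fun i => (K i).op k (x i)) = Ks.op k (q x))
    {Ω : I → Type w} [∀ i, Field (Ω i)] [∀ i, CharZero (Ω i)] [∀ i, Algebra A (Ω i)]
    [∀ i, Algebra (K i) (Ω i)] [∀ i, IsScalarTower A (K i) (Ω i)]
    {Qs : Type w} [Field Qs] [Algebra A Qs] [Algebra Ks Qs] [IsScalarTower A Ks Qs]
    (qΩ : (∀ i, Ω i) →ₐ[A] Qs) (hΩ : IsUlim U (qΩ : (∀ i, Ω i) →+* Qs))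
    (hc : ∀ x : ∀ i, K i, qΩ (fun i => algebraMap (K i) (Ω i) (x i)) = algebraMap Ks Qs (q x))
    {M : DField.{u, v, w} S} [Algebra Ks M] [IsScalarTower A Ks M]
    (hf : DField.IsHom (IsScalarTower.toAlgHom A Ks M))
    {E : Type w} [Field E] [Algebra A E] [Algebra Ks E] [IsScalarTower A Ks E]
    (vE : E →ₐ[Ks] M) (h : E →ₐ[Ks] Qs) {ι : Type w} [Finite ι] {xE : ι → E}
    (hxE : IsTranscendenceBasis Ks xE) {x : ι → ∀ i, Ω i} (hxh : ∀ k, qΩ (x k) = h (xE k))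
    (hx : ∀ i, IsTranscendenceBasis (K i) fun k => x k i)
    {κ : Type w} [Finite κ] (b : Option κ → M) {p : MvPolynomial (Option κ) Ks}
    (hb : AlgebraicIndependent Ks fun a => b (some a)) (hp : Irreducible p)
    (hp0 : MvPolynomial.aeval b p = 0)
    (hbE : ∀ o k, S.coord k (M.exp (b o)) ∈ Set.range vE)
    {V : Set M} (hVE : ∀ y ∈ V, ∀ k, S.coord k (M.exp y) ∈ Set.range vE)
    (hVb : ∀ y ∈ V, ∃ r s : MvPolynomial (Option κ) Ks, MvPolynomial.aeval b s ≠ 0 ∧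
        y * MvPolynomial.aeval b s = MvPolynomial.aeval b r) :
    ∃ (N : I → DField.{u, v, w} S) (j : ∀ i, K i →ₐ[A] N i) (g : ∀ i, M → N i),
      (∀ i, DField.IsHom (j i)) ∧
      (∀ x, ∀ᶠ i in (U : Filter I), g i (algebraMap Ks M (q x)) = j i (x i)) ∧
      EventuallyPartialHom (opLang A m) (U : Filter I) g V := by
  classical
  -- lifting elements of `E`
  have hℓ : ∀ y : M, ∃ z : ∀ i, Ω i, ∀ e : E, vE e = y → qΩ z = h e := by
    intro y
    by_cases hy : y ∈ Set.range vE
    · obtain ⟨e, rfl⟩ := hy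
      obtain ⟨z, hz⟩ := hΩ.surjective (h e)
      exact ⟨z, fun e' he' => by rw [vE.injective he']; exact hz⟩
    · exact ⟨0, fun e he => absurd ⟨e, he⟩ hy⟩
  choose ℓ hℓ using hℓ
  let hA : E →ₐ[A] Qs := h.restrictScalars A
  let vA : E →ₐ[A] M := vE.restrictScalars A
  have hvA : Function.Injective (dmap D vA) := S.dmap_injective vA vE.injective
  have hlift : ∀ y : M, (∀ k, S.coord k (M.exp y) ∈ Set.range vE) →
      ∃ z : E ⊗[A] D, dmap D vA z = M.exp y ∧
        dmap D qΩ (S.ofCoord fun k => ℓ (S.coord k (M.exp y))) = dmap D hA z := by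
    intro y hy
    choose c hc using hy
    refine ⟨S.ofCoord c, ?_, ?_⟩
    · rw [S.dmap_ofCoord, ← S.ofCoord_coord (M.exp y)]
      congr 1
      funext k
      exact hc k
    · rw [S.dmap_ofCoord, S.dmap_ofCoord]
      congr 1
      funext k
      exact hℓ _ _ (hc k)
  choose bE hbE1 hbE2 using fun o => hlift (b o) (hbE o)
  -- the homomorphisms on polynomial rings
  let algP : (∀ i, K i) →ₐ[A] ∀ i, Ω i :=
    AlgHom.pi fun i => (IsScalarTower.toAlgHom A (K i) (Ω i)).comp
      (Pi.evalAlgHom A (fun i => (K i : Type w)) i)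
  let Φ : MvPolynomial (Option κ) (∀ i, K i) →ₐ[A] (∀ i, Ω i) ⊗[A] D :=
    MvPolynomial.aevalTower ((dmap D algP).comp (piExp K))
      fun o => S.ofCoord fun k => ℓ (S.coord k (M.exp (b o)))
  let e : ∀ i, MvPolynomial (Option κ) (K i) →ₐ[A] Ω i ⊗[A] D := fun i =>
    MvPolynomial.aevalTower ((dmap D (IsScalarTower.toAlgHom A (K i) (Ω i))).comp (K i).exp)
      fun o => dmap D (Pi.evalAlgHom A Ω i) (S.ofCoord fun k => ℓ (S.coord k (M.exp (b o))))
  let eE : MvPolynomial (Option κ) Ks →ₐ[A] E ⊗[A] D :=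
    MvPolynomial.aevalTower ((dmap D (IsScalarTower.toAlgHom A Ks E)).comp Ks.exp) bE
  -- `Φ` reduces to `e i` at each index and to `eE` in the ultraproduct, while `eE` computes `M.exp`
  -- on polynomials in `b`. Identities in 𝒟(M) thereby descend to almost all indices.
  have hΦe : ∀ i g, dmap D (Pi.evalAlgHom A Ω i) (Φ g) =
      e i (MvPolynomial.map (Pi.evalRingHom (fun i => (K i : Type w)) i) g) := by
    intro i g
    induction g using MvPolynomial.induction_on with
    | C a =>
      simp only [Φ, e, MvPolynomial.aevalTower_C, MvPolynomial.map_C, AlgHom.comp_apply]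
      rw [Pi.evalRingHom_apply, ← dmap_eval_piExp, ← dmap_comp, ← dmap_comp]
      rfl
    | add f g hf hg => simp only [map_add, hf, hg]
    | mul_X f n hf =>
      simp only [map_mul, hf, MvPolynomial.map_X]
      simp only [Φ, e, MvPolynomial.aevalTower_X]
  have hqexp : ∀ a : ∀ i, K i, dmap D q (piExp K a) = Ks.exp (q a) := by
    intro a
    refine S.coord_ext fun k => ?_
    rw [S.coord_dmap, coord_piExp]
    refine Fin.cases ?_ (fun k => ?_) k
    · simp only [DField.coord_zero_exp]
    · simp only [DField.coord_succ_exp]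
      exact hop a k
  have hΦE : ∀ g, dmap D qΩ (Φ g) =
      dmap D hA (eE (MvPolynomial.map (q : (∀ i, K i) →+* Ks) g)) := by
    intro g
    induction g using MvPolynomial.induction_on with
    | C a =>
      simp only [Φ, eE, MvPolynomial.aevalTower_C, MvPolynomial.map_C, AlgHom.comp_apply]
      have h1 : qΩ.comp algP = (IsScalarTower.toAlgHom A Ks Qs).comp q :=
        AlgHom.ext fun a => hc a
      have h2 : hA.comp (IsScalarTower.toAlgHom A Ks E) = IsScalarTower.toAlgHom A Ks Qs :=
        AlgHom.ext fun a => h.commutes a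
      rw [← dmap_comp, h1, dmap_comp, hqexp, ← dmap_comp, h2]
      rfl
    | add f g hf hg => simp only [map_add, hf, hg]
    | mul_X f n hf =>
      simp only [map_mul, hf, MvPolynomial.map_X]
      simp only [Φ, eE, MvPolynomial.aevalTower_X, hbE2]
  have hEM : ∀ g, dmap D vA (eE g) = M.exp (MvPolynomial.aeval b g) := by
    intro g
    induction g using MvPolynomial.induction_on with
    | C a =>
      simp only [eE, MvPolynomial.aevalTower_C, AlgHom.comp_apply, MvPolynomial.aeval_C]
      have h2 : vA.comp (IsScalarTower.toAlgHom A Ks E) = IsScalarTower.toAlgHom A Ks M :=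
        AlgHom.ext fun a => vE.commutes a
      rw [← dmap_comp, h2]
      exact DField.isHom_iff.1 hf a
    | add f g hf hg => simp only [map_add, hf, hg]
    | mul_X f n hf =>
      simp only [map_mul, hf, MvPolynomial.aeval_X]
      simp only [eE, MvPolynomial.aevalTower_X, hbE1]
  -- the conditions which hold at almost all indices
  obtain ⟨p, rfl⟩ := MvPolynomial.map_surjective (q : (∀ i, K i) →+* Ks) hq.surjective p
  have hirr := hq.irreducible hp
  have hzero : ∀ᶠ i in (U : Filter I),
      e i (MvPolynomial.map (Pi.evalRingHom (fun i => (K i : Type w)) i) p) = 0 := by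
    have h1 : dmap D qΩ (Φ p) = dmap D qΩ 0 := by
      rw [hΦE, map_zero]
      have : eE (MvPolynomial.map (q : (∀ i, K i) →+* Ks) p) = 0 :=
        hvA (by rw [hEM, hp0, map_zero, map_zero])
      rw [this, map_zero]
    filter_upwards [eventually_dmap_eval_eq S hΩ h1] with i hi
    rw [← hΦe, hi, map_zero]
  have hindep : ∀ j, ∀ᶠ i in (U : Filter I), AlgebraicIndependent (K i)
      fun a : κ => P.projBase j (Ω i) (e i (MvPolynomial.X (some a))) := by
    intro j
    have hzE : AlgebraicIndependent Ks fun a : κ => P.projBase j E (bE (some a)) := by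
      refine AlgebraicIndependent.of_comp vE ?_
      have := algebraicIndependent_sigma P Ks hinv M hf hb j
      convert this using 1
      funext a
      change vA (P.projBase j E (bE (some a))) = _
      rw [← P.projBase_dmap, hbE1]
      rfl
    have := eventually_algebraicIndependent hq hΩ hc h hxE hxh hx hzE
      (z := fun a => P.projBase j (∀ i, Ω i)
        (S.ofCoord fun k => ℓ (S.coord k (M.exp (b (some a)))))) (fun a => by
          change qΩ _ = hA _
          rw [← P.projBase_dmap, ← P.projBase_dmap, hbE2])
    filter_upwards [this] with i hi
    convert hi using 1
    funext a
    simp only [e, MvPolynomial.aevalTower_X]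
    rw [P.projBase_dmap]
    rfl
  rw [← Filter.eventually_all] at hindep
  -- Each y is a quotient r(b) / s(b); the relation y s(b) = r(b) is kept at the level of e, where
  -- it will determine the operators on the image of y.
  have hfrac : ∀ y ∈ V, ∃ r s : MvPolynomial (Option κ) (∀ i, K i), ∀ᶠ i in (U : Filter I),
      dmap D (Pi.evalAlgHom A Ω i) (S.ofCoord fun k => ℓ (S.coord k (M.exp y))) *
        e i (MvPolynomial.map (Pi.evalRingHom (fun i => (K i : Type w)) i) s) =
          e i (MvPolynomial.map (Pi.evalRingHom (fun i => (K i : Type w)) i) r) ∧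
        S.coord 0 (e i (MvPolynomial.map (Pi.evalRingHom (fun i => (K i : Type w)) i) s)) ≠ 0 := by
    intro y hy
    obtain ⟨r, s, hs, hrs⟩ := hVb y hy
    obtain ⟨r, rfl⟩ := MvPolynomial.map_surjective (q : (∀ i, K i) →+* Ks) hq.surjective r
    obtain ⟨s, rfl⟩ := MvPolynomial.map_surjective (q : (∀ i, K i) →+* Ks) hq.surjective s
    obtain ⟨z, hz1, hz2⟩ := hlift y (hVE y hy)
    refine ⟨r, s, ?_⟩
    have h1 : dmap D qΩ ((S.ofCoord fun k => ℓ (S.coord k (M.exp y))) * Φ s) =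
        dmap D qΩ (Φ r) := by
      rw [map_mul, hz2, hΦE, hΦE, ← map_mul]
      congr 1
      apply hvA
      rw [map_mul, hz1, hEM, hEM, ← map_mul, hrs]
    have h2 : qΩ (S.coord 0 (Φ s)) ≠ 0 := by
      rw [← S.coord_dmap, hΦE, S.coord_dmap]
      change h _ ≠ 0
      rw [Ne, map_eq_zero_iff h h.injective]
      intro h0
      apply hs
      rw [← M.coord_zero_exp (MvPolynomial.aeval b _), ← hEM, S.coord_dmap, h0, map_zero]
    have h3 := hΩ.ne_zero_iff.1 h2
    filter_upwards [eventually_dmap_eval_eq S hΩ h1, h3] with i hi1 hi2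
    rw [← hΦe, ← hΦe, ← map_mul, hi1, S.coord_dmap]
    exact ⟨rfl, hi2⟩
  -- the extensions
  have hN : ∀ i, ∃ (N : DField.{u, v, w} S) (j : K i →ₐ[A] N) (φ : Ω i → N), DField.IsHom j ∧
      (Irreducible (MvPolynomial.map (Pi.evalRingHom (fun i => (K i : Type w)) i) p) →
      e i (MvPolynomial.map (Pi.evalRingHom (fun i => (K i : Type w)) i) p) = 0 →
      (∀ j, AlgebraicIndependent (K i)
        fun a : κ => P.projBase j (Ω i) (e i (MvPolynomial.X (some a)))) →
      ∃ φ' : Ω i →ₐ[A] N, (∀ c, φ c = φ' c) ∧ (∀ c, j c = φ' (algebraMap (K i) (Ω i) c)) ∧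
        ∀ g, N.exp (φ' (S.coord 0 (e i g))) = dmap D φ' (e i g)) := by
    intro i
    by_cases hi : Irreducible (MvPolynomial.map (Pi.evalRingHom (fun i => (K i : Type w)) i) p) ∧
      e i (MvPolynomial.map (Pi.evalRingHom (fun i => (K i : Type w)) i) p) = 0 ∧
      (∀ j, AlgebraicIndependent (K i)
        fun a : κ => P.projBase j (Ω i) (e i (MvPolynomial.X (some a))))
    · obtain ⟨N, φ, h1, h2⟩ := exists_dField_of_aevalTower P (K i) (e i)
        (fun a => by simp only [e, MvPolynomial.aevalTower_C, AlgHom.comp_apply]) hi.1 hi.2.1 hi.2.2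
      exact ⟨N, _, φ, h1, fun _ _ _ => ⟨φ, fun _ => rfl, fun _ => rfl, h2⟩⟩
    -- At an exceptional index any extension of `K i` will do, and `φ` carries no information there.
    · exact ⟨K i, AlgHom.id A _, fun _ => 0, fun _ _ => rfl, fun h1 h2 h3 =>
        absurd ⟨h1, h2, h3⟩ hi⟩
  choose N j φ hj hφ using hN
  have hgood : ∀ᶠ i in (U : Filter I), ∃ φ' : Ω i →ₐ[A] N i, (∀ c, φ i c = φ' c) ∧
      (∀ c, j i c = φ' (algebraMap (K i) (Ω i) c)) ∧
        ∀ g, (N i).exp (φ' (S.coord 0 (e i g))) = dmap D φ' (e i g) := by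
    filter_upwards [hirr, hzero, hindep] with i h1 h2 h3 using hφ i h1 h2 h3
  have hrange : ∀ y ∈ V, ∃ c, vE c = y := by
    intro y hy
    have := hVE y hy 0
    rwa [M.coord_zero_exp] at this
  have hℓeq : ∀ (c : E) (z : ∀ i, Ω i), qΩ z = h c → ∀ᶠ i in (U : Filter I), ℓ (vE c) i = z i :=
    fun c z hz => hΩ.eq_iff.1 ((hℓ _ c rfl).trans hz.symm)
  refine ⟨N, j, fun i y => φ i (ℓ y i), hj, fun x => ?_, ⟨fun {n} F x hx hF => ?_, ?_⟩⟩
  · have h1 : ∀ᶠ i in (U : Filter I), ℓ (algebraMap Ks M (q x)) i =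
        algebraMap (K i) (Ω i) (x i) := by
      refine hΩ.eq_iff.1 ?_
      refine (hℓ _ (algebraMap Ks E (q x)) (vE.commutes _)).trans ?_
      exact (h.commutes _).trans (hc x).symm
    filter_upwards [h1, hgood] with i hi1 ⟨φ', h2, h3, _⟩
    rw [hi1, h2, h3]
  · rcases F with F | F
    · cases F with
      | zero =>
        have h1 := hℓeq 0 0 (by rw [map_zero, map_zero])
        filter_upwards [h1, hgood] with i hi ⟨φ', h2, _, _⟩
        rw [map_zero] at hi
        refine (congrArg (fun y => φ i (ℓ y i)) (M.compatible.zero x)).trans ?_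
        refine Eq.trans ?_ ((N i).compatible.zero _).symm
        rw [hi, h2, Pi.zero_apply, map_zero]
      | one =>
        have h1 := hℓeq 1 1 (by rw [map_one, map_one])
        filter_upwards [h1, hgood] with i hi ⟨φ', h2, _, _⟩
        rw [map_one] at hi
        refine (congrArg (fun y => φ i (ℓ y i)) (M.compatible.one x)).trans ?_
        refine Eq.trans ?_ ((N i).compatible.one _).symm
        rw [hi, h2, Pi.one_apply, map_one]
      | add =>
        obtain ⟨c, hc⟩ := hrange _ (hx 0)
        obtain ⟨d, hd⟩ := hrange _ (hx 1)
        have h1 := hℓeq (c + d) (ℓ (x 0) + ℓ (x 1))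
          (by rw [map_add, map_add, hℓ _ c hc, hℓ _ d hd])
        filter_upwards [h1, hgood] with i hi ⟨φ', h2, _, _⟩
        rw [map_add, hc, hd] at hi
        refine (congrArg (fun y => φ i (ℓ y i)) (M.compatible.add x)).trans ?_
        refine Eq.trans ?_ ((N i).compatible.add _).symm
        rw [hi, h2, h2, h2, Pi.add_apply, map_add]
      | neg =>
        obtain ⟨c, hc⟩ := hrange _ (hx 0)
        have h1 := hℓeq (-c) (-ℓ (x 0)) (by rw [map_neg, map_neg, hℓ _ c hc])
        filter_upwards [h1, hgood] with i hi ⟨φ', h2, _, _⟩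
        rw [map_neg, hc] at hi
        refine (congrArg (fun y => φ i (ℓ y i)) (M.compatible.neg x)).trans ?_
        refine Eq.trans ?_ ((N i).compatible.neg _).symm
        rw [hi, h2, h2, Pi.neg_apply, map_neg]
      | mul =>
        obtain ⟨c, hc⟩ := hrange _ (hx 0)
        obtain ⟨d, hd⟩ := hrange _ (hx 1)
        have h1 := hℓeq (c * d) (ℓ (x 0) * ℓ (x 1))
          (by rw [map_mul, map_mul, hℓ _ c hc, hℓ _ d hd])
        filter_upwards [h1, hgood] with i hi ⟨φ', h2, _, _⟩
        rw [map_mul, hc, hd] at hi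
        refine (congrArg (fun y => φ i (ℓ y i)) (M.compatible.mul x)).trans ?_
        refine Eq.trans ?_ ((N i).compatible.mul _).symm
        rw [hi, h2, h2, h2, Pi.mul_apply, map_mul]
      | smul a =>
        obtain ⟨c, hc⟩ := hrange _ (hx 0)
        have h1 := hℓeq (a • c) (a • ℓ (x 0)) (by
          rw [map_smul, hℓ _ c hc]
          exact (map_smul hA a c).symm)
        filter_upwards [h1, hgood] with i hi ⟨φ', h2, _, _⟩
        rw [show vE (a • c) = a • vE c from map_smul vA a c, hc] at hi
        refine (congrArg (fun y => φ i (ℓ y i)) (M.compatible.smul a x)).trans ?_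
        refine Eq.trans ?_ ((N i).compatible.smul a _).symm
        rw [hi, h2, h2, Pi.smul_apply, map_smul]
    · cases F with
      | op k =>
        obtain ⟨r, s, hrs⟩ := hfrac _ (hx 0)
        filter_upwards [hrs, hgood] with i ⟨hi1, hi2⟩ ⟨φ', h2, _, h4⟩
        refine (congrArg (fun y => φ i (ℓ y i)) (M.compatible.op k x)).trans ?_
        refine Eq.trans ?_ ((N i).compatible.op k _).symm
        rw [h2, h2]
        have hcoord : ∀ l, S.coord l (dmap D (Pi.evalAlgHom A Ω i)
            (S.ofCoord fun k => ℓ (S.coord k (M.exp (x 0))))) = ℓ (S.coord l (M.exp (x 0))) i := by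
          intro l
          rw [S.coord_dmap, S.coord_ofCoord]
          rfl
        have hunit : IsUnit (dmap D φ' (e i
            (MvPolynomial.map (Pi.evalRingHom (fun i => (K i : Type w)) i) s))) := by
          rw [← h4]
          refine IsUnit.map _ (isUnit_iff_ne_zero.2 fun h0 => hi2 ?_)
          exact φ'.toRingHom.injective (h0.trans (map_zero φ').symm)
        -- The value of e at the image of `x 0` is known after multiplication by the unit coming
        -- from `s`.
        have hexp : (N i).exp (φ' (ℓ (x 0) i)) = dmap D φ' (dmap D (Pi.evalAlgHom A Ω i)
            (S.ofCoord fun k => ℓ (S.coord k (M.exp (x 0))))) := by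
          refine hunit.mul_right_cancel ?_
          rw [← map_mul, hi1, ← h4, ← h4, ← hi1, coord_zero_mul P, hcoord, M.coord_zero_exp,
            ← map_mul, ← map_mul]
        have := congrArg (S.coord k.succ) hexp
        rw [(N i).coord_succ_exp, S.coord_dmap, hcoord, M.coord_succ_exp] at this
        exact this.symm
  · intro y hy z hz hyz
    obtain ⟨y, rfl⟩ := hrange y hy
    obtain ⟨z, rfl⟩ := hrange z hz
    have h1 : ∀ᶠ i in (U : Filter I), ℓ (vE y) i ≠ ℓ (vE z) i := by
      refine hΩ.ne_iff.1 ?_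
      change qΩ _ ≠ qΩ _
      rw [hℓ _ y rfl, hℓ _ z rfl]
      exact fun h0 => hyz (congrArg vE (h.injective h0))
    filter_upwards [h1, hgood] with i hi1 ⟨φ', h2, h3, _⟩
    rw [h2, h2]
    exact fun h0 => hi1 (φ'.toRingHom.injective h0)

end Approximation

end FreeOp

/-! ### Models of `DCF0` are existentially closed -/

namespace FreeOp

open FirstOrder FirstOrder.Language

variable {A : Type u} [Field A] {D : Type v} [CommRing D] [Algebra A D] {m t : ℕ}
  {S : OperatorData A D m} (P : LocalDecomposition S t)

theorem exists_algHom_of_surjective {R Q Q' : Type*} [CommRing R] [CommRing Q] [CommRing Q']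
    [Algebra A R] [Algebra A Q] [Algebra A Q'] (q : R →ₐ[A] Q) (hq : Function.Surjective q)
    (f : R →ₐ[A] Q') (hf : ∀ x, q x = 0 → f x = 0) :
    ∃ c : Q →ₐ[A] Q', ∀ x, c (q x) = f x := by
  refine ⟨(Ideal.Quotient.liftₐ (RingHom.ker q) f hf).comp
    (Ideal.quotientKerAlgEquivOfSurjective hq).symm, fun x => ?_⟩
  have : (Ideal.quotientKerAlgEquivOfSurjective hq).symm (q x) =
      Ideal.Quotient.mk (RingHom.ker q) x := by
    rw [AlgEquiv.symm_apply_eq]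
    rfl
  rw [AlgHom.comp_apply, AlgEquiv.coe_toAlgHom, this]
  rfl

/-- Finitely much of an extension `M` of an ultraproduct `Ks` of `𝒟`-fields `K i` is realized in
extensions of almost all of the `K i`. -/
theorem exists_approximation {I : Type w} {U : Ultrafilter I} {K : I → DField.{u, v, w} S}
    (h0 : ∀ i, CharZero (K i)) {Ks : DField.{u, v, w} S} (h0s : CharZero Ks)
    (hinv : Ks.IsInversive P) (q : (∀ i, K i) →ₐ[A] Ks)
    (hq : IsUlim U (q : (∀ i, K i) →+* Ks))
    (hop : ∀ (x : ∀ i, K i) k, q (fun i => (K i).op k (x i)) = Ks.op k (q x))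
    {M : DField.{u, v, w} S} {f : Ks →ₐ[A] M} (hf : DField.IsHom f) {V : Set M} (hV : V.Finite) :
    ∃ (N : I → DField.{u, v, w} S) (j : ∀ i, K i →ₐ[A] N i) (g : ∀ i, M → N i),
      (∀ i, DField.IsHom (j i)) ∧
      (∀ x, ∀ᶠ i in (U : Filter I), g i (f (q x)) = j i (x i)) ∧
      EventuallyPartialHom (opLang A m) (U : Filter I) g V := by
  let _ : Algebra Ks M := f.toRingHom.toAlgebra
  have : IsScalarTower A Ks M := IsScalarTower.of_algebraMap_eq fun a => (f.commutes a).symm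
  have hf' : DField.IsHom (IsScalarTower.toAlgHom A Ks M) := hf
  obtain ⟨u, b, p, hu, hb, hp, hp0, hVb⟩ := exists_primitive_presentation (k := Ks) V hV
  have : Finite u := hu
  -- The field generated by `W` contains every coordinate of e at the elements in play and has
  -- finite transcendence degree. The `Ω i` below are given the same transcendence degree, as
  -- `eventually_algebraicIndependent` needs.
  let W : Set M := ⋃ k, (fun y => S.coord k (M.exp y)) '' (V ∪ Set.range b)
  have hW : W.Finite := Set.finite_iUnion fun k => (hV.union (Set.finite_range b)).image _
  have hWE : ∀ y ∈ V ∪ Set.range b, ∀ k,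
      S.coord k (M.exp y) ∈ Set.range (IntermediateField.adjoin Ks W).val := by
    intro y hy k
    exact ⟨⟨_, IntermediateField.subset_adjoin _ _ (Set.mem_iUnion.2 ⟨k, y, hy, rfl⟩)⟩, rfl⟩
  obtain ⟨ι, _, xE, hxE⟩ := exists_isTranscendenceBasis_adjoin (k := Ks) W hW
  choose Ω F1 A1 A2 T1 C1 x hx using fun i =>
    exists_isAlgClosed_isTranscendenceBasis A (K i) ι
  have hΩ0 : ∀ i, CharZero (Ω i) := fun i =>
    charZero_of_injective_algebraMap (algebraMap (K i) (Ω i)).injective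
  obtain ⟨Qs, _, _, qΩ, hΩ⟩ := exists_isUlim (A := A) U Ω
  have hclosed : IsAlgClosed Qs := hΩ.isAlgClosed
  let algP : (∀ i, K i) →ₐ[A] ∀ i, Ω i :=
    AlgHom.pi fun i => (IsScalarTower.toAlgHom A (K i) (Ω i)).comp
      (Pi.evalAlgHom A (fun i => (K i : Type w)) i)
  obtain ⟨c, hc⟩ := exists_algHom_of_surjective q hq.surjective (qΩ.comp algP) (by
    intro y hy
    have h1 := (hq.eq_zero_iff y).1 hy
    refine (hΩ.eq_zero_iff _).2 ?_
    filter_upwards [h1] with i hi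
    change algebraMap (K i) (Ω i) (y i) = 0
    rw [hi, map_zero])
  let _ : Algebra Ks Qs := c.toRingHom.toAlgebra
  have : IsScalarTower A Ks Qs := IsScalarTower.of_algebraMap_eq fun a => (c.commutes a).symm
  have hc' : ∀ y : ∀ i, K i,
      qΩ (fun i => algebraMap (K i) (Ω i) (y i)) = algebraMap Ks Qs (q y) := fun y => (hc y).symm
  have hind : AlgebraicIndependent Ks fun k => (qΩ : (∀ i, Ω i) →+* Qs) (fun i => x i k) :=
    ulim_algebraicIndependent (x := fun k i => x i k) hq hΩ hc' fun i => (hx i).1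
  obtain ⟨h, hh⟩ := exists_algHom_of_isTranscendenceBasis hxE hind
  exact exists_approximation_aux P hinv q hq hop qΩ hΩ hc' hf'
    (IntermediateField.adjoin Ks W).val h hxE (x := fun k i => x i k) (fun k => (hh k).symm) hx b hb
    hp hp0 (fun o => hWE _ (Or.inr ⟨o, rfl⟩)) (fun y hy => hWE y (Or.inl hy)) hVb

instance (n : ℕ) : IsEmpty ((opLang A m).Relations n) :=
  ⟨fun r => by rcases r with r | r <;> exact r.elim⟩

theorem IsElementary.exists_isHom {K K' : DField.{u, v, w} S} {g : K → K'} (hg : IsElementary g) :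
    ∃ f : K →ₐ[A] K', DField.IsHom f ∧ ∀ x, f x = g x := by
  have h : ∀ s s' : (opLang A m).Term K, s.realize id = s'.realize id →
      s.realize g = s'.realize g := fun s s' h =>
    Formula.realize_equal.1 ((hg (s.equal s')).2 (Formula.realize_equal.2 h))
  have hK := K.compatible
  have hK' := K'.compatible
  refine DField.exists_isHom g ?_ ?_ ?_ ?_ ?_
  · have := h (Term.var 1) dOne (by rw [hK.realize_one]; rfl)
    rwa [hK'.realize_one] at this
  · intro a b
    have := h (Term.var (a + b)) (dAdd (Term.var a) (Term.var b)) (by rw [hK.realize_add]; rfl)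
    rwa [hK'.realize_add] at this
  · intro a b
    have := h (Term.var (a * b)) (dMul (Term.var a) (Term.var b)) (by rw [hK.realize_mul]; rfl)
    rwa [hK'.realize_mul] at this
  · intro c b
    have := h (Term.var (c • b)) (dSmul c (Term.var b)) (by rw [hK.realize_smul]; rfl)
    rwa [hK'.realize_smul] at this
  · intro i b
    have := h (Term.var (K.op i b)) (dOp i (Term.var b)) (by rw [hK.realize_op]; rfl)
    rwa [hK'.realize_op] at this

theorem exists_ultraproduct_structure {L : FirstOrder.Language.{u, v}} {I : Type w}
    (U : Ultrafilter I) (M : I → Type w) [∀ i, L.Structure (M i)] [∀ i, Nonempty (M i)] :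
    ∃ (Q : Type w) (_ : L.Structure Q) (c : (∀ i, M i) → Q), Function.Surjective c ∧
      (∀ τ : L.Sentence, Q ⊨ τ ↔ ∀ᶠ i in (U : Filter I), M i ⊨ τ) ∧
      ∀ {α : Type w'} (φ : L.Formula α) (x : α → ∀ i, M i),
        φ.Realize (fun a => c (x a)) ↔ ∀ᶠ i in (U : Filter I), φ.Realize fun a => x a i :=
  ⟨(U : Filter I).Product M, inferInstance, fun x => (x : (U : Filter I).Product M),
    fun y => Quotient.inductionOn' y fun x => ⟨x, rfl⟩, Ultraproduct.sentence_realize,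
    fun φ x => Ultraproduct.realize_formula_cast φ x⟩

/-- Ultraproducts of `𝒟`-closed fields, with Łoś's theorem. -/
theorem exists_ultraproduct {I : Type w} (U : Ultrafilter I) (K : I → DField.{u, v, w} S)
    (hK : ∀ i, (K i).IsDClosed) :
    ∃ (Ks : DField.{u, v, w} S) (q : (∀ i, K i) →ₐ[A] Ks), Ks.IsDClosed ∧
      IsUlim U (q : (∀ i, K i) →+* Ks) ∧
      (∀ (x : ∀ i, K i) k, q (fun i => (K i).op k (x i)) = Ks.op k (q x)) ∧
      ∀ {α : Type w} (φ : (opLang A m).Formula α) (x : α → ∀ i, K i),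
        φ.Realize (fun a => q (x a)) ↔ ∀ᶠ i in (U : Filter I), φ.Realize fun a => x a i := by
  obtain ⟨Q, _, c, hcs, hcτ, hcφ⟩ := exists_ultraproduct_structure.{u, 0, w, w}
    (L := opLang A m) U (fun i => (K i : Type w))
  have hmod : Q ⊨ DCF0 S := ⟨fun τ hτ => (hcτ τ).2
    (Filter.Eventually.of_forall fun i => (hK i).realize_of_mem τ hτ)⟩
  obtain ⟨Ks, ⟨E⟩⟩ := exists_dField_of_model hmod
  have hcl : Ks.IsDClosed := StrongHomClass.theory_model E
  let g : (∀ i, K i) → Ks := fun x => E (c x)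
  have hφ : ∀ {α : Type w} (φ : (opLang A m).Formula α) (x : α → ∀ i, K i),
      φ.Realize (fun a => g (x a)) ↔ ∀ᶠ i in (U : Filter I), φ.Realize fun a => x a i :=
    fun φ x => (StrongHomClass.realize_formula E φ).trans (hcφ φ x)
  have heq : ∀ (s s' : (opLang A m).Term (∀ i, K i)),
      (∀ᶠ i in (U : Filter I), s.realize (fun a => a i) = s'.realize fun a => a i) →
      s.realize g = s'.realize g := by
    intro s s' h
    refine Formula.realize_equal.1 ((hφ (s.equal s') fun a => a).2 ?_)
    filter_upwards [h] with i hi using Formula.realize_equal.2 hi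
  have hKs := Ks.compatible
  have hone : g 1 = 1 := by
    have := heq (Term.var 1) dOne (Filter.Eventually.of_forall fun i => by
      rw [(K i).compatible.realize_one]; rfl)
    rwa [hKs.realize_one] at this
  have hmul : ∀ a b, g (a * b) = g a * g b := by
    intro a b
    have := heq (Term.var (a * b)) (dMul (Term.var a) (Term.var b))
      (Filter.Eventually.of_forall fun i => by rw [(K i).compatible.realize_mul]; rfl)
    rwa [hKs.realize_mul] at this
  have hadd : ∀ a b, g (a + b) = g a + g b := by
    intro a b
    have := heq (Term.var (a + b)) (dAdd (Term.var a) (Term.var b))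
      (Filter.Eventually.of_forall fun i => by rw [(K i).compatible.realize_add]; rfl)
    rwa [hKs.realize_add] at this
  have hsmul : ∀ (r : A) a, g (r • a) = r • g a := by
    intro r a
    have := heq (Term.var (r • a)) (dSmul r (Term.var a))
      (Filter.Eventually.of_forall fun i => by rw [(K i).compatible.realize_smul]; rfl)
    rwa [hKs.realize_smul] at this
  have hzero : g 0 = 0 := by simpa using hadd 0 0
  let q : (∀ i, K i) →ₐ[A] Ks :=
    { toFun := g, map_one' := hone, map_mul' := hmul, map_zero' := hzero, map_add' := hadd
      commutes' := fun a => by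
        rw [Algebra.algebraMap_eq_smul_one, hsmul, hone, ← Algebra.algebraMap_eq_smul_one] }
  refine ⟨Ks, q, hcl, ⟨E.surjective.comp hcs, fun x => ?_⟩, fun x k => ?_, hφ⟩
  · have h1 := hφ (Term.equal (Term.var x) dZero) (fun a => a)
    rw [Formula.realize_equal, hKs.realize_zero] at h1
    refine h1.trans (Filter.eventually_congr (Filter.Eventually.of_forall fun i => ?_))
    rw [Formula.realize_equal, (K i).compatible.realize_zero]
    rfl
  · have := heq (Term.var (fun i => (K i).op k (x i))) (dOp k (Term.var x))
      (Filter.Eventually.of_forall fun i => by rw [(K i).compatible.realize_op]; rfl)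
    rwa [hKs.realize_op] at this

/-- Otherwise the negation of `φ`, restricted to the finitely many variables occurring in it, would
be valid in all existentially closed 𝒟-fields and so in `K`. -/
theorem exists_isExistentiallyClosed_of_isDClosed {K : DField.{u, v, u} S} (hK : K.IsDClosed)
    (φ : (opLang A m).Formula K) (hφ : φ.Realize id) :
    ∃ (L : DField.{u, v, u} S) (x : K → L), CharZero L ∧ L.IsExistentiallyClosed ∧
      φ.Realize x := by
  classical
  by_contra hcon
  push Not at hcon
  let s := BoundedFormula.freeVarFinset φ
  let χ : (opLang A m).Formula s := BoundedFormula.restrictFreeVar φ (fun a => a)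
  have hχ : ∀ (L : DField.{u, v, u} S) (x : K → L), χ.Realize (fun a => x a) ↔ φ.Realize x :=
    fun L x => BoundedFormula.realize_restrictFreeVar (φ := φ) (f := fun a => a) (xs := default) x
      (fun _ => rfl)
  have h1 := realize_of_model_DCF0 hK χ.not (fun L h0 hL x => by
    rw [Formula.realize_not]
    intro h
    let y : K → L := fun a => if ha : a ∈ s then x ⟨a, ha⟩ else 0
    refine hcon L y h0 hL ((hχ L y).1 ?_)
    convert h using 1
    funext a
    simp [y]) (fun a => a)
  exact Formula.realize_not.1 h1 ((hχ K id).2 hφ)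

/-- A `𝒟`-closed field is an elementary substructure of an ultraproduct of existentially closed
`𝒟`-fields. -/
theorem exists_isElementary_ultraproduct {K : DField.{u, v, u} S} (hK : K.IsDClosed) :
    ∃ (I : Type u) (U : Ultrafilter I) (L : I → DField.{u, v, u} S) (Ks : DField.{u, v, u} S)
      (q : (∀ i, L i) →ₐ[A] Ks) (f : K →ₐ[A] Ks),
      (∀ i, CharZero (L i) ∧ (L i).IsExistentiallyClosed) ∧ Ks.IsDClosed ∧
      IsUlim U (q : (∀ i, L i) →+* Ks) ∧
      (∀ (x : ∀ i, L i) k, q (fun i => (L i).op k (x i)) = Ks.op k (q x)) ∧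
      (∀ {α : Type u} (φ : (opLang A m).Formula α) (x : α → ∀ i, L i),
        φ.Realize (fun a => q (x a)) ↔ ∀ᶠ i in (U : Filter I), φ.Realize fun a => x a i) ∧
      DField.IsHom f ∧ IsElementary f := by
  classical
  let Γ := {φ : (opLang A m).Formula K // φ.Realize id}
  have hΓ : ∀ s : Finset Γ, ∃ (L : DField.{u, v, u} S) (x : K → L), CharZero L ∧
      L.IsExistentiallyClosed ∧ ∀ φ ∈ s, φ.1.Realize x := by
    intro s
    obtain ⟨L, x, h0, hL, hx⟩ := exists_isExistentiallyClosed_of_isDClosed hK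
      ((s.toList.map Subtype.val).foldr (· ⊓ ·) ⊤) ((BoundedFormula.realize_foldr_inf _ _ _).2 (by
        intro φ hφ
        obtain ⟨ψ, -, rfl⟩ := List.mem_map.1 hφ
        exact ψ.2))
    refine ⟨L, x, h0, hL, fun φ hφ => ?_⟩
    exact (BoundedFormula.realize_foldr_inf _ _ _).1 hx _
      (List.mem_map.2 ⟨φ, Finset.mem_toList.2 hφ, rfl⟩)
  choose L x h0 hL hx using hΓ
  -- Any ultrafilter finer than `atTop` contains, for each formula, the set of indices that contain
  -- it.
  let U : Ultrafilter (Finset Γ) := Ultrafilter.of Filter.atTop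
  obtain ⟨Ks, q, hKs, hq, hop, hφ⟩ := exists_ultraproduct U L
    fun s => (hL s).isDClosed (h0 s)
  have hpos : ∀ φ : (opLang A m).Formula K, φ.Realize id →
      φ.Realize fun a => q fun s => x s a := by
    intro φ h
    refine (hφ φ fun a s => x s a).2 ?_
    have h1 : ∀ᶠ s in (Filter.atTop : Filter (Finset Γ)), φ.Realize fun a => x s a := by
      filter_upwards [Filter.eventually_ge_atTop ({⟨φ, h⟩} : Finset Γ)] with s hs
      exact hx s ⟨φ, h⟩ (hs (Finset.mem_singleton_self _))
    exact Ultrafilter.of_le _ h1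
  have hel : IsElementary fun a : K => q fun s => x s a := by
    intro φ
    refine ⟨fun h1 => ?_, hpos φ⟩
    by_contra h2
    exact Formula.realize_not.1 (hpos φ.not (Formula.realize_not.2 h2)) h1
  obtain ⟨f, hf, hfx⟩ := hel.exists_isHom
  refine ⟨Finset Γ, U, L, Ks, q, f, fun s => ⟨h0 s, hL s⟩, hKs, hq, hop, hφ, hf, ?_⟩
  have : (f : K → Ks) = fun a => q fun s => x s a := funext hfx
  rw [this]
  exact hel

theorem DField.IsDClosed.isAlgClosed (P : LocalDecomposition S t) {K : DField.{u, v, u} S}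
    (hK : K.IsDClosed) : IsAlgClosed K := by
  obtain ⟨I, U, L, Ks, q, f, hL, -, hq, -, -, hf, hel⟩ := exists_isElementary_ultraproduct hK
  have : ∀ i, IsAlgClosed (L i) := fun i => (hL i).2.isAlgClosed P (hL i).1
  have : IsAlgClosed Ks := hq.isAlgClosed
  exact hel.isAlgClosed

/-- The existentially closed `𝒟`-fields of characteristic zero are exactly the models
of their theory. -/
theorem DField.IsDClosed.isExistentiallyClosed (P : LocalDecomposition S t)
    {K : DField.{u, v, u} S} (hK : K.IsDClosed) : K.IsExistentiallyClosed := by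
  intro M f n r χ hχ a c hac
  have h0 := hK.charZero
  have hKalg := hK.isAlgClosed P
  obtain ⟨f, hf, hfx⟩ := exists_isHom f (f.map_fun (fOne : (opLang A m).Functions 0) ![])
    (fun x y => f.map_fun (fAdd : (opLang A m).Functions 2) ![x, y])
    (fun x y => f.map_fun (fMul : (opLang A m).Functions 2) ![x, y])
    (fun r x => f.map_fun (fSmul r : (opLang A m).Functions 1) ![x])
    (fun i x => f.map_fun (fOp i : (opLang A m).Functions 1) ![x])
  simp only [← hfx] at hac
  -- The given extension and the ultraproduct `Ks` are amalgamated over `K`. The solution in the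
  -- amalgam is approximated in extensions of almost all factors; these are existentially closed,
  -- hence have solutions themselves, and Łoś's theorem and elementarity bring a solution back to
  -- `K`.
  obtain ⟨I, U, L, Ks, q, j, hL, hKs, hq, hop, hφ, hj, hel⟩ := exists_isElementary_ultraproduct hK
  obtain ⟨N, f', j', hf', hj', hcomm⟩ := exists_amalgam P (hK.isInversive P) hf hj
  have h0s := hKs.charZero
  choose b hb using fun k => hq.surjective (j (a k))
  let d : Fin n ⊕ Fin r → N := fun k => f' (Sum.elim (fun k => f (a k)) c k)
  have hd : χ.Realize d := by
    have := (hχ.realize_embedding hf'.toEmbedding).2 hac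
    rw [Formula.Realize]
    convert this using 1
    rfl
  obtain ⟨V, hV, hχV⟩ := exists_finite_realize_isQF.{u, 0, u, u} hχ d (default : Fin 0 → N)
  obtain ⟨N', l, g, hl, hgl, hg⟩ := exists_approximation P (fun i => (hL i).1) h0s
    (hKs.isInversive P) q hq hop hj' hV
  have h1 : ∀ k, ∀ᶠ i in (U : Filter I), g i (d (Sum.inl k)) = l i (b k i) := by
    intro k
    have hk : d (Sum.inl k) = j' (q (b k)) := by
      rw [show q (b k) = j (a k) from hb k, ← hcomm]
      rfl
    rw [hk]
    exact hgl (b k)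
  rw [← Filter.eventually_all] at h1
  let ψ : (opLang A m).Formula (Fin n) := Formula.iExs (Fin r) χ
  have h2 : ∀ᶠ i in (U : Filter I), ψ.Realize fun k => b k i := by
    filter_upwards [h1, hχV (U : Filter I) g hg] with i hi1 hi2
    rw [Formula.realize_iExs]
    refine (hL i).2 (N' i) (hl i).toEmbedding n r χ hχ (fun k => b k i)
      (fun k => g i (d (Sum.inr k))) ?_
    have h3 : χ.Realize fun k => g i (d k) := by
      rw [Formula.Realize]
      have := hi2.2 hd
      convert this using 1
    convert h3 using 1
    funext k
    rcases k with k | k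
    · exact (hi1 k).symm
    · rfl
  -- `ULift` moves the variables to the universe in which Łoś's theorem was recorded.
  have h4 := (hφ (ψ.relabel ULift.up.{u}) fun k => b k.down).2 (by
    filter_upwards [h2] with i hi
    rw [Formula.realize_relabel]
    exact hi)
  rw [Formula.realize_relabel] at h4
  have h5 : ψ.Realize fun k => j (a k) := by
    convert h4 using 1
    funext k
    exact (hb k).symm
  have h6 := (hel.realize_iff ψ a).1 h5
  rw [Formula.realize_iExs] at h6
  exact h6

end FreeOp

/-! ### Formulas over algebraically closed inversive subfields -/

namespace FreeOp

open FirstOrder FirstOrder.Language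

variable {A : Type u} [Field A] {D : Type v} [CommRing D] [Algebra A D] {m t : ℕ}
  {S : OperatorData A D m} (P : LocalDecomposition S t)

theorem IsElementary.realize_boundedFormula_iff {K K' : DField.{u, v, w} S} {f : K → K'}
    (hf : IsElementary f) {α : Type*} {n : ℕ} (φ : (opLang A m).BoundedFormula α n) (x : α → K)
    (y : Fin n → K) : φ.Realize (fun a => f (x a)) (fun k => f (y k)) ↔ φ.Realize x y := by
  have h1 := hf.realize_iff φ.toFormula (Sum.elim x y)
  rw [BoundedFormula.realize_toFormula, BoundedFormula.realize_toFormula] at h1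
  exact h1

theorem realize_term_of_isHom {K L : DField.{u, v, w} S} {f : K →ₐ[A] L} (hf : DField.IsHom f)
    {α : Type*} (s : (opLang A m).Term α) (x : α → K) :
    s.realize (fun a => f (x a)) = f (s.realize x) :=
  HomClass.realize_term hf.toEmbedding

/-- Two `𝒟`-closed fields satisfy the same formulas on an algebraically closed inversive common
`𝒟`-subfield. -/
theorem realize_iff_of_isHom {α : Type w} {n : ℕ} (φ : (opLang A m).BoundedFormula α n) :
    ∀ (F K L : DField.{u, v, u} S), CharZero F → IsAlgClosed F → F.IsInversive P →
      K.IsDClosed → L.IsDClosed → ∀ (i : F →ₐ[A] K) (j : F →ₐ[A] L),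
      DField.IsHom i → DField.IsHom j → ∀ (a : α → F) (b : Fin n → F),
      φ.Realize (fun x => i (a x)) (fun k => i (b k)) ↔
        φ.Realize (fun x => j (a x)) (fun k => j (b k)) := by
  induction φ with
  | falsum => intros; rfl
  | @equal n s s' =>
    intro F K L _ _ _ _ _ i j hi hj a b
    have key : ∀ {K : DField.{u, v, u} S} {i : F →ₐ[A] K}, DField.IsHom i →
        ((BoundedFormula.equal s s').Realize (fun x => i (a x)) (fun k => i (b k)) ↔
          s.realize (Sum.elim a b) = s'.realize (Sum.elim a b)) := by
      intro K i hi
      have h1 : Sum.elim (fun x => i (a x)) (fun k => i (b k)) = fun x => i (Sum.elim a b x) := by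
        funext x
        cases x <;> rfl
      rw [BoundedFormula.Realize, h1, realize_term_of_isHom hi, realize_term_of_isHom hi]
      exact i.toRingHom.injective.eq_iff
    rw [key hi, key hj]
  | rel R _ => exact isEmptyElim R
  | imp _ _ ih1 ih2 =>
    intro F K L h0 hF hinv hK hL i j hi hj a b
    rw [BoundedFormula.realize_imp, BoundedFormula.realize_imp,
      ih1 F K L h0 hF hinv hK hL i j hi hj a b, ih2 F K L h0 hF hinv hK hL i j hi hj a b]
  | @all n φ ih =>
    have key : ∀ (F K L : DField.{u, v, u} S), CharZero F → IsAlgClosed F → F.IsInversive P →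
        K.IsDClosed → L.IsDClosed → ∀ (i : F →ₐ[A] K) (j : F →ₐ[A] L),
        DField.IsHom i → DField.IsHom j → ∀ (a : α → F) (b : Fin n → F),
        φ.all.Realize (fun x => j (a x)) (fun k => j (b k)) →
          φ.all.Realize (fun x => i (a x)) (fun k => i (b k)) := by
      intro F K L h0 hF hinv hK hL i j hi hj a b h x
      -- To handle the new element of `K`, amalgamate `K` and `L` over `F`, embed the amalgam in an
      -- elementary extension of `L`, and use the induction hypothesis with `K` itself as the common
      -- subfield.
      obtain ⟨M, g, f, hg, hf, hcomm⟩ := exists_amalgam P hinv hj hi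
      obtain ⟨L', h', hL', hh', hel⟩ := exists_elementary_extension hL.charZero
        (hL.isExistentiallyClosed P) hg
      have h1 := (hel.realize_boundedFormula_iff φ.all (fun x => j (a x)) (fun k => j (b k))).2 h
      have h2 := h1 (h' (f x))
      have h3 := ih K K L' hK.charZero (hK.isAlgClosed P) (hK.isInversive P) hK hL'
        (AlgHom.id A K) (h'.comp f) (fun _ _ => rfl) (hh'.comp hf) (fun x => i (a x))
        (Fin.snoc (fun k => i (b k)) x)
      refine h3.2 ?_
      convert h2 using 1
      · funext y
        exact congrArg h' (hcomm (a y)).symm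
      · funext k
        refine Fin.lastCases ?_ (fun k => ?_) k
        · simp
        · simp only [Fin.snoc_castSucc]
          exact congrArg h' (hcomm (b k)).symm
    intro F K L h0 hF hinv hK hL i j hi hj a b
    exact ⟨key F L K h0 hF hinv hL hK j i hj hi a b, key F K L h0 hF hinv hK hL i j hi hj a b⟩

/-! ### Unique lifting along algebraic extensions -/

section Etale

variable {k F : Type*} [Field k] [Field F] [Algebra k F] [Algebra.IsAlgebraic k F] [CharZero k]

/-- A separable algebraic extension is formally unramified. With `ρ` the map to the residues: on an
algebraic extension, e is determined by its values on the base and by the σⱼ. -/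
theorem ringHom_ext_of_isNilpotent_ker {Q Q' : Type*} [CommRing Q] [CommRing Q'] (ρ : Q →+* Q')
    (hρ : IsNilpotent (RingHom.ker ρ)) (e₁ e₂ : F →+* Q)
    (h : ∀ c, e₁ (algebraMap k F c) = e₂ (algebraMap k F c)) (hr : ∀ x, ρ (e₁ x) = ρ (e₂ x)) :
    e₁ = e₂ := by
  let _ : Algebra k Q := (e₁.comp (algebraMap k F)).toAlgebra
  let f₁ : F →ₐ[k] Q := { e₁ with commutes' := fun _ => rfl }
  let f₂ : F →ₐ[k] Q := { e₂ with commutes' := fun c => (h c).symm }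
  have : Algebra.FormallyEtale k F := Algebra.FormallyEtale.of_isSeparable k F
  have h1 : f₁ = f₂ := Algebra.FormallyUnramified.ext (RingHom.ker ρ) hρ fun x => by
    rw [Ideal.Quotient.eq, RingHom.mem_ker, map_sub, sub_eq_zero]
    exact hr x
  ext x
  exact congrArg (fun f : F →ₐ[k] Q => f x) h1

/-- The existence half of formal étaleness. -/
theorem exists_ringHom_lift_of_isNilpotent_ker {Q Q' : Type*} [CommRing Q] [CommRing Q']
    (ρ : Q →+* Q') (hρs : Function.Surjective ρ)
    (hρ : IsNilpotent (RingHom.ker ρ)) (e₀ : k →+* Q) (s : F →+* Q')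
    (h : ∀ c, ρ (e₀ c) = s (algebraMap k F c)) :
    ∃ e : F →+* Q, (∀ c, e (algebraMap k F c) = e₀ c) ∧ ∀ x, ρ (e x) = s x := by
  let _ : Algebra k Q := e₀.toAlgebra
  let _ : Algebra k Q' := (ρ.comp e₀).toAlgebra
  let ρ' : Q →ₐ[k] Q' := { ρ with commutes' := fun _ => rfl }
  let s' : F →ₐ[k] Q' := { s with commutes' := fun c => (h c).symm }
  have : Algebra.FormallyEtale k F := Algebra.FormallyEtale.of_isSeparable k F
  let e := Algebra.FormallySmooth.liftOfSurjective s' ρ' hρs hρ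
  refine ⟨e.toRingHom, fun c => e.commutes c, fun x => ?_⟩
  exact Algebra.FormallySmooth.liftOfSurjective_apply s' ρ' hρs hρ x

end Etale

end FreeOp

/-! ### The hull of a tuple -/

namespace FreeOp

open FirstOrder FirstOrder.Language

variable {A : Type u} [Field A] {D : Type v} [CommRing D] [Algebra A D] {m t : ℕ}
  {S : OperatorData A D m} (P : LocalDecomposition S t)

theorem exists_algHom_factor {R Q T : Type*} [CommRing R] [CommRing Q] [CommRing T] [Algebra A R]
    [Algebra A Q] [Algebra A T] (f : R →ₐ[A] T) (g : Q →ₐ[A] T) (hg : Function.Injective g)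
    (h : ∀ r, ∃ q, g q = f r) : ∃ e : R →ₐ[A] Q, ∀ r, g (e r) = f r := by
  refine ⟨((AlgEquiv.ofInjective g hg).symm : g.range →ₐ[A] Q).comp
    (f.codRestrict g.range fun r => ?_), fun r => ?_⟩
  · obtain ⟨q, hq⟩ := h r
    exact ⟨q, hq⟩
  · have h1 := (AlgEquiv.ofInjective g hg).apply_symm_apply ⟨f r, h r⟩
    exact congrArg Subtype.val h1

/-- Lifting produces a map F → 𝒟(F) from e on `k` and the σⱼ on `F`; uniqueness of lifts in 𝒟(K)
shows that it agrees with the e of `K`. -/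
theorem exists_exp_of_isAlgebraic (K : DField.{u, v, u} S) {k F : Type u} [Field k] [Field F]
    [CharZero k] [Algebra A k] [Algebra A F] [Algebra k F] [Algebra.IsAlgebraic k F]
    (c : k →ₐ[A] F) (hc : ∀ x, algebraMap k F x = c x) (i : F →ₐ[A] K)
    (he : ∀ x : k, ∃ z : k ⊗[A] D, dmap D (i.comp c) z = K.exp (i (c x)))
    (hσ : ∀ j x, ∃ y, i y = K.sigma P j (i x)) (x : F) :
    ∃ z : F ⊗[A] D, dmap D i z = K.exp (i x) := by
  have hs : ∀ j, ∃ s : F →ₐ[A] F, ∀ x, i (s x) = K.sigma P j (i x) := fun j =>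
    exists_algHom_factor ((K.sigma P j).comp i) i i.injective (hσ j)
  choose s hs using hs
  have hinj : Function.Injective i := i.injective
  have he' : ∀ x, ∃ z : F ⊗[A] D, dmap D i z = ((K.exp.comp i).comp c) x := fun x => by
    obtain ⟨z, hz⟩ := he x
    refine ⟨dmap D c z, ?_⟩
    rw [← dmap_comp, hz]
    rfl
  obtain ⟨e₀, he₀⟩ := exists_algHom_factor ((K.exp.comp i).comp c) (dmap D i)
    (S.dmap_injective i hinj) he'
  have hres : ∀ (z : F ⊗[A] D) j, i (P.projBase j F z) = P.projBase j K (dmap D i z) :=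
    fun z j => (P.projBase_dmap j i z).symm
  obtain ⟨e₁, he₁, hes₁⟩ := exists_ringHom_lift_of_isNilpotent_ker (k := k) (F := F)
    (P.resMap F : F ⊗[A] D →+* (Fin (t + 1) → F)) (P.resMap_surjective F)
    (P.isNilpotent_ker_resMap F) (e₀ : k →+* F ⊗[A] D) (RingHom.pi fun j => (s j : F →+* F))
    (fun x => funext fun j => hinj <| by
      refine (hres _ j).trans ?_
      refine (congrArg (P.projBase j K) (he₀ x)).trans ?_
      refine Eq.trans ?_ (hs j _).symm
      rw [hc]
      rfl)
  have hcomp : ((dmap D i : F ⊗[A] D →ₐ[A] K ⊗[A] D) : F ⊗[A] D →+* K ⊗[A] D).comp e₁ =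
      ((K.exp.comp i : F →ₐ[A] K ⊗[A] D) : F →+* K ⊗[A] D) :=
    ringHom_ext_of_isNilpotent_ker (k := k) (P.resMap K : K ⊗[A] D →+* (Fin (t + 1) → K))
      (P.isNilpotent_ker_resMap K) _ _
      (fun x => by
        refine (congrArg (dmap D i) (he₁ x)).trans ((he₀ x).trans ?_)
        rw [hc]
        rfl)
      (fun x => funext fun j => (hres _ j).symm.trans <|
        (congrArg i (congrFun (hes₁ x) j)).trans (hs j x))
  exact ⟨e₁ x, congrArg (fun f : F →+* K ⊗[A] D => f x) hcomp⟩

theorem exists_dField_of_exp (K : DField.{u, v, u} S) (F : IntermediateField A K)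
    (he : ∀ x : F, ∃ z : F ⊗[A] D, dmap D F.val z = K.exp x) :
    ∃ (e : F →ₐ[A] F ⊗[A] D) (he0 : ∀ r, S.coord 0 (e r) = r),
      DField.IsHom (K := DField.ofExp S F e he0) (L := K) F.val := by
  obtain ⟨e, he'⟩ := exists_algHom_factor (K.exp.comp F.val) (dmap D F.val)
    (S.dmap_injective _ F.val.injective) he
  have he0 : ∀ r, S.coord 0 (e r) = r := fun r => Subtype.ext <|
    (S.coord_dmap F.val 0 (e r)).symm.trans
      ((congrArg (S.coord 0) (he' r)).trans (K.coord_zero_exp r))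
  refine ⟨e, he0, DField.isHom_iff.2 fun r => ?_⟩
  exact (congrArg _ (DField.ofExp_exp F e he0 r)).trans (he' r)

/-- The algebraic closure inside `K` of a `𝒟`-subfield with bijective associated endomorphisms. -/
theorem exists_hull (K : DField.{u, v, u} S) [CharZero K] [IsAlgClosed K] (hK : K.IsInversive P)
    (F₀ : IntermediateField A K) (he : ∀ x : F₀, ∃ z : F₀ ⊗[A] D, dmap D F₀.val z = K.exp x)
    (hσ : ∀ j, ∀ y ∈ F₀, ∃ x ∈ F₀, K.sigma P j x = y) :
    ∃ (F : DField.{u, v, u} S) (i : F →ₐ[A] K) (c : F₀ →ₐ[A] F), DField.IsHom i ∧ IsAlgClosed F ∧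
      F.IsInversive P ∧ (∀ x, i (c x) = x) ∧ ∀ x : F, IsAlgebraic F₀ (i x) := by
  have hclo : ∃ F : IntermediateField A K, F₀ ≤ F ∧ IsAlgClosed F ∧
      ∀ x, x ∈ F ↔ IsAlgebraic F₀ x := by
    refine ⟨(algebraicClosure F₀ K).restrictScalars A, fun x hx => ?_, ?_, fun x => ?_⟩
    · exact (mem_algebraicClosure_iff).2 (isAlgebraic_algebraMap (⟨x, hx⟩ : F₀))
    · exact (algebraicClosure.isAlgClosure (F := F₀) (E := K)).isAlgClosed
    · exact mem_algebraicClosure_iff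
  obtain ⟨F, hle, hF, hmem⟩ := hclo
  have hσ₀ : ∀ j (x : F₀), K.sigma P j x ∈ F₀ := fun j x => by
    obtain ⟨z, hz⟩ := he x
    rw [K.sigma_apply, ← hz, P.projBase_dmap]
    exact (P.projBase j F₀ z).2
  have hσ₁ : ∀ j, ∃ s : F₀ →ₐ[A] F₀, ∀ x, (s x : K) = K.sigma P j x := fun j =>
    exists_algHom_factor ((K.sigma P j).comp F₀.val) F₀.val F₀.val.injective
      fun x => ⟨⟨_, hσ₀ j x⟩, rfl⟩
  choose s₀ hs₀ using hσ₁
  -- Each σⱼ maps `F₀` onto itself, so it preserves and reflects algebraicity over `F₀`; reflection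
  -- gives surjectivity on the hull.
  have hσF : ∀ j (x : K), IsAlgebraic F₀ x → IsAlgebraic F₀ (K.sigma P j x) := fun j x hx =>
    hx.ringHom_of_comp_eq (s₀ j : F₀ →+* F₀) (K.sigma P j : K →+* K)
      (s₀ j : F₀ →+* F₀).injective (RingHom.ext fun y => hs₀ j y)
  have hσF' : ∀ j (x : K), IsAlgebraic F₀ (K.sigma P j x) → IsAlgebraic F₀ x := fun j x hx =>
    hx.of_ringHom_of_comp_eq (s₀ j : F₀ →+* F₀) (K.sigma P j : K →+* K)
      (fun y => by
        obtain ⟨x, hx, hxy⟩ := hσ j y y.2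
        exact ⟨⟨x, hx⟩, Subtype.ext ((hs₀ j ⟨x, hx⟩).trans hxy)⟩)
      (K.sigma_injective P j) (RingHom.ext fun y => hs₀ j y)
  let _ : Algebra F₀ F := (IntermediateField.inclusion hle).toRingHom.toAlgebra
  have : Algebra.IsAlgebraic F₀ F := ⟨fun x =>
    ((hmem x).1 x.2).of_ringHom_of_comp_eq (RingHom.id F₀) (F.val : F →+* K)
      Function.surjective_id F.val.injective rfl⟩
  have : CharZero F₀ := (algebraMap F₀ K).charZero
  obtain ⟨e, he0, hi⟩ := exists_dField_of_exp K F (exists_exp_of_isAlgebraic P K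
    (IntermediateField.inclusion hle) (fun _ => rfl) F.val he
    fun j x => ⟨⟨_, (hmem _).2 (hσF j x ((hmem x).1 x.2))⟩, rfl⟩)
  refine ⟨DField.ofExp S F e he0, F.val, IntermediateField.inclusion hle, hi, hF,
    fun j y => ?_, fun _ => rfl, fun x => (hmem _).1 x.2⟩
  obtain ⟨x, hx⟩ := hK j (F.val y)
  have hxF : x ∈ F := (hmem x).2 (hσF' j x (by
    rw [hx]
    exact (hmem _).1 y.2))
  refine ⟨⟨x, hxF⟩, F.val.injective ?_⟩
  exact (hi.sigma P j ⟨x, hxF⟩).trans hx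

/-- The field generated by `Θ a`. -/
def thetaField (K : DField.{u, v, w} S) {n : ℕ} (a : Fin n → K) : IntermediateField A K :=
  IntermediateField.adjoin A (Set.range (thetaTuple P K a))

theorem thetaTuple_mem (K : DField.{u, v, w} S) {n : ℕ} (a : Fin n → K) (x : XVar m t n) :
    thetaTuple P K a x ∈ thetaField P K a :=
  IntermediateField.subset_adjoin _ _ ⟨x, rfl⟩

theorem thetaTuple_op (K : DField.{u, v, w} S) {n : ℕ} (a : Fin n → K) (k : Fin m)
    (θ : LocalDecomposition.Word m t) (x : Fin n) :
    thetaTuple P K a (Sum.inl k :: θ, x) = K.op k (thetaTuple P K a (θ, x)) := rfl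

theorem sigma_thetaTuple (K : DField.{u, v, w} S) (hK : K.IsInversive P) {n : ℕ} (a : Fin n → K)
    (j : Fin t) (θ : LocalDecomposition.Word m t) (x : Fin n) :
    K.sigma P j.succ (thetaTuple P K a (Sum.inr j :: θ, x)) = thetaTuple P K a (θ, x) := by
  rw [← DField.assocEnd_eq_sigma]
  refine Function.invFun_eq ?_
  obtain ⟨y, hy⟩ := hK j.succ (thetaTuple P K a (θ, x))
  exact ⟨y, (K.assocEnd_eq_sigma P _ _).trans hy⟩

/-- The tuple is closed under the operators. For inverses, e(x) has nonzero residues and is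
therefore already invertible in 𝒟 of the subfield. -/
theorem thetaField_exp (K : DField.{u, v, w} S) {n : ℕ} (a : Fin n → K) (x : K)
    (hx : x ∈ thetaField P K a) :
    ∃ z : thetaField P K a ⊗[A] D, dmap D (thetaField P K a).val z = K.exp x := by
  induction hx using IntermediateField.adjoin_induction with
  | mem x hx =>
    obtain ⟨⟨θ, x⟩, rfl⟩ := hx
    have h : ∀ k, S.coord k (K.exp (thetaTuple P K a (θ, x))) ∈ thetaField P K a := fun k => by
      refine Fin.cases ?_ (fun k => ?_) k
      · rw [K.coord_zero_exp]
        exact thetaTuple_mem P K a _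
      · rw [K.coord_succ_exp, ← thetaTuple_op]
        exact thetaTuple_mem P K a _
    refine ⟨S.ofCoord fun k => ⟨_, h k⟩, ?_⟩
    rw [S.dmap_ofCoord]
    exact S.ofCoord_coord _
  | algebraMap c => exact ⟨algebraMap A _ c, by rw [AlgHom.commutes, AlgHom.commutes]⟩
  | add x y _ _ hx hy =>
    obtain ⟨z, hz⟩ := hx
    obtain ⟨z', hz'⟩ := hy
    exact ⟨z + z', by rw [map_add, map_add, hz, hz']⟩
  | mul x y _ _ hx hy =>
    obtain ⟨z, hz⟩ := hx
    obtain ⟨z', hz'⟩ := hy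
    exact ⟨z * z', by rw [map_mul, map_mul, hz, hz']⟩
  | inv x _ hx =>
    obtain ⟨z, hz⟩ := hx
    rcases eq_or_ne x 0 with rfl | h0
    · exact ⟨0, by simp⟩
    have hu : IsUnit z := P.isUnit_of_projBase_ne_zero fun j hj => h0 <| by
      apply K.sigma_injective P j
      rw [K.sigma_apply, ← hz, P.projBase_dmap, hj, map_zero, map_zero]
    obtain ⟨z', hz'⟩ := hu.exists_right_inv
    refine ⟨z', ?_⟩
    have h1 : K.exp x * dmap D (thetaField P K a).val z' = 1 := by
      rw [← hz, ← map_mul, hz', map_one]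
    have h2 : K.exp x⁻¹ * K.exp x = 1 := by rw [← map_mul, inv_mul_cancel₀ h0, map_one]
    exact (left_inv_eq_right_inv h2 h1).symm

theorem thetaField_exists_sigma (K : DField.{u, v, w} S) (hK : K.IsInversive P) {n : ℕ}
    (a : Fin n → K) (j : Fin (t + 1)) (y : K) (hy : y ∈ thetaField P K a) :
    ∃ x ∈ thetaField P K a, K.sigma P j x = y := by
  refine Fin.cases ⟨y, hy, K.sigma_zero P y⟩ (fun j => ?_) j
  induction hy using IntermediateField.adjoin_induction with
  | mem x hx =>
    obtain ⟨⟨θ, x⟩, rfl⟩ := hx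
    exact ⟨_, thetaTuple_mem P K a (Sum.inr j :: θ, x), sigma_thetaTuple P K hK a j θ x⟩
  | algebraMap c => exact ⟨_, (thetaField P K a).algebraMap_mem c, AlgHom.commutes _ _⟩
  | add x y _ _ hx hy =>
    obtain ⟨z, hz, rfl⟩ := hx
    obtain ⟨z', hz', rfl⟩ := hy
    exact ⟨z + z', add_mem hz hz', map_add _ _ _⟩
  | mul x y _ _ hx hy =>
    obtain ⟨z, hz, rfl⟩ := hx
    obtain ⟨z', hz', rfl⟩ := hy
    exact ⟨z * z', mul_mem hz hz', map_mul _ _ _⟩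
  | inv x _ hx =>
    obtain ⟨z, hz, rfl⟩ := hx
    exact ⟨z⁻¹, inv_mem hz, map_inv₀ _ _⟩

/-- A field embedding of the hull of `a` that is compatible with the associated endomorphisms and
carries `Θ a` to `Θ b` is elementary. -/
theorem realize_iff_of_hull {K L F : DField.{u, v, u} S} (hK : K.IsDClosed) (hL : L.IsDClosed)
    {n : ℕ} (a : Fin n → K) (b : Fin n → L) {i : F →ₐ[A] K} (c : thetaField P K a →ₐ[A] F)
    (hi : DField.IsHom i) (hF : IsAlgClosed F) (hinv : F.IsInversive P) (hc : ∀ x, i (c x) = x)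
    (halg : ∀ x : F, IsAlgebraic (thetaField P K a) (i x)) (g : F →ₐ[A] L)
    (hgσ : ∀ j x, g (F.sigma P j x) = L.sigma P j (g x))
    (hgθ : ∀ x, g (c ⟨_, thetaTuple_mem P K a x⟩) = thetaTuple P L b x)
    (φ : (opLang A m).Formula (Fin n)) : φ.Realize a ↔ φ.Realize b := by
  have : CharZero K := hK.charZero
  have hF0 : CharZero F := (i : F →+* K).charZero
  have : CharZero (thetaField P K a) :=
    (algebraMap (thetaField P K a) K).charZero
  let _ : Algebra (thetaField P K a) F := c.toRingHom.toAlgebra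
  have : Algebra.IsAlgebraic (thetaField P K a) F := ⟨fun x =>
    (halg x).of_ringHom_of_comp_eq (RingHom.id _) (i : F →+* K) Function.surjective_id
      i.injective (RingHom.ext fun x => (hc x).symm)⟩
  -- On A(Θa) it is enough to compare generators, and there the claim holds because Θ is closed
  -- under prefixing an operator.
  have hmem : ∀ x (hx : x ∈ thetaField P K a),
      L.exp (g (c ⟨x, hx⟩)) = dmap D g (F.exp (c ⟨x, hx⟩)) := fun x hx => by
    induction hx using IntermediateField.adjoin_induction with
    | mem x hx =>
      obtain ⟨⟨θ, x⟩, rfl⟩ := hx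
      refine S.coord_ext fun k => ?_
      rw [S.coord_dmap]
      refine Fin.cases ?_ (fun k => ?_) k
      · rw [L.coord_zero_exp, F.coord_zero_exp]
      · rw [L.coord_succ_exp, F.coord_succ_exp]
        have h1 := hgθ (θ, x)
        have h2 := hgθ (Sum.inl k :: θ, x)
        have h3 : F.op k (c ⟨_, thetaTuple_mem P K a (θ, x)⟩) =
            c ⟨_, thetaTuple_mem P K a (Sum.inl k :: θ, x)⟩ := by
          have hinj : Function.Injective i := i.injective
          apply hinj
          rw [hi, hc, hc]
          rfl
        refine (congrArg (L.op k) h1).trans ?_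
        exact h2.symm.trans (congrArg g h3.symm)
    | algebraMap r =>
      have : (⟨algebraMap A K r, (thetaField P K a).algebraMap_mem r⟩ : thetaField P K a) =
        algebraMap A _ r := rfl
      rw [this]
      simp only [AlgHom.commutes]
    | add x y hx hy h h' =>
      have : (⟨x + y, add_mem hx hy⟩ : thetaField P K a) = ⟨x, hx⟩ + ⟨y, hy⟩ := rfl
      rw [this]
      simp only [map_add, h, h']
    | mul x y hx hy h h' =>
      have : (⟨x * y, mul_mem hx hy⟩ : thetaField P K a) = ⟨x, hx⟩ * ⟨y, hy⟩ := rfl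
      rw [this]
      simp only [map_mul, h, h']
    | inv x hx h =>
      rcases eq_or_ne x 0 with rfl | h0
      · have : (⟨(0 : K)⁻¹, inv_mem hx⟩ : thetaField P K a) = 0 := Subtype.ext inv_zero
        rw [this]
        simp only [map_zero]
      · have h1 : (⟨x⁻¹, inv_mem hx⟩ : thetaField P K a) * ⟨x, hx⟩ = 1 :=
          Subtype.ext (inv_mul_cancel₀ h0)
        have h2 : L.exp (g (c ⟨x⁻¹, inv_mem hx⟩)) * L.exp (g (c ⟨x, hx⟩)) = 1 := by
          rw [← map_mul, ← map_mul, ← map_mul, h1, map_one, map_one, map_one]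
        refine left_inv_eq_right_inv h2 ?_
        rw [h, ← map_mul, ← map_mul, ← map_mul, mul_comm, h1, map_one, map_one, map_one]
  -- Two homomorphisms F → 𝒟(L) that agree on A(Θa) and whose residues are σⱼ ∘ g and g ∘ σⱼ; unique
  -- lifting makes them equal.
  have key : ((L.exp.comp g : F →ₐ[A] L ⊗[A] D) : F →+* L ⊗[A] D) =
      (((dmap D g).comp F.exp : F →ₐ[A] L ⊗[A] D) : F →+* L ⊗[A] D) :=
    ringHom_ext_of_isNilpotent_ker (k := thetaField P K a)
      (P.resMap L : L ⊗[A] D →+* (Fin (t + 1) → L)) (P.isNilpotent_ker_resMap L) _ _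
      (fun x => hmem x x.2) (fun x => funext fun j => by
        change P.projBase j L (L.exp (g x)) = P.projBase j L (dmap D g (F.exp x))
        rw [P.projBase_dmap]
        exact (hgσ j x).symm)
  have hg : DField.IsHom g := DField.isHom_iff.2 fun x =>
    (congrArg (fun f : F →+* L ⊗[A] D => f x) key).symm
  have h1 := realize_iff_of_isHom P (φ.relabel (ULift.up.{u}) : (opLang A m).Formula _) F K L hF0 hF
    hinv hK hL i g hi hg (fun x => c ⟨_, thetaTuple_mem P K a ([], x.down)⟩) Fin.elim0
  have h2 := Formula.realize_relabel (φ := φ) (g := ULift.up.{u})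
    (v := fun x => i (c ⟨_, thetaTuple_mem P K a ([], x.down)⟩))
  have h3 := Formula.realize_relabel (φ := φ) (g := ULift.up.{u})
    (v := fun x => g (c ⟨_, thetaTuple_mem P K a ([], x.down)⟩))
  have ha : (fun x : ULift.{u} (Fin n) => i (c ⟨_, thetaTuple_mem P K a ([], x.down)⟩)) ∘ ULift.up
      = a := funext fun x => hc _
  have hb : (fun x : ULift.{u} (Fin n) => g (c ⟨_, thetaTuple_mem P K a ([], x.down)⟩)) ∘ ULift.up
      = b := funext fun x => hgθ ([], x)
  rw [ha] at h2
  rw [hb] at h3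
  rw [← h2, ← h3]
  rw [Subsingleton.elim (fun k => i (Fin.elim0 k)) default,
    Subsingleton.elim (fun k => g (Fin.elim0 k)) default] at h1
  exact h1

end FreeOp

/-! ### Ring formulas in Θx, y, σy as formulas of the operator language -/

namespace FreeOp

open FirstOrder FirstOrder.Language

variable {A : Type u} [Field A] {D : Type v} [CommRing D] [Algebra A D] {m t : ℕ}
  {S : OperatorData A D m} (P : LocalDecomposition S t)

/-- The formula expressing `z = θ s`. -/
noncomputable def wordGraph : LocalDecomposition.Word m t → ∀ {α : Type}, (opLang A m).Term α →
    (opLang A m).Term α → (opLang A m).Formula α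
  | [], _, s, z => Term.equal z s
  | Sum.inl k :: θ, _, s, z => Formula.iExs (Fin 1)
      (wordGraph θ (s.relabel Sum.inl) (Term.var (Sum.inr 0)) ⊓
        Term.equal (z.relabel Sum.inl) (dOp k (Term.var (Sum.inr 0))))
  | Sum.inr j :: θ, _, s, z => Formula.iExs (Fin 1)
      (wordGraph θ (s.relabel Sum.inl) (Term.var (Sum.inr 0)) ⊓
        Term.equal (dSigma P j.succ (z.relabel Sum.inl)) (Term.var (Sum.inr 0)))

theorem evalLetter_inr (K : DField.{u, v, w} S) (hK : K.IsInversive P) (j : Fin t) (x z : K) :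
    K.sigma P j.succ z = x ↔ z = P.evalLetter K.op (Sum.inr j) x := by
  have h1 : K.sigma P j.succ (P.evalLetter K.op (Sum.inr j) x) = x := by
    rw [← DField.assocEnd_eq_sigma]
    refine Function.invFun_eq ?_
    obtain ⟨y, hy⟩ := hK j.succ x
    exact ⟨y, (K.assocEnd_eq_sigma P _ _).trans hy⟩
  constructor
  · intro h
    exact K.sigma_injective P j.succ (h.trans h1.symm)
  · rintro rfl
    exact h1

theorem realize_wordGraph (K : DField.{u, v, w} S) (hK : K.IsInversive P)
    (θ : LocalDecomposition.Word m t) {α : Type} (s z : (opLang A m).Term α) (x : α → K) :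
    (wordGraph P θ s z).Realize x ↔ z.realize x = P.evalWord K.op θ (s.realize x) := by
  induction θ generalizing α with
  | nil => exact Formula.realize_equal
  | cons l θ ih =>
    rcases l with k | j
    · simp only [wordGraph, Formula.realize_iExs, Formula.realize_inf, ih, Formula.realize_equal,
        K.compatible.realize_op, Term.realize_relabel, Term.realize_var, Sum.elim_inr,
        Sum.elim_comp_inl]
      constructor
      · rintro ⟨y, hy, h⟩
        rw [h, hy]
        rfl
      · intro h
        exact ⟨fun _ => P.evalWord K.op θ (s.realize x), rfl, h⟩
    · simp only [wordGraph, Formula.realize_iExs, Formula.realize_inf, ih, Formula.realize_equal,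
        realize_sigma, Term.realize_relabel, Term.realize_var, Sum.elim_inr,
        Sum.elim_comp_inl, evalLetter_inr P K hK]
      constructor
      · rintro ⟨y, hy, h⟩
        rw [h, hy]
        rfl
      · intro h
        exact ⟨fun _ => P.evalWord K.op θ (s.realize x), rfl, h⟩

/-- The formula expressing that `z` is the value of the variable `v`. -/
noncomputable def varGraph {n : ℕ} {β : Type} (z : β) :
    XYVar m t n → (opLang A m).Formula ((Fin n ⊕ Fin 1) ⊕ β)
  | Sum.inl (θ, i) => wordGraph P θ (Term.var (Sum.inl (Sum.inl i))) (Term.var (Sum.inr z))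
  | Sum.inr j => Term.equal (Term.var (Sum.inr z))
      (dSigma P j (Term.var (Sum.inl (Sum.inr 0))))

theorem realize_varGraph (K : DField.{u, v, w} S) (hK : K.IsInversive P) {n : ℕ} {β : Type} (z : β)
    (V : XYVar m t n) (x : Fin n ⊕ Fin 1 → K) (y : β → K) :
    (varGraph P z V).Realize (Sum.elim x y) ↔
      y z = Sum.elim (thetaTuple P K fun i => x (Sum.inl i)) (sigmaTuple P K (x (Sum.inr 0))) V := by
  rcases V with ⟨θ, i⟩ | j
  · exact realize_wordGraph P K hK θ _ _ _
  · refine Formula.realize_equal.trans ?_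
    rw [realize_sigma, ← DField.assocEnd_eq_sigma]
    rfl

open Classical in
/-- The formula of `L_𝒟` expressing that `χ` holds at `Θ x, y, σ y`. -/
noncomputable def translate {n : ℕ} (χ : (algLang A).Formula (XYVar m t n)) :
    (opLang A m).Formula (Fin n ⊕ Fin 1) :=
  Formula.iExs χ.freeVarFinset
    (BoundedFormula.iInf (fun V : χ.freeVarFinset => varGraph P V V.1) ⊓
      (LHom.sumInl : algLang A →ᴸ opLang A m).onFormula (χ.restrictFreeVar Sum.inr))

theorem realize_translate (K : DField.{u, v, w} S) (hK : K.IsInversive P) {n : ℕ}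
    (χ : (algLang A).Formula (XYVar m t n)) (x : Fin n ⊕ Fin 1 → K) :
    (translate P χ).Realize x ↔
      χ.Realize (Sum.elim (thetaTuple P K fun i => x (Sum.inl i))
        (sigmaTuple P K (x (Sum.inr 0)))) := by
  classical
  simp only [translate, Formula.realize_iExs, Formula.realize_inf]
  set X := Sum.elim (thetaTuple P K fun i => x (Sum.inl i)) (sigmaTuple P K (x (Sum.inr 0))) with hX
  have h1 : ∀ y : χ.freeVarFinset → K, (BoundedFormula.iInf (fun V : χ.freeVarFinset =>
      varGraph P V V.1)).Realize (Sum.elim x y) default ↔ ∀ V, y V = X V.1 := fun y => by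
    rw [BoundedFormula.realize_iInf]
    exact forall_congr' fun V => realize_varGraph P K hK V V.1 x y
  have h2 : ∀ y : χ.freeVarFinset → K, (∀ V, y V = X V.1) →
      (((LHom.sumInl : algLang A →ᴸ opLang A m).onFormula (χ.restrictFreeVar Sum.inr)).Realize
        (Sum.elim x y) ↔ χ.Realize X) := fun y hy => by
    rw [LHom.realize_onFormula]
    exact BoundedFormula.realize_restrictFreeVar X hy
  constructor
  · rintro ⟨y, hy, h⟩
    exact (h2 y ((h1 y).1 hy)).1 h
  · intro h
    exact ⟨fun V => X V.1, (h1 _).2 fun _ => rfl, (h2 _ fun _ => rfl).2 h⟩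

/-- The term `θ s`, when the associated endomorphisms are trivial. -/
def wordTerm {α : Type} (θ : LocalDecomposition.Word m t) (s : (opLang A m).Term α) :
    (opLang A m).Term α :=
  θ.foldr (fun l r => Sum.elim (fun k => dOp k r) (fun _ => r) l) s

theorem realize_wordTerm (K : DField.{u, v, w} S) (hK : ∀ j r, P.assocEnd K.op j r = r)
    (θ : LocalDecomposition.Word m t) {α : Type} (s : (opLang A m).Term α) (x : α → K) :
    (wordTerm θ s).realize x = P.evalWord K.op θ (s.realize x) := by
  induction θ with
  | nil => rfl
  | cons l θ ih =>
    rcases l with k | j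
    · refine (K.compatible.realize_op _ _ _).trans ?_
      exact congrArg (K.op k) ih
    -- When σⱼ is the identity, `Function.invFun` of it is the identity as well, so the letter can
    -- be dropped.
    · refine ih.trans ?_
      have h1 : P.assocEnd K.op j.succ (Function.invFun (P.assocEnd K.op j.succ)
          (P.evalWord K.op θ (s.realize x))) = _ := Function.invFun_eq ⟨_, hK _ _⟩
      rw [hK] at h1
      exact h1.symm

theorem isQF_onBoundedFormula {L L' : FirstOrder.Language} (f : L →ᴸ L') {α : Type*} {n : ℕ}
    {φ : L.BoundedFormula α n} (h : φ.IsQF) : (f.onBoundedFormula φ).IsQF := by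
  induction h with
  | falsum => exact BoundedFormula.IsQF.falsum
  | of_isAtomic h =>
    cases h with
    | equal s s' => exact (BoundedFormula.IsAtomic.equal _ _).isQF
    | rel R s => exact (BoundedFormula.IsAtomic.rel _ _).isQF
  | imp _ _ h h' => exact h.imp h'

theorem isQF_subst {L : FirstOrder.Language} {α β : Type*} {n : ℕ} {φ : L.BoundedFormula α n}
    (h : φ.IsQF) (f : α → L.Term β) : (φ.subst f).IsQF := by
  induction h with
  | falsum => exact BoundedFormula.IsQF.falsum
  | of_isAtomic h =>
    cases h with
    | equal s s' => exact (BoundedFormula.IsAtomic.equal _ _).isQF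
    | rel R s => exact (BoundedFormula.IsAtomic.rel _ _).isQF
  | imp _ _ h h' => exact h.imp h'

/-- The quantifier-free formula expressing that `ξ` holds at `Θ x`, when the associated
endomorphisms are trivial. -/
def translateQF {n : ℕ} (ξ : (algLang A).Formula (XVar m t n)) : (opLang A m).Formula (Fin n) :=
  BoundedFormula.subst ((LHom.sumInl : algLang A →ᴸ opLang A m).onFormula ξ)
    fun p => wordTerm p.1 (Term.var p.2)

theorem isQF_translateQF {n : ℕ} {ξ : (algLang A).Formula (XVar m t n)} (h : ξ.IsQF) :
    (translateQF (m := m) ξ).IsQF :=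
  isQF_subst (isQF_onBoundedFormula _ h) _

theorem realize_translateQF (K : DField.{u, v, w} S) (hK : ∀ j r, P.assocEnd K.op j r = r) {n : ℕ}
    (ξ : (algLang A).Formula (XVar m t n)) (x : Fin n → K) :
    (translateQF ξ).Realize x ↔ ξ.Realize (thetaTuple P K x) := by
  refine BoundedFormula.realize_subst.trans ?_
  have h1 : (fun p : XVar m t n => (wordTerm p.1 (Term.var p.2) : (opLang A m).Term _).realize x) =
      thetaTuple P K x := funext fun p => realize_wordTerm P K hK _ _ _
  rw [h1]
  exact LHom.realize_onFormula _ _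

/-- Triviality of σᵢ is an equation valid in `DCF0`, so the hypothesis transfers to models in any
universe. -/
theorem assocEnd_eq_self_of_isDClosed (h : ∀ K : DField.{u, v, u} S, K.IsDClosed →
      ∀ (i : Fin (t + 1)) (r : K), P.assocEnd K.op i r = r) {K : DField.{u, v, w} S}
    (hK : K.IsDClosed) (i : Fin (t + 1)) (r : K) : P.assocEnd K.op i r = r := by
  have h1 := realize_of_model_DCF0 (S := S) hK (β := Fin 1)
    (Term.equal (dSigma P i (Term.var 0)) (Term.var 0)) (fun K h0 hec x => by
      rw [Formula.realize_equal, realize_sigma, ← DField.assocEnd_eq_sigma]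
      exact h K (hec.isDClosed h0) i _) (fun _ => r)
  rw [Formula.realize_equal, realize_sigma, ← DField.assocEnd_eq_sigma] at h1
  exact h1

section Terms

variable {α : Type w'} (K : DField.{u, v, w} S) (x : α → K)

theorem realize_addTerm (s s' : (algLang A).Term α) :
    (addTerm s s').realize x = s.realize x + s'.realize x := rfl

theorem realize_mulTerm (s s' : (algLang A).Term α) :
    (mulTerm s s').realize x = s.realize x * s'.realize x := rfl

theorem realize_powTerm (s : (algLang A).Term α) (k : ℕ) :
    (powTerm s k).realize x = s.realize x ^ k := by
  induction k with
  | zero => exact (pow_zero _).symm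
  | succ k ih =>
    rw [pow_succ, ← ih]
    rfl

theorem realize_polyTerm {N : ℕ} (c : Fin (N + 1) → (algLang A).Term α) (s : (algLang A).Term α) :
    (polyTerm c s).realize x = ∑ j : Fin (N + 1), (c j).realize x * s.realize x ^ (j : ℕ) := by
  have key : ∀ l : List ((algLang A).Term α),
      (l.foldr addTerm zeroTerm).realize x = (l.map fun s => s.realize x).sum := fun l => by
    induction l with
    | nil => rfl
    | cons s l ih =>
      rw [List.foldr_cons, realize_addTerm, ih, List.map_cons, List.sum_cons]
  rw [polyTerm, key, List.map_ofFn, List.sum_ofFn]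
  exact Finset.sum_congr rfl fun j _ => by
    rw [Function.comp_apply, realize_mulTerm, realize_powTerm]

end Terms

/-- Polynomials are given by terms. -/
theorem exists_term_realize_eq_aeval (S : OperatorData A D m) {α : Type} (p : MvPolynomial α A) :
    ∃ s : (algLang A).Term α, ∀ (K : DField.{u, v, w} S) (x : α → K),
      s.realize x = MvPolynomial.aeval x p := by
  induction p using MvPolynomial.induction_on with
  | C a =>
    refine ⟨Functions.apply₁ (L := algLang A) (AlgFunc.smul a) oneTerm, fun K x => ?_⟩
    rw [MvPolynomial.aeval_C, Algebra.algebraMap_eq_smul_one]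
    rfl
  | add p q hp hq =>
    obtain ⟨s, hs⟩ := hp
    obtain ⟨s', hs'⟩ := hq
    exact ⟨addTerm s s', fun K x => by rw [realize_addTerm, hs, hs', map_add]⟩
  | mul_X p i hp =>
    obtain ⟨s, hs⟩ := hp
    exact ⟨mulTerm s (Term.var i), fun K x => by
      rw [realize_mulTerm, hs, map_mul, MvPolynomial.aeval_X]
      rfl⟩

theorem realize_dnf {α : Type w'} (K : DField.{u, v, w} S) (x : α → K)
    (C : List (List ((algLang A).Formula α))) :
    (dnf C).Realize x ↔ ∃ c ∈ C, ∀ χ ∈ c, χ.Realize x := by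
  refine (BoundedFormula.realize_foldr_sup _ _ _).trans ?_
  simp only [List.mem_map, exists_exists_and_eq_and]
  exact exists_congr fun c => and_congr_right fun _ => BoundedFormula.realize_foldr_inf _ _ _

theorem isQF_dnf {α : Type w'} {C : List (List ((algLang A).Formula α))}
    (hC : ∀ c ∈ C, ∀ χ ∈ c, IsLiteral χ) : (dnf C).IsQF := by
  refine isQF_foldr_sup _ fun φ hφ => ?_
  obtain ⟨c, hc, rfl⟩ := List.mem_map.1 hφ
  refine isQF_foldr_inf _ fun χ hχ => ?_
  obtain h | ⟨χ', h, rfl⟩ := hC c hc χ hχ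
  · exact h.isQF
  · exact h.isQF.not

end FreeOp

/-! ### Generation of fields, polynomial relations and compactness -/

namespace FreeOp

open FirstOrder FirstOrder.Language

variable {A : Type u} [Field A] {D : Type v} [CommRing D] [Algebra A D] {m t : ℕ}
  {S : OperatorData A D m} (P : LocalDecomposition S t)

section FieldGeneration

variable {K L ι : Type*} [Field K] [Field L] [Algebra A K] [Algebra A L]

/-- Equal ideals of relations give an embedding of the generated algebra, which extends to its
fraction field. -/
theorem exists_algHom_of_aeval_eq_zero_iff (x : ι → K) (y : ι → L)
    (h : ∀ p : MvPolynomial ι A, MvPolynomial.aeval x p = 0 ↔ MvPolynomial.aeval y p = 0) :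
    ∃ g : IntermediateField.adjoin A (Set.range x) →ₐ[A] L,
      ∀ i, g ⟨x i, IntermediateField.subset_adjoin _ _ ⟨i, rfl⟩⟩ = y i := by
  open scoped IntermediateField.algebraAdjoinAdjoin in
  have hmem : ∀ p : MvPolynomial ι A,
      MvPolynomial.aeval x p ∈ Algebra.adjoin A (Set.range x) := fun p => by
    rw [Algebra.adjoin_range_eq_range_aeval]
    exact ⟨p, rfl⟩
  let q : MvPolynomial ι A →ₐ[A] Algebra.adjoin A (Set.range x) :=
    (MvPolynomial.aeval x).codRestrict _ hmem
  have hq : Function.Surjective q := by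
    rintro ⟨z, hz⟩
    rw [Algebra.adjoin_range_eq_range_aeval] at hz
    obtain ⟨p, rfl⟩ := hz
    exact ⟨p, rfl⟩
  have hq0 : ∀ p, q p = 0 ↔ MvPolynomial.aeval x p = 0 := fun p => by
    rw [← Subtype.val_inj]
    rfl
  obtain ⟨c, hc⟩ := exists_algHom_of_surjective q hq (MvPolynomial.aeval y)
    fun p hp => (h p).1 ((hq0 p).1 hp)
  have hcinj : Function.Injective c := by
    rw [injective_iff_map_eq_zero]
    intro z hz
    obtain ⟨p, rfl⟩ := hq z
    rw [hc] at hz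
    exact (hq0 p).2 ((h p).2 hz)
  refine ⟨IsFractionRing.liftAlgHom (R := A) (A := Algebra.adjoin A (Set.range x)) (g := c) hcinj,
    fun i => ?_⟩
  have h1 := IsFractionRing.lift_algebraMap (K := IntermediateField.adjoin A (Set.range x))
    (g := (c : Algebra.adjoin A (Set.range x) →+* L)) hcinj (q (MvPolynomial.X i))
  have h2 : algebraMap (Algebra.adjoin A (Set.range x))
      (IntermediateField.adjoin A (Set.range x)) (q (MvPolynomial.X i)) =
      ⟨x i, IntermediateField.subset_adjoin _ _ ⟨i, rfl⟩⟩ :=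
    Subtype.ext (MvPolynomial.aeval_X x i)
  rw [h2] at h1
  refine h1.trans ((hc _).trans (MvPolynomial.aeval_X y i))

/-- Clearing denominators replaces the generated field by the generated ring; the leading
coefficient provides the nonvanishing condition. -/
theorem exists_polynomials_of_isAlgebraic (x : ι → K) (z : K)
    (hz : IsAlgebraic (IntermediateField.adjoin A (Set.range x)) z) :
    ∃ (N : ℕ) (q : Fin (N + 1) → MvPolynomial ι A),
      MvPolynomial.aeval x (q (Fin.last N)) ≠ 0 ∧
        ∑ j : Fin (N + 1), MvPolynomial.aeval x (q j) * z ^ (j : ℕ) = 0 := by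
  open scoped IntermediateField.algebraAdjoinAdjoin in
  have h1 : IsAlgebraic (Algebra.adjoin A (Set.range x)) z :=
    (IsFractionRing.isAlgebraic_iff _ (IntermediateField.adjoin A (Set.range x)) K).2 hz
  obtain ⟨p, hp, hpz⟩ := h1
  have hq : ∀ j, ∃ q : MvPolynomial ι A, MvPolynomial.aeval x q = (p.coeff j : K) := fun j => by
    have h2 : ∀ z ∈ Algebra.adjoin A (Set.range x), ∃ q, MvPolynomial.aeval x q = z := fun z hz => by
      rw [Algebra.adjoin_range_eq_range_aeval] at hz
      exact hz
    exact h2 _ (p.coeff j).2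
  choose q hq using hq
  refine ⟨p.natDegree, fun j => q j, ?_, ?_⟩
  · dsimp only
    rw [Fin.val_last, hq]
    intro h0
    exact hp (Polynomial.leadingCoeff_eq_zero.1 (Subtype.ext h0))
  · rw [Polynomial.aeval_eq_sum_range, ← Fin.sum_univ_eq_sum_range
      (fun j => p.coeff j • z ^ j)] at hpz
    rw [← hpz]
    exact Finset.sum_congr rfl fun j _ => by
      rw [hq]
      rfl

/-- The primitive element theorem; it is the reason why one quantified variable suffices. -/
theorem exists_mem_adjoin_singleton {k F : Type*} [Field k] [Field F] [Algebra k F] [CharZero k]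
    [Algebra.IsAlgebraic k F] (s : Finset F) :
    ∃ y : F, ∀ x ∈ s, x ∈ IntermediateField.adjoin k ({y} : Set F) := by
  let E := IntermediateField.adjoin k (s : Set F)
  have : FiniteDimensional k E :=
    IntermediateField.finiteDimensional_adjoin fun x _ => Algebra.IsIntegral.isIntegral x
  obtain ⟨y, hy⟩ := Field.exists_primitive_element k E
  refine ⟨y, fun x hx => ?_⟩
  have h1 : (⟨x, IntermediateField.subset_adjoin _ _ hx⟩ : E) ∈
      IntermediateField.adjoin k ({y} : Set E) := hy ▸ IntermediateField.mem_top
  have h2 : E.val ⟨x, IntermediateField.subset_adjoin _ _ hx⟩ ∈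
      (IntermediateField.adjoin k ({y} : Set E)).map E.val := ⟨_, h1, rfl⟩
  rw [IntermediateField.adjoin_map, Set.image_singleton] at h2
  exact h2

end FieldGeneration

/-- Compactness for `𝒟`-closed fields. -/
theorem exists_isDClosed_realize {α : Type w} (Γ : Set ((opLang A m).Formula α))
    (h : ∀ Γ₀ : Finset ((opLang A m).Formula α), (Γ₀ : Set _) ⊆ Γ →
      ∃ (K : DField.{u, v, max u w} S) (_ : K.IsDClosed) (x : α → K), ∀ φ ∈ Γ₀, φ.Realize x) :
    ∃ (K : DField.{u, v, max u w} S) (_ : K.IsDClosed) (x : α → K), ∀ φ ∈ Γ, φ.Realize x := by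
  obtain ⟨M, _, hM, _, x, hx⟩ := exists_model_realize.{u, 0, w} (DCF0 S) Γ fun Γ₀ hΓ₀ => by
    obtain ⟨K, hK, x, hx⟩ := h Γ₀ hΓ₀
    exact ⟨K, inferInstance, hK, ⟨0⟩, x, hx⟩
  obtain ⟨K, ⟨e⟩⟩ := exists_dField_of_model hM
  refine ⟨K, StrongHomClass.theory_model (F := M ≃[opLang A m] K) e, fun a => e (x a), fun φ hφ => ?_⟩
  exact (StrongHomClass.realize_formula e φ).2 (hx φ hφ)

/-- If every finite list of literals true at `X` is compatible with `φ` then the full quantifier-free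
type of `X` is compatible with `φ`. -/
theorem exists_isDClosed_aeval_iff {ι β : Type} (T : (algLang A).Formula ι → (opLang A m).Formula β)
    (ev : ∀ K : DField.{u, v, u} S, (β → K) → ι → K)
    (hT : ∀ K : DField.{u, v, u} S, K.IsDClosed → ∀ χ x, (T χ).Realize x ↔ χ.Realize (ev K x))
    (φ : (opLang A m).Formula β) (K : DField.{u, v, u} S) (X : ι → K)
    (H : ∀ c : List ((algLang A).Formula ι), (∀ χ ∈ c, IsLiteral χ) → (∀ χ ∈ c, χ.Realize X) →
      ∃ (L : DField.{u, v, u} S) (_ : L.IsDClosed) (x : β → L), φ.Realize x ∧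
        ∀ χ ∈ c, χ.Realize (ev L x)) :
    ∃ (L : DField.{u, v, u} S) (_ : L.IsDClosed) (x : β → L), φ.Realize x ∧
      ∀ p : MvPolynomial ι A, MvPolynomial.aeval X p = 0 ↔ MvPolynomial.aeval (ev L x) p = 0 := by
  classical
  choose s hs using exists_term_realize_eq_aeval.{u, v, u} (α := ι) S
  let ℓ : MvPolynomial ι A → (algLang A).Formula ι := fun p =>
    if MvPolynomial.aeval X p = 0 then Term.equal (s p) zeroTerm
    else (Term.equal (s p) zeroTerm).not
  have hlit : ∀ p, IsLiteral (ℓ p) := fun p => by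
    have h1 : BoundedFormula.IsAtomic (Term.equal (s p) zeroTerm : (algLang A).Formula ι) :=
      BoundedFormula.IsAtomic.equal _ _
    by_cases h : MvPolynomial.aeval X p = 0
    · rw [show ℓ p = _ from if_pos h]
      exact Or.inl h1
    · rw [show ℓ p = _ from if_neg h]
      exact Or.inr ⟨_, h1, rfl⟩
  have hreal : ∀ (L : DField.{u, v, u} S) (Y : ι → L) p, (ℓ p).Realize Y ↔
      (MvPolynomial.aeval X p = 0 ↔ MvPolynomial.aeval Y p = 0) := fun L Y p => by
    have h1 : (Term.equal (s p) zeroTerm : (algLang A).Formula ι).Realize Y ↔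
        MvPolynomial.aeval Y p = 0 := by
      rw [Formula.realize_equal, hs]
      rfl
    by_cases h : MvPolynomial.aeval X p = 0
    · rw [show ℓ p = _ from if_pos h, h1]
      simp [h]
    · rw [show ℓ p = _ from if_neg h, Formula.realize_not, h1]
      simp [h]
  obtain ⟨L, hL, x, hx⟩ := exists_isDClosed_realize.{u, v, 0} (S := S)
    (insert φ (Set.range fun p => T (ℓ p))) fun Γ₀ hΓ₀ => by
      -- Different polynomials may give the same formula, so a choice of preimages converts the
      -- finite set of formulas into a finite list of literals.
      obtain ⟨g, hg⟩ : ∃ g : (opLang A m).Formula β → MvPolynomial ι A,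
          ∀ p, T (ℓ (g (T (ℓ p)))) = T (ℓ p) := by
        refine ⟨fun ψ => if h : ∃ p, T (ℓ p) = ψ then h.choose else 0, fun p => ?_⟩
        have h : ∃ p', T (ℓ p') = T (ℓ p) := ⟨p, rfl⟩
        dsimp only
        rw [dif_pos h]
        exact h.choose_spec
      obtain ⟨L, hL, x, hφ, hx⟩ := H (Γ₀.toList.map fun ψ => ℓ (g ψ))
        (fun χ hχ => by
          obtain ⟨ψ, -, rfl⟩ := List.mem_map.1 hχ
          exact hlit _)
        (fun χ hχ => by
          obtain ⟨ψ, -, rfl⟩ := List.mem_map.1 hχ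
          exact (hreal K X _).2 Iff.rfl)
      refine ⟨L, hL, x, fun ψ hψ => ?_⟩
      obtain rfl | ⟨p, rfl⟩ := hΓ₀ hψ
      · exact hφ
      · dsimp only at hψ ⊢
        rw [← hg, hT L hL]
        exact hx _ (List.mem_map.2 ⟨_, Finset.mem_toList.2 hψ, rfl⟩)
  refine ⟨L, hL, x, hx _ (Set.mem_insert _ _), fun p => ?_⟩
  rw [← hreal, ← hT L hL]
  exact hx _ (Set.mem_insert_of_mem _ ⟨p, rfl⟩)

end FreeOp

/-! ### Partial homomorphisms compatible with the associated endomorphisms -/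

namespace FreeOp

open FirstOrder FirstOrder.Language

variable {A : Type u} [Field A] {D : Type v} [CommRing D] [Algebra A D] {m t : ℕ}
  {S : OperatorData A D m} (P : LocalDecomposition S t)

/-- `f` respects, on `s`, the `A`-algebra operations and the associated endomorphisms, and respects
the operators on the tuple `τ`. -/
structure IsPartialHom {F L : DField.{u, v, w} S} {n : ℕ} (τ : XVar m t n → F) (s : Set F)
    (f : F → L) : Prop where
  one : f 1 = 1
  add : ∀ x ∈ s, ∀ y ∈ s, f (x + y) = f x + f y
  mul : ∀ x ∈ s, ∀ y ∈ s, f (x * y) = f x * f y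
  smul : ∀ (r : A), ∀ x ∈ s, f (r • x) = r • f x
  sigma : ∀ j, ∀ x ∈ s, f (F.sigma P j x) = L.sigma P j (f x)
  op : ∀ k θ i, f (τ (Sum.inl k :: θ, i)) = L.op k (f (τ (θ, i)))

variable {P} in
theorem IsPartialHom.mono {F L : DField.{u, v, w} S} {n : ℕ} {τ : XVar m t n → F} {s s' : Set F}
    {f : F → L} (h : IsPartialHom P τ s f) (hs : s' ⊆ s) : IsPartialHom P τ s' f :=
  ⟨h.one, fun x hx y hy => h.add x (hs hx) y (hs hy), fun x hx y hy => h.mul x (hs hx) y (hs hy),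
    fun r x hx => h.smul r x (hs hx), fun j x hx => h.sigma j x (hs hx), h.op⟩

/-- The formulas expressing `IsPartialHom`. -/
inductive IsDiagram (F : DField.{u, v, w} S) {n : ℕ} (τ : XVar m t n → F) :
    (opLang A m).Formula F → Prop
  | one : IsDiagram F τ (Term.equal (Term.var 1) dOne)
  | add (x y : F) : IsDiagram F τ
      (Term.equal (Term.var (x + y)) (dAdd (Term.var x) (Term.var y)))
  | mul (x y : F) : IsDiagram F τ
      (Term.equal (Term.var (x * y)) (dMul (Term.var x) (Term.var y)))
  | smul (r : A) (x : F) : IsDiagram F τ (Term.equal (Term.var (r • x)) (dSmul r (Term.var x)))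
  | sigma (j : Fin (t + 1)) (x : F) : IsDiagram F τ
      (Term.equal (Term.var (F.sigma P j x)) (dSigma P j (Term.var x)))
  | op (k : Fin m) (θ : LocalDecomposition.Word m t) (i : Fin n) : IsDiagram F τ
      (Term.equal (Term.var (τ (Sum.inl k :: θ, i))) (dOp k (Term.var (τ (θ, i)))))

-- Each condition involves at most two elements apart from the tuple `τ`, which is what lets
-- compactness run over finite subsets of `F`.
variable {P} in
theorem IsDiagram.exists_finset {F : DField.{u, v, w} S} {n : ℕ} {τ : XVar m t n → F}
    {φ : (opLang A m).Formula F} (h : IsDiagram P F τ φ) :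
    ∃ s : Finset F, ∀ (L : DField.{u, v, w} S) (f : F → L), IsPartialHom P τ s f →
      φ.Realize f := by
  classical
  cases h with
  | one => exact ⟨∅, fun L f h => by
      rw [Formula.realize_equal, L.compatible.realize_one]; exact h.one⟩
  | add x y => exact ⟨{x, y}, fun L f h => by
      rw [Formula.realize_equal, L.compatible.realize_add]
      exact h.add x (by simp) y (by simp)⟩
  | mul x y => exact ⟨{x, y}, fun L f h => by
      rw [Formula.realize_equal, L.compatible.realize_mul]
      exact h.mul x (by simp) y (by simp)⟩
  | smul r x => exact ⟨{x}, fun L f h => by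
      rw [Formula.realize_equal, L.compatible.realize_smul]
      exact h.smul r x (by simp)⟩
  | sigma j x => exact ⟨{x}, fun L f h => by
      rw [Formula.realize_equal, realize_sigma]
      exact h.sigma j x (by simp)⟩
  | op k θ i => exact ⟨∅, fun L f h => by
      rw [Formula.realize_equal, L.compatible.realize_op]
      exact h.op k θ i⟩

theorem isPartialHom_univ {F L : DField.{u, v, w} S} {n : ℕ} {τ : XVar m t n → F} {f : F → L}
    (h : ∀ φ, IsDiagram P F τ φ → φ.Realize f) : IsPartialHom P τ Set.univ f where
  one := by
    have := h _ .one
    rwa [Formula.realize_equal, L.compatible.realize_one] at this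
  add x _ y _ := by
    have := h _ (.add x y)
    rwa [Formula.realize_equal, L.compatible.realize_add] at this
  mul x _ y _ := by
    have := h _ (.mul x y)
    rwa [Formula.realize_equal, L.compatible.realize_mul] at this
  smul r x _ := by
    have := h _ (.smul r x)
    rwa [Formula.realize_equal, L.compatible.realize_smul] at this
  sigma j x _ := by
    have := h _ (.sigma j x)
    rwa [Formula.realize_equal, realize_sigma] at this
  op k θ i := by
    have := h _ (.op k θ i)
    rwa [Formula.realize_equal, L.compatible.realize_op] at this

/-- Compactness for partial homomorphisms. -/
theorem exists_isPartialHom_univ (F : DField.{u, v, u} S) {n : ℕ} (τ : XVar m t n → F)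
    (φ : (opLang A m).Formula F)
    (H : ∀ s : Finset F, ∃ (L : DField.{u, v, u} S) (_ : L.IsDClosed) (f : F → L), φ.Realize f ∧
      IsPartialHom P τ s f) :
    ∃ (L : DField.{u, v, u} S) (_ : L.IsDClosed) (f : F → L), φ.Realize f ∧
      IsPartialHom P τ Set.univ f := by
  classical
  obtain ⟨L, hL, f, hf⟩ := exists_isDClosed_realize.{u, v, u} (S := S)
    (insert φ {ψ | IsDiagram P F τ ψ}) fun Γ₀ hΓ₀ => by
      have h1 : ∀ ψ : (opLang A m).Formula F, ∃ s : Finset F, IsDiagram P F τ ψ →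
          ∀ (L : DField.{u, v, u} S) (f : F → L), IsPartialHom P τ s f → ψ.Realize f := fun ψ => by
        by_cases h : IsDiagram P F τ ψ
        · obtain ⟨s, hs⟩ := h.exists_finset
          exact ⟨s, fun _ => hs⟩
        · exact ⟨∅, fun h' => absurd h' h⟩
      choose s hs using h1
      obtain ⟨L, hL, f, hφ, hf⟩ := H (Γ₀.biUnion s)
      refine ⟨L, hL, f, fun ψ hψ => ?_⟩
      obtain rfl | h := hΓ₀ hψ
      · exact hφ
      · exact hs ψ h L f (hf.mono fun x hx => Finset.mem_biUnion.2 ⟨ψ, hψ, hx⟩)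
  exact ⟨L, hL, f, hf _ (Set.mem_insert _ _), isPartialHom_univ P fun ψ hψ =>
    hf _ (Set.mem_insert_of_mem _ hψ)⟩

variable {P} in
theorem IsPartialHom.exists_algHom {F L : DField.{u, v, w} S} {n : ℕ} {τ : XVar m t n → F}
    {f : F → L} (h : IsPartialHom P τ Set.univ f) : ∃ g : F →ₐ[A] L, ∀ x, g x = f x := by
  have h0 : f 0 = 0 := by
    have := h.smul 0 0 trivial
    rwa [zero_smul, zero_smul] at this
  exact ⟨{ toFun := f
           map_one' := h.one
           map_zero' := h0
           map_add' := fun x y => h.add x trivial y trivial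
           map_mul' := fun x y => h.mul x trivial y trivial
           commutes' := fun r => by
            rw [Algebra.algebraMap_eq_smul_one, h.smul r 1 trivial, h.one,
              Algebra.algebraMap_eq_smul_one] }, fun _ => rfl⟩

/-- Induction on the word: the operators are respected on `τ` by assumption, and inverses of σⱼ are
recovered from compatibility with σⱼ and its injectivity on `L`. -/
theorem IsPartialHom.map_thetaTuple {F L : DField.{u, v, w} S} {n : ℕ} {τ : XVar m t n → F}
    {s : Set F} {f : F → L} (h : IsPartialHom P τ s f) (hL : L.IsInversive P) (hs : ∀ x, τ x ∈ s)
    (hτ : ∀ j θ i, F.sigma P (Fin.succ j) (τ (Sum.inr j :: θ, i)) = τ (θ, i)) (x : XVar m t n) :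
    f (τ x) = thetaTuple P L (fun i => f (τ ([], i))) x := by
  obtain ⟨θ, i⟩ := x
  induction θ with
  | nil => rfl
  | cons l θ ih =>
    rcases l with k | j
    · rw [h.op, ih, thetaTuple_op]
    · apply L.sigma_injective P j.succ
      rw [← h.sigma _ _ (hs _), hτ, ih, sigma_thetaTuple P L hL]

/-- Hence σⱼ needs no letter of its own in Θ: it maps Θa into the `A`-linear span of Θa. -/
theorem assocEnd_thetaTuple (K : DField.{u, v, w} S) {n : ℕ} (a : Fin n → K) (j : Fin (t + 1))
    (θ : LocalDecomposition.Word m t) (i : Fin n) :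
    K.sigma P j (thetaTuple P K a (θ, i)) =
      P.projHom j (S.basis 0) • thetaTuple P K a (θ, i) +
        ∑ k, P.projHom j (S.basis k.succ) • thetaTuple P K a (Sum.inl k :: θ, i) := by
  rw [← DField.assocEnd_eq_sigma, P.assocEnd_apply]
  rfl

/-- A specialization of `Θ a, σ y` gives a partial homomorphism on the field generated by `Θ a`
and `y`. -/
theorem exists_isPartialHom {K L : DField.{u, v, u} S} {n : ℕ} (a : Fin n → K) (y : K)
    (b : Fin n → L) (d : L)
    (h : ∀ p : MvPolynomial (XYVar m t n) A,
      MvPolynomial.aeval (Sum.elim (thetaTuple P K a) (sigmaTuple P K y)) p = 0 ↔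
        MvPolynomial.aeval (Sum.elim (thetaTuple P L b) (sigmaTuple P L d)) p = 0) :
    ∃ f : K → L, IsPartialHom P (thetaTuple P K a)
      (IntermediateField.adjoin A (Set.range (thetaTuple P K a) ∪ {y})) f ∧
      ∀ x, f (thetaTuple P K a x) = thetaTuple P L b x := by
  classical
  set X := Sum.elim (thetaTuple P K a) (sigmaTuple P K y) with hX
  set Y := Sum.elim (thetaTuple P L b) (sigmaTuple P L d) with hY
  set E := IntermediateField.adjoin A (Set.range X) with hE
  set E' := IntermediateField.adjoin A (Set.range (thetaTuple P K a) ∪ {y}) with hE'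
  have hXE : ∀ i, X i ∈ E := fun i => IntermediateField.subset_adjoin _ _ ⟨i, rfl⟩
  obtain ⟨g, hg⟩ : ∃ g : E →ₐ[A] L, ∀ i, g ⟨X i, hXE i⟩ = Y i :=
    exists_algHom_of_aeval_eq_zero_iff X Y h
  have hy0 : X (Sum.inr 0) = y := P.assocEnd_zero _ y
  have hd0 : Y (Sum.inr 0) = d := P.assocEnd_zero _ d
  have hle : E' ≤ E := by
    rw [hE', IntermediateField.adjoin_le_iff]
    rintro _ (⟨x, rfl⟩ | rfl)
    · exact hXE (Sum.inl x)
    · exact hy0 ▸ hXE (Sum.inr 0)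
  -- The value 0 outside `E` plays no role.
  let f : K → L := fun z => if hz : z ∈ E then g ⟨z, hz⟩ else 0
  have hf : ∀ z (hz : z ∈ E), f z = g ⟨z, hz⟩ := fun z hz => dif_pos hz
  have hfX : ∀ i, f (X i) = Y i := fun i => (hf _ (hXE i)).trans (hg i)
  have hfθ : ∀ x, f (thetaTuple P K a x) = thetaTuple P L b x := fun x => hfX (Sum.inl x)
  have hadd : ∀ z ∈ E, ∀ z' ∈ E, f (z + z') = f z + f z' := fun z hz z' hz' => by
    rw [hf _ (add_mem hz hz'), hf _ hz, hf _ hz', ← map_add]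
    rfl
  have hmul : ∀ z ∈ E, ∀ z' ∈ E, f (z * z') = f z * f z' := fun z hz z' hz' => by
    rw [hf _ (mul_mem hz hz'), hf _ hz, hf _ hz', ← map_mul]
    rfl
  have hinv : ∀ z ∈ E, f z⁻¹ = (f z)⁻¹ := fun z hz => by
    rw [hf _ (inv_mem hz), hf _ hz, ← map_inv₀]
    rfl
  have hsmul : ∀ (r : A), ∀ z ∈ E, f (r • z) = r • f z := fun r z hz => by
    rw [hf _ (E.smul_mem hz), hf _ hz, ← map_smul]
    rfl
  have hone : f 1 = 1 := by
    rw [hf _ (one_mem E), ← map_one g]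
    rfl
  have hzero : f 0 = 0 := by
    rw [hf _ (zero_mem E), ← map_zero g]
    rfl
  have hsum : ∀ (s : Finset (Fin m)) (z : Fin m → K), (∀ k, z k ∈ E) →
      f (∑ k ∈ s, z k) = ∑ k ∈ s, f (z k) := fun s z hz => by
    induction s using Finset.induction_on with
    | empty => simpa using hzero
    | insert k s hk ih =>
      rw [Finset.sum_insert hk, Finset.sum_insert hk, hadd _ (hz k) _ (sum_mem fun k _ => hz k), ih]
  -- `E'` need not be closed under σⱼ, but σⱼ maps it into `E`, where `f` is still multiplicative
  -- and additive. This is why σ₁y, …, σ_t y are included among the generators.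
  have hσ : ∀ j, ∀ z ∈ E', K.sigma P j z ∈ E ∧ f (K.sigma P j z) = L.sigma P j (f z) := by
    intro j z hz
    induction hz using IntermediateField.adjoin_induction with
    | mem z hz =>
      obtain ⟨⟨θ, i⟩, rfl⟩ | hzy := hz
      · have hθ : ∀ x, thetaTuple P K a x ∈ E := fun x => hXE (Sum.inl x)
        rw [assocEnd_thetaTuple]
        refine ⟨add_mem (E.smul_mem (hθ _)) (sum_mem fun k _ => E.smul_mem (hθ _)), ?_⟩
        rw [hadd _ (E.smul_mem (hθ _)) _ (sum_mem fun k _ => E.smul_mem (hθ _)),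
          hsmul _ _ (hθ _), hsum _ _ (fun k => E.smul_mem (hθ _)), hfθ, assocEnd_thetaTuple]
        simp only [hsmul _ _ (hθ _), hfθ]
      · rw [show z = y from hzy]
        have h1 : K.sigma P j y = X (Sum.inr j) := (K.assocEnd_eq_sigma P j y).symm
        have h2 : L.sigma P j d = Y (Sum.inr j) := (L.assocEnd_eq_sigma P j d).symm
        have h3 : f y = d := by
          rw [← hy0, hfX, hd0]
        rw [h3, h1, h2]
        exact ⟨hXE _, hfX _⟩
    | algebraMap r =>
      have h1 : f (algebraMap A K r) = algebraMap A L r := by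
        rw [Algebra.algebraMap_eq_smul_one, hsmul _ _ (one_mem E), hone,
          Algebra.algebraMap_eq_smul_one]
      rw [AlgHom.commutes, h1, AlgHom.commutes]
      exact ⟨E.algebraMap_mem r, rfl⟩
    | add z z' hz hz' h h' =>
      rw [map_add, hadd _ h.1 _ h'.1, hadd _ (hle hz) _ (hle hz'), map_add, h.2, h'.2]
      exact ⟨add_mem h.1 h'.1, rfl⟩
    | mul z z' hz hz' h h' =>
      rw [map_mul, hmul _ h.1 _ h'.1, hmul _ (hle hz) _ (hle hz'), map_mul, h.2, h'.2]
      exact ⟨mul_mem h.1 h'.1, rfl⟩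
    | inv z hz h =>
      rw [map_inv₀, hinv _ h.1, hinv _ (hle hz), map_inv₀, h.2]
      exact ⟨inv_mem h.1, rfl⟩
  refine ⟨f, ⟨hone, fun z hz z' hz' => hadd z (hle hz) z' (hle hz'),
    fun z hz z' hz' => hmul z (hle hz) z' (hle hz'), fun r z hz => hsmul r z (hle hz),
    fun j z hz => (hσ j z hz).2, fun k θ i => ?_⟩, hfθ⟩
  rw [hfθ, hfθ, thetaTuple_op]

end FreeOp

/-! ### Quantifier reduction -/

namespace FreeOp

open FirstOrder FirstOrder.Language

variable {A : Type u} [Field A] {D : Type v} [CommRing D] [Algebra A D] {m t : ℕ}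
  {S : OperatorData A D m} (P : LocalDecomposition S t)

theorem IsPartialHom.comp {F K L : DField.{u, v, w} S} {n : ℕ} {τ : XVar m t n → F} {s : Set F}
    {s' : Set K} {f : K → L} {i : F →ₐ[A] K} (hi : DField.IsHom i)
    (h : IsPartialHom P (fun x => i (τ x)) s' f) (hs : ∀ x ∈ s, i x ∈ s') :
    IsPartialHom P τ s fun x => f (i x) where
  one := by rw [map_one, h.one]
  add x hx y hy := by rw [map_add, h.add _ (hs x hx) _ (hs y hy)]
  mul x hx y hy := by rw [map_mul, h.mul _ (hs x hx) _ (hs y hy)]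
  smul r x hx := by rw [map_smul, h.smul _ _ (hs x hx)]
  sigma j x hx := by rw [hi.sigma, h.sigma _ _ (hs x hx)]
  op := h.op

theorem exists_hull_thetaField {K : DField.{u, v, u} S} (hK : K.IsDClosed) {n : ℕ} (a : Fin n → K) :
    ∃ (F : DField.{u, v, u} S) (i : F →ₐ[A] K) (c : thetaField P K a →ₐ[A] F), DField.IsHom i ∧
      IsAlgClosed F ∧ F.IsInversive P ∧ (∀ x, i (c x) = x) ∧
      ∀ x : F, IsAlgebraic (thetaField P K a) (i x) := by
  have := hK.charZero
  have := hK.isAlgClosed P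
  have hinv := hK.isInversive P
  exact exists_hull P K hinv (thetaField P K a) (fun x => thetaField_exp P K a x x.2)
    (thetaField_exists_sigma P K hinv a)

theorem isAlgebraic_of_comp_eq {k F K : Type*} [Field k] [Field F] [Field K] [Algebra k F]
    [Algebra k K] (i : F →+* K) (hi : ∀ x, i (algebraMap k F x) = algebraMap k K x)
    (h : ∀ x, IsAlgebraic k (i x)) : Algebra.IsAlgebraic k F :=
  ⟨fun x => (h x).of_ringHom_of_comp_eq (RingHom.id k) i Function.surjective_id i.injective
    (RingHom.ext fun x => (hi x).symm)⟩

/-- Elements of the hull of `a` lie in the field generated by `Θ a` and a single element. -/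
theorem exists_generator {K F : DField.{u, v, u} S} [CharZero K] {n : ℕ} (a : Fin n → K)
    (i : F →ₐ[A] K) (c : thetaField P K a →ₐ[A] F) (hc : ∀ x, i (c x) = x)
    (halg : ∀ x : F, IsAlgebraic (thetaField P K a) (i x)) (s : Finset F) :
    ∃ y : F, ∀ x ∈ s,
      i x ∈ IntermediateField.adjoin A (Set.range (thetaTuple P K a) ∪ {i y}) := by
  let _ : Algebra (thetaField P K a) F := c.toRingHom.toAlgebra
  have : CharZero (thetaField P K a) := (algebraMap (thetaField P K a) K).charZero
  have : Algebra.IsAlgebraic (thetaField P K a) F :=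
    isAlgebraic_of_comp_eq (i : F →+* K) (fun x => hc x) halg
  obtain ⟨y, hy⟩ := exists_mem_adjoin_singleton (k := thetaField P K a) s
  refine ⟨y, fun x hx => ?_⟩
  have hxy := hy x hx
  clear hx
  induction hxy using IntermediateField.adjoin_induction with
  | mem x hx =>
    rw [show x = y from hx]
    exact IntermediateField.subset_adjoin _ _ (Or.inr rfl)
  | algebraMap x =>
    have h1 : i (algebraMap (thetaField P K a) F x) = x := hc x
    rw [h1]
    exact IntermediateField.adjoin.mono _ _ _ Set.subset_union_left x.2
  | add x y _ _ hx hy =>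
    rw [map_add]
    exact add_mem hx hy
  | mul x y _ _ hx hy =>
    rw [map_mul]
    exact mul_mem hx hy
  | inv x _ hx =>
    rw [map_inv₀]
    exact inv_mem hx

theorem exists_algebraic_literals {K : DField.{u, v, u} S} {n : ℕ} (a : Fin n → K) (y : K)
    (hy : IsAlgebraic (thetaField P K a) y) :
    ∃ (N : ℕ) (p : Fin (N + 1) → (algLang A).Term (XVar m t n)),
      (Term.equal ((p (Fin.last N)).relabel Sum.inl : (algLang A).Term (XYVar m t n))
        zeroTerm).not.Realize (Sum.elim (thetaTuple P K a) (sigmaTuple P K y)) ∧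
      (Term.equal (polyTerm (fun j => (p j).relabel Sum.inl) (Term.var (Sum.inr 0)) :
        (algLang A).Term (XYVar m t n)) zeroTerm).Realize
          (Sum.elim (thetaTuple P K a) (sigmaTuple P K y)) := by
  obtain ⟨N, q, hq, hqy⟩ := exists_polynomials_of_isAlgebraic _ _ hy
  choose s hs using exists_term_realize_eq_aeval.{u, v, u} (α := XVar m t n) S
  refine ⟨N, fun j => s (q j), ?_, ?_⟩
  · rw [Formula.realize_not, Formula.realize_equal, Term.realize_relabel, Sum.elim_comp_inl, hs]
    exact hq
  · rw [Formula.realize_equal, realize_polyTerm]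
    simp only [Term.realize_relabel, Sum.elim_comp_inl, hs]
    refine Eq.trans (Finset.sum_congr rfl fun j _ => ?_) hqy
    rw [Term.realize_var, Sum.elim_inr, sigmaTuple, P.assocEnd_zero]

/-- Suppose no conjunction works. For a finite subset of the hull choose a generator y; the literals
true at (Θa, y, σy), even with the algebraicity of y, never imply φ, so by compactness the whole
type of this tuple is realized at some (Θb, d, σd) where φ(b) fails. This yields a partial
homomorphism on the finite subset. A second compactness argument gives an embedding of the entire
hull respecting Θ and all σⱼ, with φ failing at the image of a, against `realize_iff_of_hull`. -/
theorem exists_conjunct {n : ℕ} (φ : (opLang A m).Formula (Fin n)) {K : DField.{u, v, u} S}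
    (hK : K.IsDClosed) (a : Fin n → K) (hφ : φ.Realize a) :
    ∃ c : List ((algLang A).Formula (XYVar m t n)), IsAlgebraicDNF [c] ∧
      (∃ y, ∀ χ ∈ c, χ.Realize (Sum.elim (thetaTuple P K a) (sigmaTuple P K y))) ∧
      ∀ L : DField.{u, v, u} S, L.IsDClosed → ∀ (b : Fin n → L) (d : L),
        (∀ χ ∈ c, χ.Realize (Sum.elim (thetaTuple P L b) (sigmaTuple P L d))) → φ.Realize b := by
  by_contra H
  have := hK.charZero
  obtain ⟨F, i, c, hi, hF, hinv, hc, halg⟩ := exists_hull_thetaField P hK a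
  let τ : XVar m t n → F := fun x => c ⟨_, thetaTuple_mem P K a x⟩
  have hτ : ∀ x, i (τ x) = thetaTuple P K a x := fun x => hc _
  obtain ⟨L, hL, f, hφf, hf⟩ := exists_isPartialHom_univ P F τ
    (φ.relabel fun x => τ ([], x) : (opLang A m).Formula F).not fun s => by
      obtain ⟨y, hy⟩ := exists_generator P a i c hc halg s
      obtain ⟨N, p, hp, hpy⟩ := exists_algebraic_literals P a (i y) (halg y)
      obtain ⟨L, hL, x, hφx, hx⟩ := exists_isDClosed_aeval_iff (translate P)
        (fun K x => Sum.elim (thetaTuple P K fun i => x (Sum.inl i))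
          (sigmaTuple P K (x (Sum.inr 0))))
        (fun K hK χ x => realize_translate P K (hK.isInversive P) χ x)
        (φ.relabel Sum.inl : (opLang A m).Formula (Fin n ⊕ Fin 1)).not K
        (Sum.elim (thetaTuple P K a) (sigmaTuple P K (i y))) fun l hl hlX => by
          by_contra h'
          refine H ⟨(Term.equal ((p (Fin.last N)).relabel Sum.inl) zeroTerm).not ::
            Term.equal (polyTerm (fun j => (p j).relabel Sum.inl) (Term.var (Sum.inr 0)))
              zeroTerm :: l, ?_, ⟨i y, ?_⟩, fun L hL b d hbd => ?_⟩
          · intro l' hl'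
            rw [List.mem_singleton.1 hl']
            refine ⟨?_, N, p, by simp, by simp⟩
            simp only [List.forall_mem_cons]
            exact ⟨Or.inr ⟨_, BoundedFormula.IsAtomic.equal _ _, rfl⟩,
              Or.inl (BoundedFormula.IsAtomic.equal _ _), hl⟩
          · simp only [List.forall_mem_cons]
            exact ⟨hp, hpy, hlX⟩
          · by_contra hφb
            refine h' ⟨L, hL, Sum.elim b fun _ => d, ?_, fun χ hχ => ?_⟩
            · rw [Formula.realize_not, Formula.realize_relabel, Sum.elim_comp_inl]
              exact hφb
            · exact hbd χ (List.mem_cons_of_mem _ (List.mem_cons_of_mem _ hχ))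
      obtain ⟨f, hf, hfθ⟩ := exists_isPartialHom P a (i y) _ _ hx
      refine ⟨L, hL, fun x => f (i x), ?_, IsPartialHom.comp P hi
        ((funext hτ : (fun x => i (τ x)) = _) ▸ hf) hy⟩
      rw [Formula.realize_not, Formula.realize_relabel] at hφx ⊢
      convert hφx using 2
      funext k
      refine (congrArg f (hτ _)).trans (hfθ _)
  rw [Formula.realize_not, Formula.realize_relabel] at hφf
  obtain ⟨g, hg⟩ := hf.exists_algHom
  refine hφf ((realize_iff_of_hull P hK hL a (fun x => f (τ ([], x))) c hi hF hinv hc halg g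
    (fun j x => ?_) (fun x => ?_) φ).1 hφ)
  · rw [hg, hg, hf.sigma _ _ trivial]
  · rw [hg]
    refine hf.map_thetaTuple P (hL.isInversive P) (fun _ => trivial) (fun j θ k => ?_) x
    have hinj : Function.Injective i := i.injective
    apply hinj
    rw [hi.sigma, hτ, hτ, sigma_thetaTuple P K (hK.isInversive P)]

/-- With trivial σⱼ, any embedding of A(Θa) into the algebraically closed `L` extends to the hull,
and the extension commutes with the σⱼ for free; no auxiliary y is required. -/
theorem exists_conjunct_of_assocEnd_eq (h : ∀ K : DField.{u, v, u} S, K.IsDClosed →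
      ∀ (i : Fin (t + 1)) (r : K), P.assocEnd K.op i r = r)
    {n : ℕ} (φ : (opLang A m).Formula (Fin n)) {K : DField.{u, v, u} S}
    (hK : K.IsDClosed) (a : Fin n → K) (hφ : φ.Realize a) :
    ∃ c : List ((algLang A).Formula (XVar m t n)), (∀ χ ∈ c, IsLiteral χ) ∧
      (∀ χ ∈ c, χ.Realize (thetaTuple P K a)) ∧
      ∀ L : DField.{u, v, u} S, L.IsDClosed → ∀ b : Fin n → L,
        (∀ χ ∈ c, χ.Realize (thetaTuple P L b)) → φ.Realize b := by
  by_contra H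
  obtain ⟨F, i, c, hi, hF, hinv, hc, halg⟩ := exists_hull_thetaField P hK a
  obtain ⟨L, hL, b, hφb, hb⟩ := exists_isDClosed_aeval_iff translateQF
    (fun K x => thetaTuple P K x)
    (fun K hK χ x => realize_translateQF P K (h K hK) χ x) φ.not K (thetaTuple P K a)
    fun l hl hlX => by
      by_contra h'
      refine H ⟨l, hl, hlX, fun L hL b hb => ?_⟩
      by_contra hφb
      exact h' ⟨L, hL, b, Formula.realize_not.2 hφb, hb⟩
  obtain ⟨g₀, hg₀⟩ := exists_algHom_of_aeval_eq_zero_iff _ _ hb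
  have hσ : ∀ (K : DField.{u, v, u} S), K.IsDClosed → ∀ j x, K.sigma P j x = x :=
    fun K hK j x => (K.assocEnd_eq_sigma P j x).symm.trans (h K hK j x)
  obtain ⟨g, hg⟩ : ∃ g : F →+* L, ∀ x, g (c x) = g₀ x := by
    let _ : Algebra (thetaField P K a) F := c.toRingHom.toAlgebra
    let _ : Algebra (thetaField P K a) L := g₀.toRingHom.toAlgebra
    have : Algebra.IsAlgebraic (thetaField P K a) F :=
      isAlgebraic_of_comp_eq (i : F →+* K) (fun x => hc x) halg
    have := hL.isAlgClosed P
    let g : F →ₐ[thetaField P K a] L := IsAlgClosed.lift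
    exact ⟨g, g.commutes⟩
  let g' : F →ₐ[A] L := { g with
    commutes' := fun r => by
      have h1 := hg (algebraMap A _ r)
      rw [AlgHom.commutes] at h1
      exact h1.trans (g₀.commutes r) }
  refine Formula.realize_not.1 hφb ((realize_iff_of_hull P hK hL a b c hi hF hinv hc halg g'
    (fun j x => ?_) (fun x => (hg _).trans (hg₀ x)) φ).1 hφ)
  rw [hσ L hL]
  congr 1
  have hinj : Function.Injective i := i.injective
  apply hinj
  rw [hi.sigma, hσ K hK]

/-- If no finite list sufficed, `φ` with the negations of all good `ψ c` would be finitely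
satisfiable, hence satisfiable. -/
theorem exists_finite_cover (S : OperatorData A D m) {n : ℕ} (φ : (opLang A m).Formula (Fin n))
    {κ : Type*} (good : Set κ) (ψ : κ → (opLang A m).Formula (Fin n))
    (h : ∀ K : DField.{u, v, u} S, K.IsDClosed → ∀ a : Fin n → K, φ.Realize a →
      ∃ c ∈ good, (ψ c).Realize a) :
    ∃ C : List κ, (∀ c ∈ C, c ∈ good) ∧
      ∀ K : DField.{u, v, u} S, K.IsDClosed → ∀ a : Fin n → K, φ.Realize a →
        ∃ c ∈ C, (ψ c).Realize a := by
  classical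
  by_contra H
  obtain ⟨K, hK, a, ha⟩ := exists_isDClosed_realize.{u, v, 0} (S := S)
    (insert φ ((fun c => (ψ c).not) '' good)) fun Γ₀ hΓ₀ => by
      have h1 : ((Γ₀.erase φ : Finset _) : Set ((opLang A m).Formula (Fin n))) ⊆
          (fun c => (ψ c).not) '' good := fun χ hχ => by
        have h2 := Finset.mem_erase.1 hχ
        exact (hΓ₀ h2.2).resolve_left h2.1
      obtain ⟨s, hs, hse⟩ := Finset.subset_set_image_iff.1 h1
      by_contra h2
      refine H ⟨s.toList, fun c hc => hs (Finset.mem_toList.1 hc), fun K hK a hφ => ?_⟩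
      by_contra h3
      refine h2 ⟨K, hK, a, fun χ hχ => ?_⟩
      by_cases h4 : χ = φ
      · rwa [h4]
      · have h5 : χ ∈ Γ₀.erase φ := Finset.mem_erase.2 ⟨h4, hχ⟩
        rw [← hse] at h5
        obtain ⟨c, hc, rfl⟩ := Finset.mem_image.1 h5
        exact Formula.realize_not.2 fun h6 => h3 ⟨c, Finset.mem_toList.2 hc, h6⟩
  obtain ⟨c, hc, hca⟩ := h K hK a (ha _ (Set.mem_insert _ _))
  exact Formula.realize_not.1 (ha _ (Set.mem_insert_of_mem _ ⟨c, hc, rfl⟩)) hca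

theorem exists_algebraicDNF {n : ℕ} (φ : (opLang A m).Formula (Fin n)) :
    ∃ C : List (List ((algLang A).Formula (XYVar m t n))), IsAlgebraicDNF C ∧
      ∀ K : DField.{u, v, u} S, K.IsDClosed → ∀ a : Fin n → K,
        φ.Realize a ↔ ∃ y, (dnf C).Realize (Sum.elim (thetaTuple P K a) (sigmaTuple P K y)) := by
  have hreal : ∀ (K : DField.{u, v, u} S), K.IsDClosed → ∀ (a : Fin n → K)
      (c : List ((algLang A).Formula (XYVar m t n))),
      (Formula.iExs (Fin 1) (translate P (dnf [c]))).Realize a ↔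
        ∃ y, ∀ χ ∈ c, χ.Realize (Sum.elim (thetaTuple P K a) (sigmaTuple P K y)) := by
    intro K hK a c
    simp only [Formula.realize_iExs, realize_translate P K (hK.isInversive P), realize_dnf,
      List.mem_singleton, exists_eq_left, Sum.elim_inl, Sum.elim_inr]
    exact ⟨fun ⟨y, hy⟩ => ⟨y 0, hy⟩, fun ⟨y, hy⟩ => ⟨fun _ => y, hy⟩⟩
  obtain ⟨C, hC, hφ⟩ := exists_finite_cover S φ
    {c : List ((algLang A).Formula (XYVar m t n)) | IsAlgebraicDNF [c] ∧
      ∀ L : DField.{u, v, u} S, L.IsDClosed → ∀ (b : Fin n → L) (d : L),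
        (∀ χ ∈ c, χ.Realize (Sum.elim (thetaTuple P L b) (sigmaTuple P L d))) → φ.Realize b}
    (fun c => Formula.iExs (Fin 1) (translate P (dnf [c])))
    (fun K hK a ha => by
      obtain ⟨c, hc, hy, hL⟩ := exists_conjunct P φ hK a ha
      exact ⟨c, ⟨hc, hL⟩, (hreal K hK a c).2 hy⟩)
  refine ⟨C, fun c hc => (hC c hc).1 c (List.mem_singleton.2 rfl), fun K hK a => ⟨fun ha => ?_, ?_⟩⟩
  · obtain ⟨c, hc, h⟩ := hφ K hK a ha
    obtain ⟨y, hy⟩ := (hreal K hK a c).1 h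
    exact ⟨y, (realize_dnf K _ C).2 ⟨c, hc, hy⟩⟩
  · rintro ⟨y, hy⟩
    obtain ⟨c, hc, h⟩ := (realize_dnf K _ C).1 hy
    exact (hC c hc).2 K hK a y h

theorem exists_dnf_of_assocEnd_eq (h : ∀ K : DField.{u, v, u} S, K.IsDClosed →
      ∀ (i : Fin (t + 1)) (r : K), P.assocEnd K.op i r = r)
    {n : ℕ} (φ : (opLang A m).Formula (Fin n)) :
    ∃ ξ : (algLang A).Formula (XVar m t n), ξ.IsQF ∧
      ∀ K : DField.{u, v, u} S, K.IsDClosed → ∀ a : Fin n → K,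
        φ.Realize a ↔ ξ.Realize (thetaTuple P K a) := by
  have hreal : ∀ (K : DField.{u, v, u} S), K.IsDClosed → ∀ (a : Fin n → K)
      (c : List ((algLang A).Formula (XVar m t n))),
      (translateQF (dnf [c])).Realize a ↔ ∀ χ ∈ c, χ.Realize (thetaTuple P K a) := by
    intro K hK a c
    simp only [realize_translateQF P K (h K hK), realize_dnf, List.mem_singleton, exists_eq_left]
  obtain ⟨C, hC, hφ⟩ := exists_finite_cover S φ
    {c : List ((algLang A).Formula (XVar m t n)) | (∀ χ ∈ c, IsLiteral χ) ∧
      ∀ L : DField.{u, v, u} S, L.IsDClosed → ∀ b : Fin n → L,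
        (∀ χ ∈ c, χ.Realize (thetaTuple P L b)) → φ.Realize b}
    (fun c => translateQF (dnf [c]))
    (fun K hK a ha => by
      obtain ⟨c, hc, hy, hL⟩ := exists_conjunct_of_assocEnd_eq P h φ hK a ha
      exact ⟨c, ⟨hc, hL⟩, (hreal K hK a c).2 hy⟩)
  refine ⟨dnf C, isQF_dnf fun c hc => (hC c hc).1, fun K hK a => ⟨fun ha => ?_, fun ha => ?_⟩⟩
  · obtain ⟨c, hc, h⟩ := hφ K hK a ha
    exact (realize_dnf K _ C).2 ⟨c, hc, (hreal K hK a c).1 h⟩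
  · obtain ⟨c, hc, h⟩ := (realize_dnf K _ C).1 ha
    exact (hC c hc).2 K hK a h

/-- Equivalence modulo a theory concerns arbitrary models; `exists_dField_of_model` replaces each by
an isomorphic 𝒟-field. -/
theorem iff_of_isDClosed (S : OperatorData A D m) {n : ℕ} (φ ψ : (opLang A m).Formula (Fin n))
    (h : ∀ K : DField.{u, v, u} S, K.IsDClosed → ∀ a : Fin n → K, φ.Realize a ↔ ψ.Realize a) :
    (DCF0 S).Iff φ ψ := by
  refine fun M x xs => ?_
  obtain ⟨K, ⟨e⟩⟩ := exists_dField_of_model M.is_model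
  have hK : K.IsDClosed := StrongHomClass.theory_model (F := M ≃[opLang A m] K) e
  rw [Subsingleton.elim xs default, BoundedFormula.realize_iff]
  have h1 := h K hK fun a => e (x a)
  exact (StrongHomClass.realize_formula e φ).symm.trans
    (h1.trans (StrongHomClass.realize_formula e ψ))

theorem realize_relabel_id {L : FirstOrder.Language} {M : Type*} [L.Structure M] {α : Type*} {k : ℕ}
    (ψ : L.Formula (α ⊕ Fin k)) (a : α → M) (y : Fin k → M) :
    (BoundedFormula.relabel (n := k) id ψ).Realize a y ↔ ψ.Realize (Sum.elim a y) := by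
  refine BoundedFormula.realize_relabel.trans (iff_of_eq ?_)
  exact congrArg (BoundedFormula.Realize ψ (Sum.elim a y)) (Subsingleton.elim (α := Fin 0 → M) _ _)

end FreeOp

theorem mainTheorem10 {A : Type u} [Field A] {D : Type v} [CommRing D] [Algebra A D] {m t : ℕ}
    (S : FreeOp.OperatorData A D m) (P : FreeOp.LocalDecomposition S t) :
    -- every formula is equivalent to some `∃ y ψ(x, y)`, where `ψ(x, y)` is `ξ(Θ x, y, σ y)`
    (∀ (n : ℕ) (φ : (FreeOp.opLang A m).Formula (Fin n)),
      ∃ (ψ : (FreeOp.opLang A m).BoundedFormula (Fin n) 1)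
        (C : List (List ((FreeOp.algLang A).Formula (FreeOp.XYVar m t n)))),
        FreeOp.IsAlgebraicDNF C ∧
        (FreeOp.DCF0 S).Iff φ ψ.ex ∧
        ∀ K : FreeOp.DField.{u, v, w} S, K.IsDClosed →
          ∀ (a : Fin n → K) (b : K),
            ψ.Realize a (fun _ => b) ↔
              (FreeOp.dnf C).Realize
                (Sum.elim (FreeOp.thetaTuple P K a) (FreeOp.sigmaTuple P K b))) ∧
    -- if all associated endomorphisms are trivial, the quantifier may be omitted
    ((∀ K : FreeOp.DField.{u, v, u} S, K.IsDClosed →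
        ∀ (i : Fin (t + 1)) (r : K), P.assocEnd K.op i r = r) →
      ∀ (n : ℕ) (φ : (FreeOp.opLang A m).Formula (Fin n)),
        ∃ (ψ : (FreeOp.opLang A m).Formula (Fin n))
          (ξ : (FreeOp.algLang A).Formula (FreeOp.XVar m t n)),
          ψ.IsQF ∧ ξ.IsQF ∧
          (FreeOp.DCF0 S).Iff φ ψ ∧
          ∀ K : FreeOp.DField.{u, v, w} S, K.IsDClosed →
            ∀ a : Fin n → K, ψ.Realize a ↔ ξ.Realize (FreeOp.thetaTuple P K a)) := by
  open FirstOrder FirstOrder.Language FreeOp in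
  refine ⟨fun n φ => ?_, fun h n φ => ?_⟩
  · obtain ⟨C, hC, hφ⟩ := exists_algebraicDNF P φ
    -- Relabelling by `id` turns the free variable from `Fin 1` into the bound variable that `ex`
    -- quantifies.
    refine ⟨BoundedFormula.relabel (n := 1) id (translate P (dnf C)), C, hC, ?_,
      fun K hK a b => (realize_relabel_id _ _ _).trans
        (realize_translate P K (hK.isInversive P) _ _)⟩
    refine iff_of_isDClosed S _ _ fun K hK a => (hφ K hK a).trans ?_
    refine Iff.trans ?_ BoundedFormula.realize_ex.symm
    refine exists_congr fun y => ?_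
    refine Iff.trans ?_ (realize_relabel_id _ _ _).symm
    exact (realize_translate P K (hK.isInversive P) _ (Sum.elim a (Fin.snoc default y))).symm
  · obtain ⟨ξ, hξ, hφ⟩ := exists_dnf_of_assocEnd_eq P h φ
    refine ⟨translateQF ξ, ξ, isQF_translateQF hξ, hξ, ?_, fun K hK a =>
      realize_translateQF P K (assocEnd_eq_self_of_isDClosed P h hK) ξ a⟩
    refine iff_of_isDClosed S _ _ fun K hK a => ?_
    rw [hφ K hK, realize_translateQF P K (h K hK)]
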